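/- **Setting.** Let $0\le k\le n$ and let $\Omega$ be an open subset of $\mathbb H^n\cong\mathbb R^{4n}$, with coordinates $q_l=x_{4l}+\mathbf i x_{4l+1}+\mathbf j x_{4l+2}+\mathbf k x_{4l+3}$, $0\le l<n$. An upper semicontinuous function $u:\Omega\to[-\infty,\infty)$ is *plurisubharmonic* ($u\in PSH(\Omega)$) if it is subharmonic on each right quaternionic line $\{a+bq:\ q\in\mathbb H\}$, $a\in\mathbb H^n$, $0\ne b\in\mathbb H^n$ (intersected with $\Omega$). Let $\omega^0,\dots,\omega^{2n-1}$ be the basis of $\mathbb C^{2n}$, and put $$\begin{pmatrix}\nabla_{(2l)0}&\nabla_{(2l)1}\\ \nabla_{(2l+1)0}&\nabla_{(2l+1)1}\end{pmatrix}=\begin{pmatrix}\partial_{x_{4l}}+i\partial_{x_{4l+1}}&-\partial_{x_{4l+2}}-i\partial_{x_{4l+3}}\\ \partial_{x_{4l+2}}-i\partial_{x_{4l+3}}&\partial_{x_{4l}}-i\partial_{x_{4l+1}}\end{pmatrix},\qquad 0\le l<n,$$ $$d_\alpha\Big(\sum_I f_I\,\omega^I\Big)=\sum_{j,I}\nabla_{j\alpha}f_I\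 \omega^j\wedge\omega^I\quad(\alpha=0,1),\qquad \triangle=d_0d_1 .$$ A $p$-current on $\Omega$ is a continuous linear functional on the space $\mathcal D^{2n-p}(\Omega)=C_0^\infty(\Omega,\wedge^{2n-p}\mathbb C^{2n})$ of test forms; weak convergence of currents is convergence on each test form. If a current $T$ has (complex Radon) measure coefficients and $u$ is a locally bounded Borel function on $\Omega$, then $uT$ denotes the current obtained by multiplying the coefficients of $T$ by $u$. For an even-degree current $F$ one sets $(\triangle F)(\eta)=F(\triangle\eta)$. For $u_1,\dots,u_k\in PSH\cap L^\infty_{loc}(\Omega)$ the $2k$-current $\triangle u_1\wedge\dots\wedge\triangle u_k$ is defined inductively by $$\triangle u_1\wedge\triangle u_2\wedge\dots\wedge\triangle u_k:=\triangle\big(u_1\,\triangle u_2\wedge\dots\wedge\triangle u_k\big),$$ starting from the empty product, which is the $0$-current $1$: $f\,\omega^0\wedge\dots\wedge\omega^{2n-1}\mapsto\int_\Omega f\,dV$. **Theorem.** Let $v^1,\dots,v^k\in PSH\cap L^\infty_{loc}(\Omega)$, and for each $t=1,\dots,k$ let $(v_j^t)_{j\in\mathbb N}$ be a decreasing sequence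 of plurisubharmonic functions on $\Omega$ with $\lim_{j\to\infty}v_j^t=v^t$ pointwise in $\Omega$. Then the currents $\triangle v_j^1\wedge\dots\wedge\triangle v_j^k$ $(j\in\mathbb N)$ and $\triangle v^1\wedge\dots\wedge\triangle v^k$ are well defined, and $$\triangle v_j^1\wedge\dots\wedge\triangle v_j^k\ \longrightarrow\ \triangle v^1\wedge\dots\wedge\triangle v^k\quad\text{weakly as } j\to\infty .$$ -/

import Mathlib

open MeasureTheory Filter Topology
open TopologicalSpace (Opens)
open scoped Distributions LineDeriv ENNReal Quaternion

noncomputable section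

namespace QuatPluripotential

/-! ### Quaternionic space and plurisubharmonic functions -/

/-- `ℍⁿ ≅ ℝ⁴ⁿ`; the coordinate `(l, m)` is the real variable `x_{4l+m}`, that is,
`q_l = x_{4l} + i x_{4l+1} + j x_{4l+2} + k x_{4l+3}`. -/
abbrev HSpace (n : ℕ) : Type := EuclideanSpace ℝ (Fin n × Fin 4)

/-- The identification of `n`-tuples of quaternions with points of `ℝ⁴ⁿ`. -/
def ofQuat {n : ℕ} (w : Fin n → ℍ[ℝ]) : HSpace n :=
  WithLp.toLp 2 fun p => ![(w p.1).re, (w p.1).imI, (w p.1).imJ, (w p.1).imK] p.2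

/-- The point `a + b q` of the right quaternionic line through `a` with direction `b`, where the
quaternion `q = y₀ + i y₁ + j y₂ + k y₃` is given by its real coordinates. -/
def rightLine {n : ℕ} (a : HSpace n) (b : Fin n → ℍ[ℝ]) (y : EuclideanSpace ℝ (Fin 4)) :
    HSpace n :=
  a + ofQuat fun l => b l * ⟨y 0, y 1, y 2, y 3⟩

/-- The mean value over a ball of a `[-∞, ∞)`-valued function that is bounded above there. -/
def ballMean (f : EuclideanSpace ℝ (Fin 4) → EReal) (y : EuclideanSpace ℝ (Fin 4)) (r : ℝ) :
    EReal :=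
  ((⨍⁻ z in Metric.ball y r, (f z).toENNReal ∂volume : ℝ≥0∞) : EReal) -
    ((⨍⁻ z in Metric.ball y r, (-f z).toENNReal ∂volume : ℝ≥0∞) : EReal)

/-- Subharmonic functions `U → [-∞, ∞)` on an open subset of `ℝ⁴ ≅ ℍ`. -/
structure SubharmonicOn (f : EuclideanSpace ℝ (Fin 4) → EReal)
    (U : Set (EuclideanSpace ℝ (Fin 4))) : Prop where
  usc : UpperSemicontinuousOn f U
  lt_top : ∀ y ∈ U, f y < ⊤
  le_mean : ∀ y r, 0 < r → Metric.closedBall y r ⊆ U → f y ≤ ballMean f y r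

/-- Quaternionic plurisubharmonic functions `Ω → [-∞, ∞)`: upper semicontinuous and subharmonic
on each right quaternionic line. (The values of `u` outside `Ω` are irrelevant.) -/
structure PSH {n : ℕ} (Ω : Opens (HSpace n)) (u : HSpace n → EReal) : Prop where
  usc : UpperSemicontinuousOn u Ω
  lt_top : ∀ x ∈ Ω, u x < ⊤
  subharmonic : ∀ (a : HSpace n) (b : Fin n → ℍ[ℝ]), b ≠ 0 →
    SubharmonicOn (fun y => u (rightLine a b y)) {y | rightLine a b y ∈ Ω}

/-- `u ∈ L^∞_loc(Ω)`. -/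
def LocallyBounded {n : ℕ} (Ω : Opens (HSpace n)) (u : HSpace n → EReal) : Prop :=
  ∀ x ∈ Ω, ∃ C : ℝ, ∃ s ∈ 𝓝 x, ∀ᵐ y ∂(volume : Measure (HSpace n)),
    y ∈ s → ((-C : ℝ) : EReal) ≤ u y ∧ u y ≤ (C : EReal)

/-! ### Forms, and the operators `d₀`, `d₁` and `△` on test forms -/

/-- Increasing multi-indices of length `q` in `{0, …, 2n-1}`. -/
abbrev MultiIndex (n q : ℕ) : Type := {I : Finset (Fin (2 * n)) // I.card = q}

/-- `⋀^q ℂ²ⁿ`, an element `∑_I F_I ω^I` being given by its coefficients. -/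
abbrev Form (n q : ℕ) : Type := MultiIndex n q → ℂ

/-- The exterior multiplication `F ↦ ω^j ∧ F`: for `j ∉ I` one has `ω^j ∧ ω^I = ± ω^J`, where
`J = I ∪ {j}` and the sign is `(-1)^{#{i ∈ J, i < j}}`. -/
def omegaWedge {n : ℕ} (q : ℕ) (j : Fin (2 * n)) : Form n q →L[ℂ] Form n (q + 1) :=
  ContinuousLinearMap.pi fun J =>
    if h : j ∈ J.1 then
      ((-1 : ℂ) ^ (J.1.filter (· < j)).card) •
        (ContinuousLinearMap.proj (R := ℂ) (φ := fun _ : MultiIndex n q => ℂ)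
          ⟨J.1.erase j, by rw [Finset.card_erase_of_mem h, J.2]; rfl⟩)
    else 0

/-- Test `q`-forms, `𝓓^q(Ω) = C₀^∞(Ω, ⋀^q ℂ²ⁿ)`. -/
abbrev TestForm {n : ℕ} (Ω : Opens (HSpace n)) (q : ℕ) : Type := 𝓓(Ω, Form n q)

/-- The partial derivative `∂/∂x_{4l+m}`. -/
def partialDeriv {n q : ℕ} {Ω : Opens (HSpace n)} (l : Fin n) (m : Fin 4) (F : TestForm Ω q) :
    TestForm Ω q :=
  ∂_{(EuclideanSpace.single (l, m) (1 : ℝ) : HSpace n)} F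

/-- The operators `∇_{jα}`, acting on the coefficients of a form; the rows `j = 2l, 2l+1` are
`∂_{x_{4l}} + i ∂_{x_{4l+1}},   -∂_{x_{4l+2}} - i ∂_{x_{4l+3}}` and
`∂_{x_{4l+2}} - i ∂_{x_{4l+3}},   ∂_{x_{4l}} - i ∂_{x_{4l+1}}`. -/
def nabla {n q : ℕ} {Ω : Opens (HSpace n)} (j : Fin (2 * n)) (α : Fin 2) (F : TestForm Ω q) :
    TestForm Ω q :=
  let l : Fin n := ⟨j / 2, by omega⟩
  if (j : ℕ) % 2 = 0 then
    if α = 0 then partialDeriv l 0 F + Complex.I • partialDeriv l 1 F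
    else -partialDeriv l 2 F - Complex.I • partialDeriv l 3 F
  else
    if α = 0 then partialDeriv l 2 F - Complex.I • partialDeriv l 3 F
    else partialDeriv l 0 F - Complex.I • partialDeriv l 1 F

/-- `d_α F = ∑_{j,I} ∇_{jα} F_I ω^j ∧ ω^I`. -/
def dOp {n q : ℕ} {Ω : Opens (HSpace n)} (α : Fin 2) (F : TestForm Ω q) : TestForm Ω (q + 1) :=
  ∑ j : Fin (2 * n), TestFunction.postcompCLM (omegaWedge q j) (nabla j α F)

/-- The Baston operator `△ = d₀ d₁` on test forms. -/
def baston {n q : ℕ} {Ω : Opens (HSpace n)} (F : TestForm Ω q) : TestForm Ω (q + 2) :=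
  dOp 0 (dOp 1 F)

/-! ### Currents and the products `△u₁ ∧ ⋯ ∧ △u_k` -/

/-- Continuous linear functionals on the test `q`-forms, that is, `(2n-q)`-currents on `Ω`. -/
abbrev DualForm {n : ℕ} (Ω : Opens (HSpace n)) (q : ℕ) : Type := TestForm Ω q →L[ℂ] ℂ

/-- Complex Radon measures on `Ω`, written as `μ₀ + i μ₁ - μ₂ - i μ₃` with positive Radon measures
`μ₀, …, μ₃`. -/
structure ComplexRadonMeasure {n : ℕ} (Ω : Opens (HSpace n)) where
  part : Fin 4 → Measure (HSpace n)
  finite_on_compacts : ∀ m K, IsCompact K → K ⊆ (Ω : Set (HSpace n)) → part m K < ⊤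

/-- The integral over `Ω` with respect to a complex Radon measure. -/
def ComplexRadonMeasure.integral {n : ℕ} {Ω : Opens (HSpace n)} (μ : ComplexRadonMeasure Ω)
    (f : HSpace n → ℂ) : ℂ :=
  ∑ m : Fin 4, Complex.I ^ (m : ℕ) * ∫ x in (Ω : Set (HSpace n)), f x ∂(μ.part m)

/-- `T` has the measure coefficients `μ`: `T(φ) = ∑_I ∫ φ_I dμ_I` for every test form `φ`.
In terms of the expansion `T = ∑_I T_I ω^I` the measure `μ_I` is, up to the sign `ε`,
the coefficient of `T` at the multi-index complementary to `I`. -/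
def HasCoefficients {n q : ℕ} {Ω : Opens (HSpace n)} (T : DualForm Ω q)
    (μ : MultiIndex n q → ComplexRadonMeasure Ω) : Prop :=
  ∀ φ : TestForm Ω q, T φ = ∑ I, (μ I).integral fun x => φ x I

/-- `R = u T`, for a locally bounded function `u` and a current `T` with measure coefficients:
the coefficients of `u T` are those of `T` multiplied by `u`. -/
def IsMulCurrent {n q : ℕ} {Ω : Opens (HSpace n)} (u : HSpace n → EReal) (T R : DualForm Ω q) :
    Prop :=
  ∃ μ : MultiIndex n q → ComplexRadonMeasure Ω, HasCoefficients T μ ∧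
    ∀ φ : TestForm Ω q, R φ = ∑ I, (μ I).integral fun x => ((u x).toReal : ℂ) * φ x I

/-- `P` is the current `△u₁ ∧ ⋯ ∧ △u_k`, defined inductively by
`△u₁ ∧ △u₂ ∧ ⋯ ∧ △u_k = △(u₁ △u₂ ∧ ⋯ ∧ △u_k)`, where `(△R)(η) = R(△η)`.
The empty product is the `0`-current `1`, that is, `η = f ω⁰ ∧ ⋯ ∧ ω²ⁿ⁻¹ ↦ ∫_Ω f dV`.
(The product of `k` factors is a functional on test forms of degree `q = 2n - 2k`.) -/
def IsBastonProduct {n : ℕ} (Ω : Opens (HSpace n)) :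
    List (HSpace n → EReal) → (q : ℕ) → DualForm Ω q → Prop
  | [], q, P => ∀ η : TestForm Ω q,
      P η = ∫ x in (Ω : Set (HSpace n)),
        ∑ I : MultiIndex n q, if I.1 = Finset.univ then η x I else 0
  | u :: us, q, P => ∃ T R : DualForm Ω (q + 2),
      IsBastonProduct Ω us (q + 2) T ∧ IsMulCurrent u T R ∧
        ∀ η : TestForm Ω q, P η = R (baston η)

end QuatPluripotential

end

/-! The proof is the Bedford–Taylor argument, carried out on smooth approximations. The analysis is
done for an abstract mixed discriminant (`MixedForm`): a kernel alternating in each of two groups of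
indices, nonnegative on a convex cone of Hessians. Alternation makes the cofactors divergence free,
so a function outside and a function in a slot may be exchanged by integration by parts
(`integral_mul_ma_update`); positivity of the cone supplies the inequalities.

The central estimate is `LocalSeq.uniform_small`. Let `u j` be smooth, plurisubharmonic, decreasing,
uniformly bounded on a ball `B` and independent of `j` outside `B`. Then the integral of `u i - u j`
against the density of `w` is small for large `i ≤ j`, uniformly over all plurisubharmonic families
`w` with a given bound and a given mass on `B`. With `N` slots, integration by parts bounds the
integral of `(u i - u j) ^ (N + 1)` by a multiple of the integral of `u i - u j` against the pure
density of `u j`, and this is at most the drop of the energy, a bounded monotone sequence. No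
capacity or quasicontinuity is needed. It follows that the densities converge weakly
(`LocalSeq.cauchySeq`), and that in the limit they may be multiplied by a further decreasing
sequence (`IsLimitMeasure.tendsto_mul`). Gluing with a paraboloid reduces the general case to
sequences fixed outside a ball (`Approx.localize`).

Smooth approximations come from taking suprema over small balls and then mollifying
(`PSH.exists_majorant`). From majorants of the members of a decreasing sequence, `exists_diagonal`
extracts a sequence which itself decreases to the limit, up to added constants `(1/2)^m`.
Interleaving two approximations shows that weak limits do not depend on the choice
(`Approx.tendsto_of_tendsto`).

The algebra shows that the Baston product fits this scheme. For rank-one Hessians the top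
coefficient is the determinant of a quaternionic matrix, hence nonnegative, and invariance under
right multiplications extends this to the cone of quaternionic plurisubharmonicity
(`quatDisc_nonneg`). Every `ω^I` of even degree is a combination of products of positive `2`-forms
(`exists_omega_eq_sum`), so each coefficient of a product of `k` factors is a combination of full
mixed discriminants with quadratic functions in the other `n - k` slots.

Together these show that every Baston product is the limit of the smooth products of every
approximating family (`IsBastonProduct.isLimitCurrent`). Existence and uniqueness follow, and the
theorem is a last diagonal argument (`tendsto_bastonProduct`). -/

open scoped ContDiff

set_option linter.unusedSectionVars false

noncomputable section

namespace QuatPluripotential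


/-! ### Partial derivatives and Hessians -/

section Calculus

variable {ι : Type*} [Fintype ι] [DecidableEq ι]

/-- The partial derivative of a function on `ℝ^ι` in the direction `p`. -/
def pd (p : ι) (w : EuclideanSpace ℝ ι → ℝ) (x : EuclideanSpace ℝ ι) : ℝ :=
  fderiv ℝ w x (EuclideanSpace.single p 1)

/-- The Hessian matrix. -/
def hess (w : EuclideanSpace ℝ ι → ℝ) (x : EuclideanSpace ℝ ι) : Matrix ι ι ℝ :=
  fun p q => pd p (pd q w) x

variable {w f g : EuclideanSpace ℝ ι → ℝ} {p q : ι} {x : EuclideanSpace ℝ ι}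

lemma contDiff_pd (hw : ContDiff ℝ ∞ w) : ContDiff ℝ ∞ (pd p w) :=
  (hw.fderiv_right (m := ∞) (by simp)).clm_apply contDiff_const

lemma contDiff_hess (hw : ContDiff ℝ ∞ w) : ContDiff ℝ ∞ (fun x => hess w x p q) :=
  contDiff_pd (contDiff_pd hw)

lemma _root_.ContDiff.diffAt (hw : ContDiff ℝ ∞ w) : DifferentiableAt ℝ w x :=
  (hw.differentiable (by simp)).differentiableAt

lemma pd_add (hf : ContDiff ℝ ∞ f) (hg : ContDiff ℝ ∞ g) :
    pd p (fun x => f x + g x) = fun x => pd p f x + pd p g x := by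
  funext x
  simp [pd, fderiv_fun_add hf.diffAt hg.diffAt]

lemma pd_sub (hf : ContDiff ℝ ∞ f) (hg : ContDiff ℝ ∞ g) :
    pd p (fun x => f x - g x) = fun x => pd p f x - pd p g x := by
  funext x
  simp [pd, fderiv_fun_sub hf.diffAt hg.diffAt]

lemma pd_mul (hf : ContDiff ℝ ∞ f) (hg : ContDiff ℝ ∞ g) :
    pd p (fun x => f x * g x) = fun x => pd p f x * g x + f x * pd p g x := by
  funext x
  simp only [pd, fderiv_fun_mul hf.diffAt hg.diffAt]
  simp; ring

@[simp] lemma pd_const (c : ℝ) : pd p (fun _ => c) = fun _ => 0 := by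
  funext x
  simp [pd]

lemma pd_const_mul (hf : ContDiff ℝ ∞ f) (c : ℝ) :
    pd p (fun x => c * f x) = fun x => c * pd p f x := by
  rw [pd_mul contDiff_const hf]; simp

lemma pd_comp {φ : ℝ → ℝ} (hφ : ContDiff ℝ ∞ φ) (hf : ContDiff ℝ ∞ f) :
    pd p (fun x => φ (f x)) = fun x => deriv φ (f x) * pd p f x := by
  funext x
  have h := (((hφ.differentiable (by simp)) (f x)).hasDerivAt.comp_hasFDerivAt x
    hf.diffAt.hasFDerivAt)
  have h2 := h.fderiv
  simp only [pd]
  change (fderiv ℝ (φ ∘ f) x) _ = _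
  rw [h2]; simp

lemma pd_prod {σ : Type*} [DecidableEq σ] (s : Finset σ) {F : σ → EuclideanSpace ℝ ι → ℝ}
    (hF : ∀ i, ContDiff ℝ ∞ (F i)) :
    pd p (fun x => ∏ i ∈ s, F i x) =
      fun x => ∑ i ∈ s, (∏ j ∈ s.erase i, F j x) * pd p (F i) x := by
  funext x
  simp only [pd]
  rw [fderiv_finsetProd (fun i _ => (hF i).diffAt)]
  simp

lemma pd_congr (h : f =ᶠ[𝓝 x] g) : pd p f x = pd p g x := by
  simp only [pd, h.fderiv_eq]

lemma pd_eventuallyEq (h : f =ᶠ[𝓝 x] g) : pd p f =ᶠ[𝓝 x] pd p g := by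
  filter_upwards [h.eventuallyEq_nhds] with y hy using pd_congr hy

lemma hess_congr (h : f =ᶠ[𝓝 x] g) : hess f x = hess g x := by
  ext p q
  exact pd_congr (pd_eventuallyEq h)

lemma pd_comm (hw : ContDiff ℝ ∞ w) : pd p (pd q w) x = pd q (pd p w) x := by
  have h2 : IsSymmSndFDerivAt ℝ w x :=
    (hw.contDiffAt).isSymmSndFDerivAt (by
      rw [minSmoothness_of_isRCLikeNormedField]; exact WithTop.coe_le_coe.2 (le_top : (2 : ℕ∞) ≤ ⊤))
  have hd : DifferentiableAt ℝ (fderiv ℝ w) x :=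
    ((hw.fderiv_right (m := ∞) (by simp)).differentiable (by simp)).differentiableAt
  have key : ∀ v u : EuclideanSpace ℝ ι,
      fderiv ℝ (fun y => fderiv ℝ w y v) x u = fderiv ℝ (fderiv ℝ w) x u v := by
    intro v u
    rw [fderiv_clm_apply hd (differentiableAt_const v)]
    simp
  change fderiv ℝ (fun y => fderiv ℝ w y _) x _ = fderiv ℝ (fun y => fderiv ℝ w y _) x _
  rw [key, key, h2.eq]

lemma hess_apply (p q : ι) : hess w x p q = pd p (pd q w) x := rfl

lemma hess_symm (hw : ContDiff ℝ ∞ w) : (hess w x).IsSymm := by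
  ext p q
  exact pd_comm hw

lemma hess_add (hf : ContDiff ℝ ∞ f) (hg : ContDiff ℝ ∞ g) :
    hess (fun x => f x + g x) x = hess f x + hess g x := by
  ext p q
  simp only [hess_apply, Matrix.add_apply, pd_add hf hg, pd_add (contDiff_pd hf) (contDiff_pd hg)]

lemma hess_sub (hf : ContDiff ℝ ∞ f) (hg : ContDiff ℝ ∞ g) :
    hess (fun x => f x - g x) x = hess f x - hess g x := by
  ext p q
  simp only [hess_apply, Matrix.sub_apply, pd_sub hf hg, pd_sub (contDiff_pd hf) (contDiff_pd hg)]

@[simp] lemma hess_const (c : ℝ) : hess (fun _ : EuclideanSpace ℝ ι => c) x = 0 := by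
  ext p q
  simp [hess_apply]

lemma hess_add_const (hf : ContDiff ℝ ∞ f) (c : ℝ) :
    hess (fun x => f x + c) x = hess f x := by
  rw [hess_add hf contDiff_const]; simp

/-- The gradient, as a vector of partial derivatives. -/
def gradVec (w : EuclideanSpace ℝ ι → ℝ) (x : EuclideanSpace ℝ ι) : ι → ℝ := fun p => pd p w x

lemma hess_comp {φ : ℝ → ℝ} (hφ : ContDiff ℝ ∞ φ) (hf : ContDiff ℝ ∞ f) :
    hess (fun x => φ (f x)) x = deriv φ (f x) • hess f x +
      deriv (deriv φ) (f x) • Matrix.vecMulVec (gradVec f x) (gradVec f x) := by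
  have hφ' : ContDiff ℝ ∞ (deriv φ) := (contDiff_infty_iff_deriv.1 hφ).2
  ext p q
  simp only [hess_apply, pd_comp hφ hf, Matrix.add_apply, Matrix.smul_apply, smul_eq_mul,
    Matrix.vecMulVec_apply, gradVec]
  rw [pd_mul (f := fun x => deriv φ (f x)) (hφ'.comp hf) (contDiff_pd hf), pd_comp hφ' hf]
  ring

lemma hasCompactSupport_pd (hf : HasCompactSupport f) : HasCompactSupport (pd p f) :=
  HasCompactSupport.intro hf fun x hx => by
    have : f =ᶠ[𝓝 x] fun _ => 0 := notMem_tsupport_iff_eventuallyEq.1 hx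
    rw [pd_congr this]; simp

lemma integral_pd_eq_zero (hf : ContDiff ℝ ∞ f) (hc : HasCompactSupport f) :
    ∫ x, pd p f x = 0 := by
  have h := integral_mul_fderiv_eq_neg_fderiv_mul_of_integrable (μ := volume)
    (f := fun _ : EuclideanSpace ℝ ι => (1 : ℝ)) (g := f) (v := EuclideanSpace.single p 1)
    (by simp) (by
      simp only [one_mul]
      exact (contDiff_pd (p := p) hf).continuous.integrable_of_hasCompactSupport
        (hasCompactSupport_pd hc)) (by
      simp only [one_mul]
      exact hf.continuous.integrable_of_hasCompactSupport hc)
    (fun _ _ => differentiableAt_const _) (fun _ _ => hf.diffAt)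
  simpa [pd] using h

end Calculus

/-! ### Mixed discriminants and their integration by parts -/

/-- An abstract mixed discriminant: a kernel which is alternating in each of its two groups of
indices and which is nonnegative on a convex cone of matrices containing the positive
semidefinite ones. -/
structure MixedForm (ι σ : Type*) [Fintype ι] [DecidableEq ι] [Fintype σ] [DecidableEq σ] where
  ker : (σ → ι) → (σ → ι) → ℝ
  swap_left : ∀ P Q i j, i ≠ j → ker (P ∘ Equiv.swap i j) Q = -ker P Q
  swap_right : ∀ P Q i j, i ≠ j → ker P (Q ∘ Equiv.swap i j) = -ker P Q
  cone : Set (Matrix ι ι ℝ)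
  psd_mem : ∀ A : Matrix ι ι ℝ, A.PosSemidef → A ∈ cone
  add_mem : ∀ A B, A ∈ cone → B ∈ cone → A + B ∈ cone
  smul_mem : ∀ (c : ℝ) A, 0 ≤ c → A ∈ cone → c • A ∈ cone
  nonneg : ∀ A : σ → Matrix ι ι ℝ, (∀ i, A i ∈ cone) →
    0 ≤ ∑ P, ∑ Q, ker P Q * ∏ i, A i (P i) (Q i)

namespace MixedForm

variable {ι σ : Type*} [Fintype ι] [DecidableEq ι] [Fintype σ] [DecidableEq σ]
variable (𝓜 : MixedForm ι σ)

/-- The mixed discriminant as a multilinear map. -/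
def disc : MultilinearMap ℝ (fun _ : σ => Matrix ι ι ℝ) ℝ :=
  ∑ P : σ → ι, ∑ Q : σ → ι, 𝓜.ker P Q •
    (MultilinearMap.mkPiAlgebra ℝ σ ℝ).compLinearMap
      (fun i => Matrix.entryLinearMap ℝ ℝ (P i) (Q i))

lemma disc_apply (A : σ → Matrix ι ι ℝ) :
    𝓜.disc A = ∑ P, ∑ Q, 𝓜.ker P Q * ∏ i, A i (P i) (Q i) := by
  simp [disc]

lemma disc_nonneg {A : σ → Matrix ι ι ℝ} (hA : ∀ i, A i ∈ 𝓜.cone) : 0 ≤ 𝓜.disc A := by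
  rw [disc_apply]; exact 𝓜.nonneg A hA

/-- The mixed Monge–Ampère density of a family of functions. -/
def ma (w : σ → EuclideanSpace ℝ ι → ℝ) (x : EuclideanSpace ℝ ι) : ℝ :=
  𝓜.disc fun i => hess (w i) x

variable {w : σ → EuclideanSpace ℝ ι → ℝ} {f g : EuclideanSpace ℝ ι → ℝ} {i : σ}

lemma ma_update_apply (x : EuclideanSpace ℝ ι) :
    𝓜.ma (Function.update w i g) x =
      𝓜.disc (Function.update (fun r => hess (w r) x) i (hess g x)) := by
  unfold ma
  congr 1
  funext r
  by_cases h : r = i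
  · subst h; simp
  · simp [h]

lemma ma_contDiff (hw : ∀ i, ContDiff ℝ ∞ (w i)) : ContDiff ℝ ∞ (𝓜.ma w) := by
  have : 𝓜.ma w = fun x => ∑ P, ∑ Q, 𝓜.ker P Q * ∏ i, hess (w i) x (P i) (Q i) := by
    funext x; exact 𝓜.disc_apply _
  rw [this]
  exact ContDiff.sum fun P _ => ContDiff.sum fun Q _ => contDiff_const.mul
    (contDiff_prod fun i _ => contDiff_hess (hw i))

lemma update_contDiff (hw : ∀ i, ContDiff ℝ ∞ (w i)) (hg : ContDiff ℝ ∞ g) (r : σ) :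
    ContDiff ℝ ∞ (Function.update w i g r) := by
  by_cases h : r = i
  · subst h; simpa using hg
  · simpa [h] using hw r

/-- The product of all Hessian entries but that of the slot `i`. -/
def cofactor (w : σ → EuclideanSpace ℝ ι → ℝ) (i : σ) (P Q : σ → ι) (x : EuclideanSpace ℝ ι) : ℝ :=
  ∏ r ∈ Finset.univ.erase i, hess (w r) x (P r) (Q r)

lemma contDiff_cofactor (hw : ∀ i, ContDiff ℝ ∞ (w i)) (P Q : σ → ι) :
    ContDiff ℝ ∞ (cofactor w i P Q) :=
  contDiff_prod fun r _ => contDiff_hess (hw r)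

lemma ma_update (x : EuclideanSpace ℝ ι) :
    𝓜.ma (Function.update w i g) x =
      ∑ P, ∑ Q, 𝓜.ker P Q * (hess g x (P i) (Q i) * cofactor w i P Q x) := by
  rw [ma_update_apply, disc_apply]
  refine Finset.sum_congr rfl fun P _ => Finset.sum_congr rfl fun Q _ => ?_
  rw [← Finset.mul_prod_erase _ _ (Finset.mem_univ i), cofactor]
  congr 2
  · simp
  · refine Finset.prod_congr rfl fun r hr => ?_
    rw [Function.update_of_ne (Finset.ne_of_mem_erase hr)]

/-- A transposition of the slots permutes the multi-indices, so the sum equals its own negative. -/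
lemma sum_eq_zero_of_swap {i r : σ} (F : (σ → ι) → ℝ)
    (hF : ∀ P, F (P ∘ Equiv.swap i r) = -F P) : ∑ P, F P = 0 := by
  have h : ∑ P, F P = ∑ P, F (P ∘ Equiv.swap i r) :=
    (Equiv.sum_comp (Equiv.arrowCongr (Equiv.swap i r) (Equiv.refl ι)) F).symm.trans
      (Finset.sum_congr rfl fun P _ => by
        congr 1)
  simp only [hF, Finset.sum_neg_distrib] at h
  linarith

/-- Cofactors are divergence free: differentiating the factor of slot `r` in direction `P i` gives a
third derivative symmetric in `P i` and `P r`, while the kernel changes sign when these two are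
exchanged. -/
lemma sum_ker_pd_cofactor_left (hw : ∀ i, ContDiff ℝ ∞ (w i)) (Q : σ → ι)
    (a : EuclideanSpace ℝ ι) :
    ∑ P, 𝓜.ker P Q * pd (P i) (cofactor w i P Q) a = 0 := by
  have h1 : ∀ P, pd (P i) (cofactor w i P Q) a = ∑ r ∈ Finset.univ.erase i,
      (∏ s ∈ (Finset.univ.erase i).erase r, hess (w s) a (P s) (Q s)) *
        pd (P i) (fun x => hess (w r) x (P r) (Q r)) a := by
    intro P
    have := congrFun (pd_prod (p := P i) (Finset.univ.erase i)
      (F := fun r x => hess (w r) x (P r) (Q r)) (fun r => contDiff_hess (hw r))) a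
    exact this
  simp only [h1, Finset.mul_sum]
  rw [Finset.sum_comm]
  refine Finset.sum_eq_zero fun r hr => ?_
  have hri : r ≠ i := Finset.ne_of_mem_erase hr
  refine sum_eq_zero_of_swap (i := i) (r := r) _ fun P => ?_
  rw [𝓜.swap_left P Q i r hri.symm]
  have h2 : ∏ s ∈ (Finset.univ.erase i).erase r, hess (w s) a ((P ∘ Equiv.swap i r) s) (Q s) =
      ∏ s ∈ (Finset.univ.erase i).erase r, hess (w s) a (P s) (Q s) := by
    refine Finset.prod_congr rfl fun s hs => ?_
    have hsr : s ≠ r := Finset.ne_of_mem_erase hs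
    have hsi : s ≠ i := Finset.ne_of_mem_erase (Finset.mem_of_mem_erase hs)
    simp [Equiv.swap_apply_of_ne_of_ne hsi hsr]
  have h3 : pd ((P ∘ Equiv.swap i r) i) (fun x => hess (w r) x ((P ∘ Equiv.swap i r) r) (Q r)) a =
      pd (P i) (fun x => hess (w r) x (P r) (Q r)) a := by
    simp only [Function.comp, Equiv.swap_apply_left, Equiv.swap_apply_right]
    exact pd_comm (contDiff_pd (hw r))
  rw [h2, h3]; ring

lemma sum_ker_pd_cofactor_right (hw : ∀ i, ContDiff ℝ ∞ (w i)) (P : σ → ι)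
    (a : EuclideanSpace ℝ ι) :
    ∑ Q, 𝓜.ker P Q * pd (Q i) (cofactor w i P Q) a = 0 := by
  have h1 : ∀ Q, pd (Q i) (cofactor w i P Q) a = ∑ r ∈ Finset.univ.erase i,
      (∏ s ∈ (Finset.univ.erase i).erase r, hess (w s) a (P s) (Q s)) *
        pd (Q i) (fun x => hess (w r) x (P r) (Q r)) a := by
    intro Q
    have := congrFun (pd_prod (p := Q i) (Finset.univ.erase i)
      (F := fun r x => hess (w r) x (P r) (Q r)) (fun r => contDiff_hess (hw r))) a
    exact this
  simp only [h1, Finset.mul_sum]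
  rw [Finset.sum_comm]
  refine Finset.sum_eq_zero fun r hr => ?_
  have hri : r ≠ i := Finset.ne_of_mem_erase hr
  refine sum_eq_zero_of_swap (i := i) (r := r) _ fun Q => ?_
  rw [𝓜.swap_right P Q i r hri.symm]
  have h2 : ∏ s ∈ (Finset.univ.erase i).erase r, hess (w s) a (P s) ((Q ∘ Equiv.swap i r) s) =
      ∏ s ∈ (Finset.univ.erase i).erase r, hess (w s) a (P s) (Q s) := by
    refine Finset.prod_congr rfl fun s hs => ?_
    have hsr : s ≠ r := Finset.ne_of_mem_erase hs
    have hsi : s ≠ i := Finset.ne_of_mem_erase (Finset.mem_of_mem_erase hs)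
    simp [Equiv.swap_apply_of_ne_of_ne hsi hsr]
  have h3 : pd ((Q ∘ Equiv.swap i r) i) (fun x => hess (w r) x (P r) ((Q ∘ Equiv.swap i r) r)) a =
      pd (Q i) (fun x => hess (w r) x (P r) (Q r)) a := by
    simp only [Function.comp, Equiv.swap_apply_left, Equiv.swap_apply_right]
    -- The index to be exchanged with `Q i` is the inner one of the Hessian; transposing brings it
    -- to the outside.
    have hc : ∀ q q' : ι, (fun x => hess (w r) x q q') = fun x => hess (w r) x q' q :=
      fun q q' => funext fun x => pd_comm (hw r)
    rw [hc, hc (P r) (Q r)]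
    exact pd_comm (contDiff_pd (hw r))
  rw [h2, h3]; ring

/-- Both integrals are compared with one gradient expression. In each case integrand plus gradient
terms is a sum of derivatives of compactly supported functions, up to the divergence of the
cofactors, which vanishes. The first identity uses the divergence in `P`, the second that in `Q`, so
that the same expression appears in both. -/
lemma integral_mul_ma_update_aux (hw : ∀ i, ContDiff ℝ ∞ (w i)) (hf : ContDiff ℝ ∞ f)
    (hg : ContDiff ℝ ∞ g) (hc : HasCompactSupport f ∨ HasCompactSupport g) :
    ∫ x, f x * 𝓜.ma (Function.update w i g) x = -∫ x, ∑ P, ∑ Q,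
      𝓜.ker P Q * (pd (P i) f x * pd (Q i) g x * cofactor w i P Q x) ∧
    ∫ x, g x * 𝓜.ma (Function.update w i f) x = -∫ x, ∑ P, ∑ Q,
      𝓜.ker P Q * (pd (P i) f x * pd (Q i) g x * cofactor w i P Q x) := by
  have hcof := fun P Q => contDiff_cofactor (i := i) hw P Q
  have hintg : ∀ F : EuclideanSpace ℝ ι → ℝ, ContDiff ℝ ∞ F → HasCompactSupport F →
      Integrable F := fun F h1 h2 => h1.continuous.integrable_of_hasCompactSupport h2
  have hA : ∀ P Q, ContDiff ℝ ∞ fun x => f x * (pd (Q i) g x * cofactor w i P Q x) :=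
    fun P Q => hf.mul ((contDiff_pd hg).mul (hcof P Q))
  have hB : ∀ P Q, ContDiff ℝ ∞ fun x => g x * (pd (P i) f x * cofactor w i P Q x) :=
    fun P Q => hg.mul ((contDiff_pd hf).mul (hcof P Q))
  have hAc : ∀ P Q, HasCompactSupport fun x => f x * (pd (Q i) g x * cofactor w i P Q x) := by
    intro P Q
    rcases hc with h | h
    · exact h.mul_right
    · exact ((hasCompactSupport_pd h).mul_right).mul_left
  have hBc : ∀ P Q, HasCompactSupport fun x => g x * (pd (P i) f x * cofactor w i P Q x) := by
    intro P Q
    rcases hc with h | h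
    · exact ((hasCompactSupport_pd h).mul_right).mul_left
    · exact h.mul_right
  have hG : ContDiff ℝ ∞ fun x => ∑ P, ∑ Q,
      𝓜.ker P Q * (pd (P i) f x * pd (Q i) g x * cofactor w i P Q x) :=
    ContDiff.sum fun P _ => ContDiff.sum fun Q _ => contDiff_const.mul
      (((contDiff_pd hf).mul (contDiff_pd hg)).mul (hcof P Q))
  have hGc : HasCompactSupport fun x => ∑ P, ∑ Q,
      𝓜.ker P Q * (pd (P i) f x * pd (Q i) g x * cofactor w i P Q x) := by
    rcases hc with h | h
    · refine HasCompactSupport.intro h fun x hx => ?_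
      have : f =ᶠ[𝓝 x] fun _ => 0 := notMem_tsupport_iff_eventuallyEq.1 hx
      simp [pd_congr this]
    · refine HasCompactSupport.intro h fun x hx => ?_
      have : g =ᶠ[𝓝 x] fun _ => 0 := notMem_tsupport_iff_eventuallyEq.1 hx
      simp [pd_congr this]
  have hL1 : ContDiff ℝ ∞ fun x => f x * 𝓜.ma (Function.update w i g) x :=
    hf.mul (𝓜.ma_contDiff (update_contDiff hw hg))
  have hL2 : ContDiff ℝ ∞ fun x => g x * 𝓜.ma (Function.update w i f) x :=
    hg.mul (𝓜.ma_contDiff (update_contDiff hw hf))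
  have hzero : ∀ {φ : EuclideanSpace ℝ ι → ℝ} (x : EuclideanSpace ℝ ι), x ∉ tsupport φ →
      𝓜.ma (Function.update w i φ) x = 0 := by
    intro φ x hx
    have : φ =ᶠ[𝓝 x] fun _ => 0 := notMem_tsupport_iff_eventuallyEq.1 hx
    rw [ma_update]
    simp [hess_congr this]
  have hL1c : HasCompactSupport fun x => f x * 𝓜.ma (Function.update w i g) x := by
    rcases hc with h | h
    · exact h.mul_right
    · exact HasCompactSupport.intro h fun x hx => by simp [hzero x hx]
  have hL2c : HasCompactSupport fun x => g x * 𝓜.ma (Function.update w i f) x := by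
    rcases hc with h | h
    · exact HasCompactSupport.intro h fun x hx => by simp [hzero x hx]
    · exact h.mul_right
  constructor
  · rw [eq_neg_iff_add_eq_zero, ← integral_add (hintg _ hL1 hL1c) (hintg _ hG hGc)]
    have hptw : ∀ x, f x * 𝓜.ma (Function.update w i g) x + ∑ P, ∑ Q,
        𝓜.ker P Q * (pd (P i) f x * pd (Q i) g x * cofactor w i P Q x) =
        ∑ P, ∑ Q, 𝓜.ker P Q *
          pd (P i) (fun x => f x * (pd (Q i) g x * cofactor w i P Q x)) x := by
      intro x
      have e : ∀ P Q, 𝓜.ker P Q *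
          pd (P i) (fun x => f x * (pd (Q i) g x * cofactor w i P Q x)) x =
          f x * (𝓜.ker P Q * (hess g x (P i) (Q i) * cofactor w i P Q x)) +
          𝓜.ker P Q * (pd (P i) f x * pd (Q i) g x * cofactor w i P Q x) +
          f x * pd (Q i) g x * (𝓜.ker P Q * pd (P i) (cofactor w i P Q) x) := by
        intro P Q
        rw [pd_mul hf ((contDiff_pd hg).mul (hcof P Q)), pd_mul (contDiff_pd hg) (hcof P Q),
          hess_apply]
        ring
      simp only [e, Finset.sum_add_distrib]
      rw [Finset.sum_comm (f := fun P Q => f x * pd (Q i) g x *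
        (𝓜.ker P Q * pd (P i) (cofactor w i P Q) x))]
      simp only [← Finset.mul_sum]
      simp only [𝓜.sum_ker_pd_cofactor_left hw, mul_zero, Finset.sum_const_zero, add_zero]
      rw [ma_update]
    simp only [hptw]
    have hi : ∀ P Q, Integrable fun x => 𝓜.ker P Q *
        pd (P i) (fun x => f x * (pd (Q i) g x * cofactor w i P Q x)) x := fun P Q =>
      (hintg _ (contDiff_pd (hA P Q)) (hasCompactSupport_pd (hAc P Q))).const_mul _
    rw [integral_finsetSum _ (fun P _ => integrable_finsetSum _ fun Q _ => hi P Q)]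
    refine Finset.sum_eq_zero fun P _ => ?_
    rw [integral_finsetSum _ (fun Q _ => hi P Q)]
    refine Finset.sum_eq_zero fun Q _ => ?_
    rw [integral_const_mul, integral_pd_eq_zero (hA P Q) (hAc P Q), mul_zero]
  · rw [eq_neg_iff_add_eq_zero, ← integral_add (hintg _ hL2 hL2c) (hintg _ hG hGc)]
    have hptw : ∀ x, g x * 𝓜.ma (Function.update w i f) x + ∑ P, ∑ Q,
        𝓜.ker P Q * (pd (P i) f x * pd (Q i) g x * cofactor w i P Q x) =
        ∑ P, ∑ Q, 𝓜.ker P Q *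
          pd (Q i) (fun x => g x * (pd (P i) f x * cofactor w i P Q x)) x := by
      intro x
      have e : ∀ P Q, 𝓜.ker P Q *
          pd (Q i) (fun x => g x * (pd (P i) f x * cofactor w i P Q x)) x =
          g x * (𝓜.ker P Q * (hess f x (P i) (Q i) * cofactor w i P Q x)) +
          𝓜.ker P Q * (pd (P i) f x * pd (Q i) g x * cofactor w i P Q x) +
          g x * pd (P i) f x * (𝓜.ker P Q * pd (Q i) (cofactor w i P Q) x) := by
        intro P Q
        rw [pd_mul hg ((contDiff_pd hf).mul (hcof P Q)), pd_mul (contDiff_pd hf) (hcof P Q),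
          hess_apply, pd_comm (p := P i) hf]
        ring
      simp only [e, Finset.sum_add_distrib]
      simp only [← Finset.mul_sum]
      simp only [𝓜.sum_ker_pd_cofactor_right hw, mul_zero, Finset.sum_const_zero, add_zero]
      rw [ma_update]
    simp only [hptw]
    have hi : ∀ P Q, Integrable fun x => 𝓜.ker P Q *
        pd (Q i) (fun x => g x * (pd (P i) f x * cofactor w i P Q x)) x := fun P Q =>
      (hintg _ (contDiff_pd (hB P Q)) (hasCompactSupport_pd (hBc P Q))).const_mul _
    rw [integral_finsetSum _ (fun P _ => integrable_finsetSum _ fun Q _ => hi P Q)]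
    refine Finset.sum_eq_zero fun P _ => ?_
    rw [integral_finsetSum _ (fun Q _ => hi P Q)]
    refine Finset.sum_eq_zero fun Q _ => ?_
    rw [integral_const_mul, integral_pd_eq_zero (hB P Q) (hBc P Q), mul_zero]

/-- Integration by parts for mixed Monge–Ampère densities. -/
theorem integral_mul_ma_update (hw : ∀ i, ContDiff ℝ ∞ (w i)) (hf : ContDiff ℝ ∞ f)
    (hg : ContDiff ℝ ∞ g) (hc : HasCompactSupport f ∨ HasCompactSupport g) :
    ∫ x, f x * 𝓜.ma (Function.update w i g) x = ∫ x, g x * 𝓜.ma (Function.update w i f) x := by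
  obtain ⟨h1, h2⟩ := 𝓜.integral_mul_ma_update_aux (i := i) hw hf hg hc
  rw [h1, h2]

end MixedForm

/-! ### Estimates for smooth plurisubharmonic functions -/

namespace MixedForm

variable {ι σ : Type*} [Fintype ι] [DecidableEq ι] [Fintype σ] [DecidableEq σ]
variable (𝓜 : MixedForm ι σ)

/-- Smooth functions whose Hessian lies everywhere in the cone. -/
structure SmoothPsh (w : EuclideanSpace ℝ ι → ℝ) : Prop where
  contDiff : ContDiff ℝ ∞ w
  mem_cone : ∀ x, hess w x ∈ 𝓜.cone

variable {𝓜} in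
lemma SmoothPsh.update {w : σ → EuclideanSpace ℝ ι → ℝ} {g : EuclideanSpace ℝ ι → ℝ} {i : σ}
    (hw : ∀ r, 𝓜.SmoothPsh (w r)) (hg : 𝓜.SmoothPsh g) (r : σ) :
    𝓜.SmoothPsh (Function.update w i g r) := by
  by_cases h : r = i
  · subst h; simpa using hg
  · simpa [h] using hw r

lemma ma_nonneg {w : σ → EuclideanSpace ℝ ι → ℝ} (hw : ∀ r, 𝓜.SmoothPsh (w r))
    (x : EuclideanSpace ℝ ι) : 0 ≤ 𝓜.ma w x :=
  𝓜.disc_nonneg fun r => (hw r).mem_cone x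

lemma posSemidef_vecMulVec (a : ι → ℝ) : (Matrix.vecMulVec a a).PosSemidef := by
  simpa using Matrix.posSemidef_vecMulVec_self_star a

variable {w : σ → EuclideanSpace ℝ ι → ℝ} {f g a b : EuclideanSpace ℝ ι → ℝ} {i : σ}

lemma ma_update_sub (ha : ContDiff ℝ ∞ a) (hb : ContDiff ℝ ∞ b) (x : EuclideanSpace ℝ ι) :
    𝓜.ma (Function.update w i fun x => a x - b x) x =
      𝓜.ma (Function.update w i a) x - 𝓜.ma (Function.update w i b) x := by
  rw [ma_update_apply, ma_update_apply, ma_update_apply, hess_sub ha hb,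
    MultilinearMap.map_update_sub]

lemma ma_update_congr {x : EuclideanSpace ℝ ι} (h : hess f x = hess g x) :
    𝓜.ma (Function.update w i f) x = 𝓜.ma (Function.update w i g) x := by
  rw [ma_update_apply, ma_update_apply, h]

lemma ma_update_eq_zero {x : EuclideanSpace ℝ ι} (hx : x ∉ tsupport g) :
    𝓜.ma (Function.update w i g) x = 0 := by
  have : g =ᶠ[𝓝 x] fun _ => 0 := notMem_tsupport_iff_eventuallyEq.1 hx
  rw [ma_update_apply, hess_congr this]
  simp [MultilinearMap.map_update_zero]

lemma hasCompactSupport_ma_update (hg : HasCompactSupport g) :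
    HasCompactSupport (𝓜.ma (Function.update w i g)) :=
  HasCompactSupport.intro hg fun _ hx => 𝓜.ma_update_eq_zero hx

/-- The second-order chain rule produces an extra term with the rank-one matrix `∇g ⊗ ∇g` in slot
`i`; this matrix is positive semidefinite, so the term has a sign that can be exploited. -/
lemma ma_update_pow (hg : ContDiff ℝ ∞ g) (p : ℕ) (x : EuclideanSpace ℝ ι) :
    𝓜.ma (Function.update w i fun x => g x ^ (p + 1)) x =
      (p + 1) * g x ^ p * 𝓜.ma (Function.update w i g) x +
      (p + 1) * (p * g x ^ (p - 1)) * 𝓜.disc (Function.update (fun r => hess (w r) x) i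
        (Matrix.vecMulVec (gradVec g x) (gradVec g x))) := by
  have h1 : deriv (fun t : ℝ => t ^ (p + 1)) = fun t => ((p : ℝ) + 1) * t ^ p := by
    funext t; simp
  have h2 : ∀ t : ℝ, deriv (fun t : ℝ => ((p : ℝ) + 1) * t ^ p) t =
      (p + 1) * (p * t ^ (p - 1)) := by
    intro t; simp
  rw [ma_update_apply, ma_update_apply,
    hess_comp (φ := fun t => t ^ (p + 1)) (contDiff_id.pow _) hg, h1, h2,
    MultilinearMap.map_update_add, MultilinearMap.map_update_smul, MultilinearMap.map_update_smul]
  simp [mul_assoc]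

lemma integrable_mul_ma (hw : ∀ r, ContDiff ℝ ∞ (w r)) (hf : Continuous f)
    (hc : HasCompactSupport f) : Integrable fun x => f x * 𝓜.ma w x :=
  (hf.mul (𝓜.ma_contDiff hw).continuous).integrable_of_hasCompactSupport hc.mul_right

/-- One power of `a - b` is traded for replacing `g` by `b` in slot `i`. After integration by parts
`g` may be shifted to `g - M`, which is nonpositive on the support. In the expansion of the density
of `(a - b) ^ (p + 1)` the rank-one term and the term with `a` can then be dropped, and the term
with `b` carries the factor `M - g ≤ 2 * M`. -/
lemma integral_pow_succ_mul_ma_update_le (hw : ∀ r, 𝓜.SmoothPsh (w r)) (ha : 𝓜.SmoothPsh a)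
    (hb : 𝓜.SmoothPsh b) (hab : ∀ x, b x ≤ a x)
    (hc : HasCompactSupport fun x => a x - b x) (hg : ContDiff ℝ ∞ g) {M : ℝ}
    (hM : ∀ x ∈ tsupport (fun x => a x - b x), |g x| ≤ M) (p : ℕ) (hp : p ≠ 0) :
    ∫ x, (a x - b x) ^ (p + 1) * 𝓜.ma (Function.update w i g) x ≤
      2 * M * (p + 1) * ∫ x, (a x - b x) ^ p * 𝓜.ma (Function.update w i b) x := by
  set h : EuclideanSpace ℝ ι → ℝ := fun x => a x - b x with hh
  have hhs : ContDiff ℝ ∞ h := ha.contDiff.sub hb.contDiff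
  have hws := fun r => (hw r).contDiff
  have hpow : ∀ m : ℕ, m ≠ 0 → HasCompactSupport fun x => h x ^ m := by
    intro m hm
    exact HasCompactSupport.intro hc fun x hx => by
      rw [image_eq_zero_of_notMem_tsupport hx, zero_pow hm]
  have hg' : ContDiff ℝ ∞ fun x => g x - M := hg.sub contDiff_const
  have e1 : ∫ x, h x ^ (p + 1) * 𝓜.ma (Function.update w i g) x =
      ∫ x, (g x - M) * 𝓜.ma (Function.update w i fun x => h x ^ (p + 1)) x := by
    rw [← 𝓜.integral_mul_ma_update hws (hhs.pow (p + 1)) hg' (Or.inl (hpow _ (by simp)))]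
    congr 1
    funext x
    rw [𝓜.ma_update_congr (f := fun x => g x - M) (g := g)]
    rw [hess_sub hg contDiff_const]; simp
  rw [e1, ← integral_const_mul]
  refine integral_mono ?_ ?_ ?_
  · exact (hg'.continuous.mul (𝓜.ma_contDiff (update_contDiff hws (hhs.pow _))).continuous
      ).integrable_of_hasCompactSupport
      (𝓜.hasCompactSupport_ma_update (hpow _ (by simp))).mul_left
  · exact (𝓜.integrable_mul_ma (update_contDiff hws hb.contDiff) (hhs.pow p).continuous
      (hpow p hp)).const_mul _
  · intro x
    change (g x - M) * _ ≤ 2 * M * (p + 1) * (h x ^ p * _)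
    have hx0 : 0 ≤ h x := sub_nonneg.2 (hab x)
    by_cases hx : x ∈ tsupport h
    · have hA := 𝓜.ma_nonneg (SmoothPsh.update (i := i) hw ha) x
      have hB := 𝓜.ma_nonneg (SmoothPsh.update (i := i) hw hb) x
      have hD : 0 ≤ 𝓜.disc (Function.update (fun r => hess (w r) x) i
          (Matrix.vecMulVec (gradVec h x) (gradVec h x))) := by
        refine 𝓜.disc_nonneg fun r => ?_
        by_cases hr : r = i
        · subst hr; simpa using 𝓜.psd_mem _ (posSemidef_vecMulVec _)
        · simpa [hr] using (hw r).mem_cone x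
      rw [𝓜.ma_update_pow hhs, hh, 𝓜.ma_update_sub ha.contDiff hb.contDiff, ← hh]
      have hgM := abs_le.1 (hM x hx)
      have hpp : 0 ≤ h x ^ p := pow_nonneg hx0 p
      have hpq : 0 ≤ h x ^ (p - 1) := pow_nonneg hx0 _
      set A := 𝓜.ma (Function.update w i a) x
      set B := 𝓜.ma (Function.update w i b) x
      set D := 𝓜.disc (Function.update (fun r => hess (w r) x) i
          (Matrix.vecMulVec (gradVec h x) (gradVec h x)))
      have hc0 : 0 ≤ M - g x := by linarith
      have t1 : 0 ≤ (M - g x) * ((p + 1) * h x ^ p * A) := by positivity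
      have t2 : 0 ≤ (M - g x) * ((p + 1) * (p * h x ^ (p - 1)) * D) := by positivity
      have t3 : 0 ≤ (M + g x) * ((p + 1) * h x ^ p * B) := by
        have : 0 ≤ M + g x := by linarith
        positivity
      nlinarith [t1, t2, t3]
    · have hx' : x ∉ tsupport fun x => h x ^ (p + 1) := fun hmem =>
        hx (closure_mono (fun y hy => by
          simp only [Function.mem_support] at hy ⊢
          intro h0; exact hy (by rw [h0]; simp)) hmem)
      rw [𝓜.ma_update_eq_zero hx', image_eq_zero_of_notMem_tsupport hx, zero_pow hp]
      simp

/-- The one-slot estimate is iterated over `s`: each slot costs one power and a factor `2 * M * (p +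
1)`, and the factors `p + 1` multiply to the factorial. -/
lemma integral_pow_mul_ma_le_piecewise (ha : 𝓜.SmoothPsh a)
    (hb : 𝓜.SmoothPsh b) (hab : ∀ x, b x ≤ a x)
    (hc : HasCompactSupport fun x => a x - b x) {M : ℝ} (hM0 : 0 ≤ M) (s : Finset σ) :
    ∀ w : σ → EuclideanSpace ℝ ι → ℝ, (∀ r, 𝓜.SmoothPsh (w r)) →
    (∀ r ∈ s, ∀ x ∈ tsupport (fun x => a x - b x), |w r x| ≤ M) →
    ∫ x, (a x - b x) ^ (s.card + 1) * 𝓜.ma w x ≤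
      (2 * M) ^ s.card * (s.card + 1).factorial *
        ∫ x, (a x - b x) * 𝓜.ma (s.piecewise (fun _ => b) w) x := by
  induction s using Finset.induction_on with
  | empty => intro w _ _; simp
  | insert i s hi ih =>
    intro w hw hM
    rw [Finset.card_insert_of_notMem hi]
    have h1 := 𝓜.integral_pow_succ_mul_ma_update_le (i := i) hw ha hb hab hc (hw i).contDiff
      (hM i (Finset.mem_insert_self i s)) (s.card + 1) (by simp)
    rw [Function.update_eq_self] at h1
    have h2 := ih (Function.update w i b) (SmoothPsh.update hw hb) (fun r hr x hx => by
      have : r ≠ i := fun h => hi (h ▸ hr)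
      rw [Function.update_of_ne this]
      exact hM r (Finset.mem_insert_of_mem hr) x hx)
    have h3 : s.piecewise (fun _ => b) (Function.update w i b) =
        (insert i s).piecewise (fun _ => b) w := by
      funext r
      by_cases hrs : r ∈ s
      · simp [hrs]
      · by_cases hri : r = i
        · subst hri; simp [hrs]
        · simp [hrs, hri]
    rw [h3] at h2
    refine h1.trans ?_
    have h4 : 0 ≤ 2 * M * ((s.card + 1 : ℕ) + 1 : ℝ) := by positivity
    refine (mul_le_mul_of_nonneg_left h2 h4).trans (le_of_eq ?_)
    rw [Nat.factorial_succ (s.card + 1)]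
    push_cast
    ring

/-- The comparison of a mixed Monge–Ampère integral with the pure one of the lower function. -/
lemma integral_pow_mul_ma_le (ha : 𝓜.SmoothPsh a)
    (hb : 𝓜.SmoothPsh b) (hab : ∀ x, b x ≤ a x)
    (hc : HasCompactSupport fun x => a x - b x) {M : ℝ} (hM0 : 0 ≤ M)
    (hw : ∀ r, 𝓜.SmoothPsh (w r))
    (hM : ∀ r, ∀ x ∈ tsupport (fun x => a x - b x), |w r x| ≤ M) :
    ∫ x, (a x - b x) ^ (Fintype.card σ + 1) * 𝓜.ma w x ≤
      (2 * M) ^ Fintype.card σ * (Fintype.card σ + 1).factorial *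
        ∫ x, (a x - b x) * 𝓜.ma (fun _ => b) x := by
  have := 𝓜.integral_pow_mul_ma_le_piecewise ha hb hab hc hM0 Finset.univ w hw
    (fun r _ => hM r)
  simpa [Finset.card_univ] using this

/-! ### Energy of decreasing sequences and uniform smallness -/

section Energy

variable {B : Set (EuclideanSpace ℝ ι)}

/-- The difference on the left involves only the density of `a - b`, which vanishes off `B`. It is
therefore a global integral, and the compact support of `a - b` alone justifies integrating by
parts. -/
lemma setIntegral_mul_ma_update_sub (hB : IsCompact B) (hw : ∀ r, ContDiff ℝ ∞ (w r))
    (hg : ContDiff ℝ ∞ g) (ha : ContDiff ℝ ∞ a) (hb : ContDiff ℝ ∞ b)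
    (hs : tsupport (fun x => a x - b x) ⊆ B) :
    (∫ x in B, g x * 𝓜.ma (Function.update w i a) x) -
      ∫ x in B, g x * 𝓜.ma (Function.update w i b) x =
      ∫ x, (a x - b x) * 𝓜.ma (Function.update w i g) x := by
  have hi : ∀ u, ContDiff ℝ ∞ u →
      IntegrableOn (fun x => g x * 𝓜.ma (Function.update w i u) x) B := fun u hu =>
    (hg.continuous.mul (𝓜.ma_contDiff (update_contDiff hw hu)).continuous
      ).continuousOn.integrableOn_compact hB
  have hc : HasCompactSupport fun x => a x - b x := hB.of_isClosed_subset (isClosed_tsupport _) hs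
  rw [𝓜.integral_mul_ma_update hw (ha.sub hb) hg (Or.inl hc), ← integral_sub (hi a ha) (hi b hb)]
  refine Eq.trans ?_ (setIntegral_eq_integral_of_forall_compl_eq_zero (s := B) fun x hx => ?_)
  · refine integral_congr_ae (ae_of_all _ fun x => ?_)
    change _ = g x * 𝓜.ma (Function.update w i fun x => a x - b x) x
    rw [𝓜.ma_update_sub ha hb]; ring
  · change g x * 𝓜.ma (Function.update w i fun x => a x - b x) x = 0
    rw [𝓜.ma_update_eq_zero (fun h => hx (hs h)), mul_zero]

/-- This is the preceding identity for `g = 1`, whose Hessian is zero. -/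
lemma setIntegral_ma_update_eq (hB : IsCompact B) (hw : ∀ r, ContDiff ℝ ∞ (w r))
    (ha : ContDiff ℝ ∞ a) (hb : ContDiff ℝ ∞ b)
    (hs : tsupport (fun x => a x - b x) ⊆ B) :
    ∫ x in B, 𝓜.ma (Function.update w i a) x = ∫ x in B, 𝓜.ma (Function.update w i b) x := by
  have h := 𝓜.setIntegral_mul_ma_update_sub (i := i) hB hw (g := fun _ => 1) contDiff_const ha hb hs
  have h0 : ∀ x, 𝓜.ma (Function.update w i fun _ => 1) x = 0 := fun x => by
    rw [ma_update_apply]; simp [MultilinearMap.map_update_zero]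
  simp only [h0, mul_zero, integral_zero, one_mul] at h
  linarith

lemma piecewise_insert_eq_update {X : Type*} (s : Finset σ) (i : σ) (u v : σ → X) :
    (insert i s).piecewise u v = Function.update (s.piecewise u v) i (u i) :=
  Finset.piecewise_insert s u v i

/-- The total mass is not changed by a modification inside `B`. -/
lemma setIntegral_ma_eq (hB : IsCompact B) {w' : σ → EuclideanSpace ℝ ι → ℝ}
    (hw : ∀ r, ContDiff ℝ ∞ (w r)) (hw' : ∀ r, ContDiff ℝ ∞ (w' r))
    (hs : ∀ r, tsupport (fun x => w' r x - w r x) ⊆ B) :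
    ∫ x in B, 𝓜.ma w' x = ∫ x in B, 𝓜.ma w x := by
  suffices H : ∀ s : Finset σ, ∫ x in B, 𝓜.ma (s.piecewise w' w) x = ∫ x in B, 𝓜.ma w x by
    simpa using H Finset.univ
  intro s
  induction s using Finset.induction_on with
  | empty => simp
  | insert i s hi ih =>
    have hp : ∀ r, ContDiff ℝ ∞ (s.piecewise w' w r) := fun r => by
      by_cases h : r ∈ s <;> simp [h, hw, hw']
    rw [piecewise_insert_eq_update, 𝓜.setIntegral_ma_update_eq hB hp (hw' i) (hw i) (hs i), ← ih]
    have : Function.update (s.piecewise w' w) i (w i) = s.piecewise w' w := by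
      rw [Function.update_eq_iff]; simp [hi]
    rw [this]

/-- The energy on `B`. -/
def energy (B : Set (EuclideanSpace ℝ ι)) (u : EuclideanSpace ℝ ι → ℝ) : ℝ :=
  ∫ x in B, u x * 𝓜.ma (fun _ => u) x

/-- Replacing `b` by `a` in one slot increases the integral of `a` against the density: by
integration by parts the increase is the integral of `a - b` against a nonnegative density. After
all slots the integral is the energy of `a`. -/
lemma integral_sub_mul_ma_le_energy (hB : IsCompact B) (ha : 𝓜.SmoothPsh a) (hb : 𝓜.SmoothPsh b)
    (hab : ∀ x, b x ≤ a x) (hs : tsupport (fun x => a x - b x) ⊆ B) :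
    ∫ x, (a x - b x) * 𝓜.ma (fun _ => b) x ≤ 𝓜.energy B a - 𝓜.energy B b := by
  have H : ∀ s : Finset σ, ∫ x in B, a x * 𝓜.ma (fun _ => b) x ≤
      ∫ x in B, a x * 𝓜.ma (s.piecewise (fun _ => a) (fun _ => b)) x := by
    intro s
    induction s using Finset.induction_on with
    | empty => simp
    | insert i s hi ih =>
      have hp : ∀ r, 𝓜.SmoothPsh (s.piecewise (fun _ => a) (fun _ => b) r) := fun r => by
        by_cases h : r ∈ s <;> simp [h, ha, hb]
      refine ih.trans ?_
      have h := 𝓜.setIntegral_mul_ma_update_sub (i := i) hB (fun r => (hp r).contDiff)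
        ha.contDiff ha.contDiff hb.contDiff hs
      have h0 : 0 ≤ ∫ x, (a x - b x) * 𝓜.ma (Function.update
          (s.piecewise (fun _ => a) (fun _ => b)) i a) x :=
        integral_nonneg fun x => mul_nonneg (sub_nonneg.2 (hab x))
          (𝓜.ma_nonneg (SmoothPsh.update hp ha) x)
      have : Function.update (s.piecewise (fun _ => a) (fun _ => b)) i b =
          s.piecewise (fun _ => a) (fun _ => b) := by
        rw [Function.update_eq_iff]; simp [hi]
      rw [this] at h
      rw [piecewise_insert_eq_update]
      linarith
  have h1 := H Finset.univ
  rw [Finset.piecewise_univ] at h1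
  have hi : ∀ u v : EuclideanSpace ℝ ι → ℝ, 𝓜.SmoothPsh u → 𝓜.SmoothPsh v →
      IntegrableOn (fun x => u x * 𝓜.ma (fun _ => v) x) B := fun u v hu hv =>
    (hu.contDiff.continuous.mul (𝓜.ma_contDiff fun _ => hv.contDiff).continuous
      ).continuousOn.integrableOn_compact hB
  have h2 : ∫ x, (a x - b x) * 𝓜.ma (fun _ => b) x =
      (∫ x in B, a x * 𝓜.ma (fun _ => b) x) - ∫ x in B, b x * 𝓜.ma (fun _ => b) x := by
    rw [← integral_sub (hi a b ha hb) (hi b b hb hb),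
      ← setIntegral_eq_integral_of_forall_compl_eq_zero (s := B)]
    · exact integral_congr_ae (ae_of_all _ fun x => by simp only; ring)
    · intro x hx
      have : a x - b x = 0 :=
        image_eq_zero_of_notMem_tsupport (f := fun x => a x - b x) fun h => hx (hs h)
      rw [this, zero_mul]
  rw [h2]
  unfold energy
  linarith

/-- A decreasing sequence of smooth plurisubharmonic functions which is uniformly bounded on `B`
and constant outside `B`. -/
structure LocalSeq (B : Set (EuclideanSpace ℝ ι)) (u : ℕ → EuclideanSpace ℝ ι → ℝ) : Prop where
  psh : ∀ j, 𝓜.SmoothPsh (u j)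
  anti : ∀ x, Antitone fun j => u j x
  tsupp : ∀ i j, tsupport (fun x => u i x - u j x) ⊆ B
  bdd : ∃ M : ℝ, ∀ j, ∀ x ∈ B, |u j x| ≤ M

-- The integrals are bounded by differences of energies. The energies decrease, and they are bounded
-- below because the total mass on `B` does not depend on `j`; hence they form a Cauchy sequence.
variable {𝓜} in
lemma LocalSeq.energy_small {u : ℕ → EuclideanSpace ℝ ι → ℝ} (hB : IsCompact B)
    (hu : 𝓜.LocalSeq B u) {δ : ℝ} (hδ : 0 < δ) :
    ∃ I, ∀ i j, I ≤ i → i ≤ j → ∫ x, (u i x - u j x) * 𝓜.ma (fun _ => u j) x < δ := by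
  have key : ∀ i j, i ≤ j → ∫ x, (u i x - u j x) * 𝓜.ma (fun _ => u j) x ≤
      𝓜.energy B (u i) - 𝓜.energy B (u j) := fun i j hij =>
    𝓜.integral_sub_mul_ma_le_energy hB (hu.psh i) (hu.psh j) (fun x => hu.anti x hij) (hu.tsupp i j)
  have hanti : Antitone fun j => 𝓜.energy B (u j) := by
    intro i j hij
    have h0 : 0 ≤ ∫ x, (u i x - u j x) * 𝓜.ma (fun _ => u j) x :=
      integral_nonneg fun x => mul_nonneg (sub_nonneg.2 (hu.anti x hij))
        (𝓜.ma_nonneg (fun _ => hu.psh j) x)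
    have := key i j hij
    simp only; linarith
  obtain ⟨M, hM⟩ := hu.bdd
  have hbdd : BddBelow (Set.range fun j => 𝓜.energy B (u j)) := by
    refine ⟨-M * ∫ x in B, 𝓜.ma (fun _ => u 0) x, ?_⟩
    rintro _ ⟨j, rfl⟩
    have hmass : ∫ x in B, 𝓜.ma (fun _ : σ => u j) x = ∫ x in B, 𝓜.ma (fun _ : σ => u 0) x :=
      𝓜.setIntegral_ma_eq hB (fun _ => (hu.psh 0).contDiff) (fun _ => (hu.psh j).contDiff)
        (fun _ => hu.tsupp j 0)
    rw [← hmass, ← integral_const_mul]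
    have hcont := (𝓜.ma_contDiff fun _ : σ => (hu.psh j).contDiff).continuous
    refine setIntegral_mono_on ?_ ?_ hB.measurableSet ?_
    · exact (continuous_const.mul hcont).continuousOn.integrableOn_compact hB
    · exact ((hu.psh j).contDiff.continuous.mul hcont).continuousOn.integrableOn_compact hB
    · intro x hx
      exact mul_le_mul_of_nonneg_right (abs_le.1 (hM j x hx)).1
        (𝓜.ma_nonneg (fun _ => hu.psh j) x)
  have hcauchy := (tendsto_atTop_ciInf hanti hbdd).cauchySeq
  obtain ⟨I, hI⟩ := Metric.cauchySeq_iff.1 hcauchy δ hδ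
  refine ⟨I, fun i j hi hij => (key i j hij).trans_lt ?_⟩
  exact (le_abs_self _).trans_lt (hI i hi j (hi.trans hij))

variable {𝓜} in
/-- Uniform smallness of mixed Monge–Ampère integrals of the differences of a decreasing
sequence. -/
lemma LocalSeq.uniform_small {u : ℕ → EuclideanSpace ℝ ι → ℝ} (hB : IsCompact B)
    (hu : 𝓜.LocalSeq B u) (M m : ℝ) {δ : ℝ} (hδ : 0 < δ) :
    ∃ I, ∀ i j, I ≤ i → i ≤ j → ∀ w : σ → EuclideanSpace ℝ ι → ℝ, (∀ r, 𝓜.SmoothPsh (w r)) →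
      (∀ r, ∀ x ∈ B, |w r x| ≤ M) → ∫ x in B, 𝓜.ma w x ≤ m →
      ∫ x, (u i x - u j x) * 𝓜.ma w x ≤ δ := by
  set N := Fintype.card σ
  set m' := max m 0
  set M' := max M 0
  -- The height at which the difference is cut: the part below `d` contributes at most `d * m' ≤ δ /
  -- 2`. Both `m` and `M` are arbitrary reals, whence the maxima with `0`.
  set d := δ / (2 * (m' + 1))
  have hm' : 0 ≤ m' := le_max_right _ _
  have hM' : 0 ≤ M' := le_max_right _ _
  have hd : 0 < d := by positivity
  set C : ℝ := (2 * M') ^ N * (N + 1).factorial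
  have hC : 0 ≤ C := by positivity
  obtain ⟨I, hI⟩ := hu.energy_small hB (δ := δ / 2 * d ^ N / (C + 1)) (by positivity)
  refine ⟨I, fun i j hi hij w hw hwM hwm => ?_⟩
  have hs := hu.tsupp i j
  have hc : HasCompactSupport fun x => u i x - u j x :=
    hB.of_isClosed_subset (isClosed_tsupport _) hs
  have hcont : Continuous fun x => u i x - u j x :=
    (hu.psh i).contDiff.continuous.sub (hu.psh j).contDiff.continuous
  have hma := (𝓜.ma_contDiff fun r => (hw r).contDiff).continuous
  have h1 := 𝓜.integral_pow_mul_ma_le (hu.psh i) (hu.psh j) (fun x => hu.anti x hij) hc hM' hw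
    (fun r x hx => (hwM r x (hs hx)).trans (le_max_left _ _))
  have h2 := hI i j hi hij
  have h0 : ∀ x, 0 ≤ u i x - u j x := fun x => sub_nonneg.2 (hu.anti x hij)
  have h3 : ∫ x, (u i x - u j x) * 𝓜.ma w x =
      ∫ x in B, (u i x - u j x) * 𝓜.ma w x :=
    (setIntegral_eq_integral_of_forall_compl_eq_zero fun x hx => by
      have : u i x - u j x = 0 :=
        image_eq_zero_of_notMem_tsupport (f := fun x => u i x - u j x) fun h => hx (hs h)
      rw [this, zero_mul]).symm
  have h4 : ∫ x in B, (u i x - u j x) ^ (N + 1) * 𝓜.ma w x =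
      ∫ x, (u i x - u j x) ^ (N + 1) * 𝓜.ma w x :=
    setIntegral_eq_integral_of_forall_compl_eq_zero fun x hx => by
      have : u i x - u j x = 0 :=
        image_eq_zero_of_notMem_tsupport (f := fun x => u i x - u j x) fun h => hx (hs h)
      rw [this]; simp
  -- Chebyshev's inequality: for `h ≥ 0` one has `h ≤ d + h ^ (N + 1) / d ^ N`, trivially if `h ≤ d`
  -- and because `(h / d) ^ N ≥ 1` otherwise.
  have h5 : ∫ x in B, (u i x - u j x) * 𝓜.ma w x ≤
      ∫ x in B, (d * 𝓜.ma w x + (d ^ N)⁻¹ * ((u i x - u j x) ^ (N + 1) * 𝓜.ma w x)) := by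
    refine setIntegral_mono_on ?_ ?_ hB.measurableSet ?_
    · exact (hcont.mul hma).continuousOn.integrableOn_compact hB
    · exact ((continuous_const.mul hma).add
        (continuous_const.mul ((hcont.pow _).mul hma))).continuousOn.integrableOn_compact hB
    · intro x _
      have hx := 𝓜.ma_nonneg hw x
      rw [← mul_assoc, ← add_mul]
      refine mul_le_mul_of_nonneg_right ?_ hx
      rcases le_total (u i x - u j x) d with hle | hle
      · have : 0 ≤ (d ^ N)⁻¹ * (u i x - u j x) ^ (N + 1) := by
          have := h0 x
          positivity
        linarith
      · have : u i x - u j x ≤ (d ^ N)⁻¹ * (u i x - u j x) ^ (N + 1) := by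
          rw [inv_mul_eq_div, le_div_iff₀ (by positivity), pow_succ, mul_comm]
          exact mul_le_mul_of_nonneg_right (pow_le_pow_left₀ hd.le hle N) (h0 x)
        linarith
  rw [h3]
  refine h5.trans ?_
  rw [integral_add, integral_const_mul, integral_const_mul, h4]
  · have e1 : d * ∫ x in B, 𝓜.ma w x ≤ δ / 2 := by
      have : d * ∫ x in B, 𝓜.ma w x ≤ d * (m' + 1) :=
        mul_le_mul_of_nonneg_left (hwm.trans ((le_max_left _ _).trans (by linarith))) hd.le
      refine this.trans (le_of_eq ?_)
      simp only [d]; field_simp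
    have e2 : (d ^ N)⁻¹ * ∫ x, (u i x - u j x) ^ (N + 1) * 𝓜.ma w x ≤ δ / 2 := by
      rw [inv_mul_eq_div, div_le_iff₀ (by positivity)]
      refine h1.trans ?_
      have : C * ∫ x, (u i x - u j x) * 𝓜.ma (fun _ => u j) x ≤
          (C + 1) * (δ / 2 * d ^ N / (C + 1)) := by
        have h00 : 0 ≤ ∫ x, (u i x - u j x) * 𝓜.ma (fun _ => u j) x :=
          integral_nonneg fun x => mul_nonneg (h0 x) (𝓜.ma_nonneg (fun _ => hu.psh j) x)
        calc _ ≤ (C + 1) * ∫ x, (u i x - u j x) * 𝓜.ma (fun _ => u j) x := by nlinarith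
          _ ≤ _ := mul_le_mul_of_nonneg_left h2.le (by positivity)
      refine this.trans (le_of_eq ?_)
      field_simp
    linarith
  · exact (continuous_const.mul hma).continuousOn.integrableOn_compact hB
  · exact (continuous_const.mul ((hcont.pow _).mul hma)).continuousOn.integrableOn_compact hB

end Energy

end MixedForm

/-! ### Quadratic functions -/

section Quadratic

variable {ι : Type*} [Fintype ι] [DecidableEq ι]

lemma contDiff_coord (p : ι) : ContDiff ℝ ∞ fun x : EuclideanSpace ℝ ι => x p :=
  (EuclideanSpace.proj (𝕜 := ℝ) p).contDiff

lemma pd_coord (r p : ι) :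
    pd r (fun x : EuclideanSpace ℝ ι => x p) = fun _ => if p = r then 1 else 0 := by
  funext x
  have : (fun x : EuclideanSpace ℝ ι => x p) = EuclideanSpace.proj (𝕜 := ℝ) p := rfl
  rw [pd, this, ContinuousLinearMap.fderiv]
  simp

lemma pd_sum {κ : Type*} (s : Finset κ) {F : κ → EuclideanSpace ℝ ι → ℝ} {p : ι}
    (hF : ∀ i, ContDiff ℝ ∞ (F i)) :
    pd p (fun x => ∑ i ∈ s, F i x) = fun x => ∑ i ∈ s, pd p (F i) x := by
  funext x
  simp only [pd]
  rw [fderiv_fun_sum (fun i _ => (hF i).diffAt)]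
  simp

/-- The quadratic polynomial with Hessian `C`. -/
def quad (C : Matrix ι ι ℝ) (x : EuclideanSpace ℝ ι) : ℝ :=
  ∑ p, ∑ q, (C p q / 2) * (x p * x q)

lemma contDiff_quad (C : Matrix ι ι ℝ) : ContDiff ℝ ∞ (quad C) :=
  ContDiff.sum fun p _ => ContDiff.sum fun q _ =>
    contDiff_const.mul ((contDiff_coord p).mul (contDiff_coord q))

lemma hess_quad {C : Matrix ι ι ℝ} (hC : C.IsSymm) (x : EuclideanSpace ℝ ι) :
    hess (quad C) x = C := by
  have h1 : ∀ r, pd r (quad C) = fun x => ∑ q, C r q * x q := by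
    intro r
    unfold quad
    rw [pd_sum _ (fun p => ContDiff.sum fun q _ =>
      contDiff_const.mul ((contDiff_coord p).mul (contDiff_coord q)))]
    funext x
    have h2 : ∀ p, pd r (fun x : EuclideanSpace ℝ ι => ∑ q, C p q / 2 * (x p * x q)) x =
        ∑ q, (C p q / 2 * ((if p = r then 1 else 0) * x q) +
          C p q / 2 * (x p * (if q = r then 1 else 0))) := by
      intro p
      rw [pd_sum _ (fun q => contDiff_const.mul ((contDiff_coord p).mul (contDiff_coord q)))]
      refine Finset.sum_congr rfl fun q _ => ?_
      rw [pd_const_mul ((contDiff_coord p).mul (contDiff_coord q)),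
        pd_mul (contDiff_coord p) (contDiff_coord q), pd_coord, pd_coord]
      ring
    simp only [h2, Finset.sum_add_distrib]
    have e1 : ∑ p, ∑ q, C p q / 2 * ((if p = r then 1 else 0) * x q) = ∑ q, C r q / 2 * x q := by
      rw [Finset.sum_comm]
      refine Finset.sum_congr rfl fun q _ => ?_
      simp
    have e2 : ∑ p, ∑ q, C p q / 2 * (x p * (if q = r then 1 else 0)) = ∑ q, C r q / 2 * x q := by
      refine Finset.sum_congr rfl fun p _ => ?_
      simp [hC.apply p r]
    rw [e1, e2, ← Finset.sum_add_distrib]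
    exact Finset.sum_congr rfl fun q _ => by ring
  ext p q
  rw [hess_apply, h1, pd_sum _ (fun r => contDiff_const.mul (contDiff_coord r))]
  simp only [pd_const_mul (contDiff_coord _), pd_coord]
  simp [hC.apply p q]

lemma hess_normSq_sub (x₀ x : EuclideanSpace ℝ ι) (A c : ℝ) :
    hess (fun x => A * (‖x - x₀‖ ^ 2 - c)) x = (2 * A) • (1 : Matrix ι ι ℝ) := by
  have h0 : (fun x : EuclideanSpace ℝ ι => A * (‖x - x₀‖ ^ 2 - c)) =
      fun x => ∑ p, A * (x p * x p - 2 * x₀ p * x p) + A * ((∑ p, x₀ p ^ 2) - c) := by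
    funext x
    rw [EuclideanSpace.real_norm_sq_eq, mul_sub, mul_sub, Finset.mul_sum, Finset.mul_sum,
      add_sub, ← Finset.sum_add_distrib]
    congr 1
    refine Finset.sum_congr rfl fun p _ => ?_
    simp only [PiLp.sub_apply]
    ring
  have hs : ∀ p, ContDiff ℝ ∞ fun x : EuclideanSpace ℝ ι => x p * x p - 2 * x₀ p * x p := fun p =>
    ((contDiff_coord p).mul (contDiff_coord p)).sub (contDiff_const.mul (contDiff_coord p))
  have hs' : ∀ p, ContDiff ℝ ∞ fun x : EuclideanSpace ℝ ι => A * (x p * x p - 2 * x₀ p * x p) :=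
    fun p => contDiff_const.mul (hs p)
  rw [h0, hess_add_const (ContDiff.sum fun p _ => hs' p)]
  have h1 : ∀ r, pd r (fun x : EuclideanSpace ℝ ι => ∑ p, A * (x p * x p - 2 * x₀ p * x p)) =
      fun x => 2 * A * x r + -(2 * A * x₀ r) := by
    intro r
    rw [pd_sum _ hs']
    funext x
    have h2 : ∀ p, pd r (fun x : EuclideanSpace ℝ ι => A * (x p * x p - 2 * x₀ p * x p)) x =
        if p = r then 2 * A * x r + -(2 * A * x₀ r) else 0 := by
      intro p
      rw [pd_const_mul (hs p), pd_sub ((contDiff_coord p).mul (contDiff_coord p))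
        (contDiff_const.mul (contDiff_coord p)), pd_mul (contDiff_coord p) (contDiff_coord p),
        pd_const_mul (contDiff_coord p), pd_coord]
      by_cases h : p = r
      · subst h; simp; ring
      · simp [h]
    simp [h2]
  ext p q
  rw [hess_apply, h1, pd_add (contDiff_const.mul (contDiff_coord q)) contDiff_const,
    pd_const_mul (contDiff_coord q), pd_coord]
  simp [Matrix.one_apply, eq_comm]

/-- A symmetric matrix with entries bounded by `c` is bounded by a multiple of the identity. -/
lemma posSemidef_smul_one_sub {A : Matrix ι ι ℝ} (hA : A.IsSymm) {c : ℝ}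
    (hc : ∀ p q, |A p q| ≤ c) :
    ((Fintype.card ι * c) • (1 : Matrix ι ι ℝ) - A).PosSemidef := by
  refine Matrix.PosSemidef.of_dotProduct_mulVec_nonneg ?_ fun x => ?_
  · ext p q
    simp [Matrix.one_apply, hA.apply p q, eq_comm]
  · have h1 : x ⬝ᵥ A.mulVec x ≤ ∑ p, ∑ q, c * ((x p ^ 2 + x q ^ 2) / 2) := by
      simp only [dotProduct, Matrix.mulVec, Finset.mul_sum]
      refine Finset.sum_le_sum fun p _ => Finset.sum_le_sum fun q _ => ?_
      calc x p * (A p q * x q) ≤ |x p * (A p q * x q)| := le_abs_self _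
        _ = |A p q| * (|x p| * |x q|) := by rw [abs_mul, abs_mul]; ring
        _ ≤ c * (|x p| * |x q|) := mul_le_mul_of_nonneg_right (hc p q) (by positivity)
        _ ≤ c * ((x p ^ 2 + x q ^ 2) / 2) := by
          refine mul_le_mul_of_nonneg_left ?_ ((abs_nonneg _).trans (hc p q))
          nlinarith [sq_nonneg (|x p| - |x q|), sq_abs (x p), sq_abs (x q)]
    have h2 : ∑ p, ∑ q, c * ((x p ^ 2 + x q ^ 2) / 2) = Fintype.card ι * c * ∑ p, x p ^ 2 := by
      simp only [← Finset.mul_sum, ← Finset.sum_div, Finset.sum_add_distrib, Finset.sum_const,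
        Finset.card_univ, nsmul_eq_mul]
      ring
    have h3 : x ⬝ᵥ x = ∑ p, x p ^ 2 := by
      simp [dotProduct, sq]
    simp only [star_trivial, Matrix.sub_mulVec, Matrix.smul_mulVec, Matrix.one_mulVec,
      dotProduct_sub, dotProduct_smul, smul_eq_mul, h3]
    linarith

end Quadratic

namespace MixedForm

variable {ι σ : Type*} [Fintype ι] [DecidableEq ι] [Fintype σ] [DecidableEq σ]
variable {𝓜 : MixedForm ι σ} {B : Set (EuclideanSpace ℝ ι)}

lemma smoothPsh_quad {C : Matrix ι ι ℝ} (hC : C.PosSemidef) : 𝓜.SmoothPsh (quad C) :=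
  ⟨contDiff_quad C, fun x => by
    rw [hess_quad (by simpa [Matrix.IsHermitian, Matrix.IsSymm] using hC.1)]
    exact 𝓜.psd_mem _ hC⟩

/-- A compactly supported smooth `f` has bounded second derivatives, so a large multiple of the
identity, which is the Hessian of `quad 1`, dominates both `hess f` and `-hess f`. Since `C` does
not depend on `w`, a slot containing `f` can be handled by estimates for plurisubharmonic functions.
-/
lemma abs_ma_update_le
    {f : EuclideanSpace ℝ ι → ℝ} (hf : ContDiff ℝ ∞ f) (hc : HasCompactSupport f) :
    ∃ C : ℝ, 0 ≤ C ∧ ∀ (w : σ → EuclideanSpace ℝ ι → ℝ) (i : σ) (x : EuclideanSpace ℝ ι),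
      (∀ r, 𝓜.SmoothPsh (w r)) →
      |𝓜.ma (Function.update w i f) x| ≤ C * 𝓜.ma (Function.update w i (quad 1)) x := by
  have hb : ∀ p q : ι, ∃ c : ℝ, ∀ x, |hess f x p q| ≤ c := by
    intro p q
    obtain ⟨c, hc⟩ := (contDiff_hess (p := p) (q := q) hf).continuous.bounded_above_of_compact_support
      (hasCompactSupport_pd (hasCompactSupport_pd hc))
    exact ⟨c, hc⟩
  choose c hcb using hb
  set c' : ℝ := ∑ p, ∑ q, |c p q|
  have hc' : ∀ x p q, |hess f x p q| ≤ c' := fun x p q =>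
    (hcb p q x).trans <| (le_abs_self _).trans <|
      (Finset.single_le_sum (f := fun q => |c p q|) (fun _ _ => abs_nonneg _)
        (Finset.mem_univ q)).trans
      (Finset.single_le_sum (f := fun p => ∑ q, |c p q|)
        (fun _ _ => Finset.sum_nonneg fun _ _ => abs_nonneg _) (Finset.mem_univ p))
  refine ⟨Fintype.card ι * c', by positivity, fun w i x hw => ?_⟩
  have hpos : ∀ A : Matrix ι ι ℝ, A.PosSemidef →
      0 ≤ 𝓜.disc (Function.update (fun r => hess (w r) x) i A) := fun A hA => by
    refine 𝓜.disc_nonneg fun r => ?_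
    by_cases hr : r = i
    · subst hr; simpa using 𝓜.psd_mem _ hA
    · simpa [hr] using (hw r).mem_cone x
  have h1 := hpos _ (posSemidef_smul_one_sub (hess_symm hf) (hc' x))
  have h2 := hpos _ (posSemidef_smul_one_sub (A := -hess f x)
    (by simpa [Matrix.IsSymm] using hess_symm hf) (fun p q => by simpa using hc' x p q))
  rw [MultilinearMap.map_update_sub, MultilinearMap.map_update_smul] at h1 h2
  rw [MultilinearMap.map_update_neg] at h2
  rw [ma_update_apply, ma_update_apply, hess_quad (by simp [Matrix.IsSymm]), abs_le]
  simp only [smul_eq_mul] at h1 h2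
  constructor <;> linarith

/-- Weak convergence of mixed Monge–Ampère densities against smooth functions. -/
lemma LocalSeq.cauchySeq_of_smooth (hB : IsCompact B) {u : σ → ℕ → EuclideanSpace ℝ ι → ℝ}
    (hu : ∀ t, 𝓜.LocalSeq B (u t)) {f : EuclideanSpace ℝ ι → ℝ} (hf : ContDiff ℝ ∞ f)
    (hc : HasCompactSupport f) :
    CauchySeq fun j => ∫ x, f x * 𝓜.ma (fun t => u t j) x := by
  obtain ⟨C, hC0, hC⟩ := abs_ma_update_le (𝓜 := 𝓜) hf hc
  choose M hM using fun t => (hu t).bdd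
  obtain ⟨Mq, hMq⟩ := hB.exists_bound_of_continuousOn (contDiff_quad (1 : Matrix ι ι ℝ)).continuous.continuousOn
  set M' : ℝ := |Mq| + ∑ t, |M t|
  have hM't : ∀ t j, ∀ x ∈ B, |u t j x| ≤ M' := fun t j x hx =>
    (hM t j x hx).trans <| (le_abs_self _).trans <|
      (Finset.single_le_sum (f := fun t => |M t|) (fun _ _ => abs_nonneg _)
        (Finset.mem_univ t)).trans (le_add_of_nonneg_left (abs_nonneg _))
  have hM'q : ∀ x ∈ B, |quad (1 : Matrix ι ι ℝ) x| ≤ M' := fun x hx =>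
    (hMq x hx).trans <| (le_abs_self _).trans
      (le_add_of_nonneg_right (Finset.sum_nonneg fun _ _ => abs_nonneg _))
  have hq : 𝓜.SmoothPsh (quad (1 : Matrix ι ι ℝ)) := smoothPsh_quad Matrix.PosSemidef.one
  rw [Metric.cauchySeq_iff']
  intro ε hε
  set N := Fintype.card σ
  set δ : ℝ := ε / (2 * (N + 1) * (C + 1))
  have hδ : 0 < δ := by positivity
  -- The mass bound is computed from the members of index `0`. The families used below differ from
  -- these only inside `B`, so they have the same mass on `B`.
  choose I hI using fun t => (hu t).uniform_small hB M'
    (∫ x in B, 𝓜.ma (Function.update (fun r => u r 0) t (quad 1)) x) hδ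
  set I' := ∑ t, I t
  have hII : ∀ t, I t ≤ I' := fun t =>
    Finset.single_le_sum (f := I) (fun _ _ => Nat.zero_le _) (Finset.mem_univ t)
  refine ⟨I', fun j hj => ?_⟩
  -- The slots pass from index `I'` to `j` one at a time. In each change, integration by parts
  -- brings `u i I' - u i j` outside and puts `f` into the slot, where it is dominated by `quad 1`.
  have step : ∀ s : Finset σ, |(∫ x, f x * 𝓜.ma (s.piecewise (fun t => u t j) (fun t => u t I')) x) -
      ∫ x, f x * 𝓜.ma (fun t => u t I') x| ≤ s.card * (C * δ) := by
    intro s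
    induction s using Finset.induction_on with
    | empty => simp
    | insert i s hi ih =>
      set W := s.piecewise (fun t => u t j) (fun t => u t I') with hW
      have hWp : ∀ r, 𝓜.SmoothPsh (W r) := fun r => by
        by_cases h : r ∈ s <;> simp [hW, h, (hu r).psh]
      have hWs := fun r => (hWp r).contDiff
      have hWM : ∀ r, ∀ x ∈ B, |W r x| ≤ M' := fun r => by
        by_cases h : r ∈ s <;> simp only [hW, h, Finset.piecewise_eq_of_mem,
          Finset.piecewise_eq_of_notMem, not_false_eq_true] <;> exact hM't r _
      have hWi : Function.update W i (u i I') = W := by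
        rw [Function.update_eq_iff]; simp [hW, hi]
      have hsm := fun k => ((hu i).psh k).contDiff
      have hcs : HasCompactSupport fun x => u i I' x - u i j x :=
        hB.of_isClosed_subset (isClosed_tsupport _) ((hu i).tsupp I' j)
      have e1 : (∫ x, f x * 𝓜.ma W x) - ∫ x, f x * 𝓜.ma (Function.update W i (u i j)) x =
          ∫ x, (u i I' x - u i j x) * 𝓜.ma (Function.update W i f) x := by
        rw [𝓜.integral_mul_ma_update hWs ((hsm I').sub (hsm j)) hf (Or.inr hc),
          ← integral_sub (𝓜.integrable_mul_ma hWs hf.continuous hc)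
            (𝓜.integrable_mul_ma (update_contDiff hWs (hsm j)) hf.continuous hc)]
        refine integral_congr_ae (ae_of_all _ fun x => ?_)
        change _ = f x * 𝓜.ma (Function.update W i fun x => u i I' x - u i j x) x
        rw [𝓜.ma_update_sub (hsm I') (hsm j), hWi]; ring
      have hcont : Continuous fun x => u i I' x - u i j x :=
        (hsm I').continuous.sub (hsm j).continuous
      have e2 : |∫ x, (u i I' x - u i j x) * 𝓜.ma (Function.update W i f) x| ≤ C * δ := by
        have h1 : ∫ x, (u i I' x - u i j x) * 𝓜.ma (Function.update W i (quad 1)) x ≤ δ := by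
          refine hI i I' j (hII i) hj _ (SmoothPsh.update hWp hq) (fun r x hx => ?_) (le_of_eq ?_)
          · by_cases h : r = i
            · subst h; simpa using hM'q x hx
            · simpa [h] using hWM r x hx
          · refine 𝓜.setIntegral_ma_eq hB (update_contDiff (fun r => ((hu r).psh 0).contDiff)
              hq.contDiff) (update_contDiff hWs hq.contDiff) fun r => ?_
            by_cases h : r = i
            · subst h; simp [tsupport]
            · simp only [Function.update_of_ne h]
              by_cases hr : r ∈ s
              · simpa [hW, hr] using (hu r).tsupp j 0
              · simpa [hW, hr] using (hu r).tsupp I' 0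
        calc _ ≤ ∫ x, |(u i I' x - u i j x) * 𝓜.ma (Function.update W i f) x| :=
              abs_integral_le_integral_abs
          _ ≤ ∫ x, C * ((u i I' x - u i j x) * 𝓜.ma (Function.update W i (quad 1)) x) := by
            refine integral_mono ?_ ?_ fun x => ?_
            · exact (𝓜.integrable_mul_ma (update_contDiff hWs hf) hcont hcs).abs
            · exact (𝓜.integrable_mul_ma (update_contDiff hWs hq.contDiff) hcont hcs).const_mul _
            · have h0 : 0 ≤ u i I' x - u i j x := sub_nonneg.2 ((hu i).anti x hj)
              simp only [abs_mul, abs_of_nonneg h0]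
              have := mul_le_mul_of_nonneg_left (hC W i x hWp) h0
              linarith
          _ = C * ∫ x, (u i I' x - u i j x) * 𝓜.ma (Function.update W i (quad 1)) x :=
            integral_const_mul _ _
          _ ≤ C * δ := mul_le_mul_of_nonneg_left h1 hC0
      rw [piecewise_insert_eq_update, ← hW, Finset.card_insert_of_notMem hi]
      rw [← e1] at e2
      push_cast
      rw [abs_le] at e2 ih ⊢
      constructor <;> linarith [e2.1, e2.2, ih.1, ih.2]
  have hfin := step Finset.univ
  rw [Finset.piecewise_univ, Finset.card_univ] at hfin
  rw [Real.dist_eq]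
  refine hfin.trans_lt ?_
  have : (N : ℝ) * (C * δ) = ε * (N * C / (2 * (N + 1) * (C + 1))) := by
    simp only [δ]; field_simp
  change (N : ℝ) * (C * δ) < ε
  rw [this]
  have h2 : (N : ℝ) * C / (2 * (N + 1) * (C + 1)) < 1 := by
    rw [div_lt_one (by positivity)]
    have : (0 : ℝ) ≤ N := Nat.cast_nonneg N
    nlinarith
  nlinarith

/-- Weak convergence of mixed Monge–Ampère densities against continuous functions. -/
lemma LocalSeq.cauchySeq (hB : IsCompact B) {u : σ → ℕ → EuclideanSpace ℝ ι → ℝ}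
    (hu : ∀ t, 𝓜.LocalSeq B (u t)) {f : EuclideanSpace ℝ ι → ℝ} (hf : Continuous f)
    (hc : HasCompactSupport f) (hfB : tsupport f ⊆ B) :
    CauchySeq fun j => ∫ x, f x * 𝓜.ma (fun t => u t j) x := by
  set m : ℝ := ∫ x in B, 𝓜.ma (fun t => u t 0) x
  have hm : 0 ≤ m := setIntegral_nonneg hB.measurableSet fun x _ =>
    𝓜.ma_nonneg (fun t => (hu t).psh 0) x
  have hmass : ∀ j, ∫ x in B, 𝓜.ma (fun t => u t j) x = m := fun j =>
    𝓜.setIntegral_ma_eq hB (fun t => ((hu t).psh 0).contDiff) (fun t => ((hu t).psh j).contDiff)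
      (fun t => (hu t).tsupp j 0)
  rw [Metric.cauchySeq_iff]
  intro ε hε
  set δ := ε / (3 * (m + 1))
  have hδ : 0 < δ := by positivity
  -- Replacing `f` by a uniformly close smooth function with support in that of `f` changes each
  -- integral by at most `δ * m`, because the mass `m` on `B` is the same for all `j`.
  obtain ⟨g, hg, hgf, hgs⟩ := hf.exists_contDiff_approx (ε := fun _ => δ) ⊤ continuous_const
    (fun _ => hδ)
  have hgts : tsupport g ⊆ tsupport f := closure_mono hgs
  have hgc : HasCompactSupport g := hc.of_isClosed_subset (isClosed_tsupport _) hgts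
  obtain ⟨I, hI⟩ := Metric.cauchySeq_iff.1 (LocalSeq.cauchySeq_of_smooth hB hu hg hgc) (ε / 3)
    (by positivity)
  have hsm := fun j => fun t => ((hu t).psh j).contDiff
  have close : ∀ j, |(∫ x, f x * 𝓜.ma (fun t => u t j) x) -
      ∫ x, g x * 𝓜.ma (fun t => u t j) x| ≤ ε / 3 := by
    intro j
    have hcont := (𝓜.ma_contDiff (hsm j)).continuous
    rw [← integral_sub (𝓜.integrable_mul_ma (hsm j) hf hc)
      (𝓜.integrable_mul_ma (hsm j) hg.continuous hgc)]
    have e1 : ∫ x, (f x * 𝓜.ma (fun t => u t j) x - g x * 𝓜.ma (fun t => u t j) x) =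
        ∫ x in B, (f x * 𝓜.ma (fun t => u t j) x - g x * 𝓜.ma (fun t => u t j) x) :=
      (setIntegral_eq_integral_of_forall_compl_eq_zero fun x hx => by
        rw [image_eq_zero_of_notMem_tsupport (f := f) fun h => hx (hfB h),
          image_eq_zero_of_notMem_tsupport (f := g) fun h => hx (hfB (hgts h))]
        simp).symm
    rw [e1]
    calc _ ≤ ∫ x in B, |f x * 𝓜.ma (fun t => u t j) x - g x * 𝓜.ma (fun t => u t j) x| :=
          abs_integral_le_integral_abs
      _ ≤ ∫ x in B, δ * 𝓜.ma (fun t => u t j) x := by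
        refine setIntegral_mono_on ?_ ?_ hB.measurableSet fun x _ => ?_
        · exact (((hf.mul hcont).sub (hg.continuous.mul hcont)).abs).continuousOn.integrableOn_compact hB
        · exact (continuous_const.mul hcont).continuousOn.integrableOn_compact hB
        · have h0 := 𝓜.ma_nonneg (fun t => (hu t).psh j) x
          rw [← sub_mul, abs_mul, abs_of_nonneg h0]
          refine mul_le_mul_of_nonneg_right ?_ h0
          have := hgf x
          rw [Real.dist_eq, abs_sub_comm] at this
          exact this.le
      _ = δ * m := by rw [integral_const_mul, hmass]
      _ ≤ ε / 3 := by
        simp only [δ]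
        rw [div_mul_eq_mul_div, div_le_div_iff₀ (by positivity) (by positivity)]
        nlinarith
  refine ⟨I, fun i hi j hj => ?_⟩
  have h1 := close i
  have h2 := close j
  have h3 := hI i hi j hj
  rw [Real.dist_eq] at h3 ⊢
  rw [abs_lt] at h3 ⊢
  rw [abs_le] at h1 h2
  constructor <;> linarith [h1.1, h1.2, h2.1, h2.2, h3.1, h3.2]

end MixedForm

/-! ### A convex gluing function -/

/-- A smooth convex nondecreasing function which vanishes on `(-∞, 0]` and has slope one on
`[1, ∞)`. -/
def glue (s : ℝ) : ℝ := ∫ t in (0 : ℝ)..s, Real.smoothTransition t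

lemma deriv_glue : deriv glue = Real.smoothTransition :=
  funext fun s => Continuous.deriv_integral _ Real.smoothTransition.continuous 0 s

lemma differentiable_glue : Differentiable ℝ glue := fun s =>
  (Real.smoothTransition.continuous.integral_hasStrictDerivAt 0 s).hasDerivAt.differentiableAt

lemma contDiff_glue : ContDiff ℝ ∞ glue :=
  contDiff_infty_iff_deriv.2 ⟨differentiable_glue, by
    rw [deriv_glue]; exact Real.smoothTransition.contDiff⟩

lemma monotone_glue : Monotone glue :=
  monotone_of_deriv_nonneg differentiable_glue fun s => by
    rw [deriv_glue]; exact Real.smoothTransition.nonneg s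

lemma glue_of_nonpos {s : ℝ} (hs : s ≤ 0) : glue s = 0 := by
  unfold glue
  rw [intervalIntegral.integral_congr (g := fun _ => (0 : ℝ))]
  · simp
  · intro t ht
    rw [Set.uIcc_of_ge hs] at ht
    exact Real.smoothTransition.zero_of_nonpos ht.2

lemma glue_nonneg (s : ℝ) : 0 ≤ glue s := by
  rcases le_total s 0 with h | h
  · rw [glue_of_nonpos h]
  · have := monotone_glue h
    rwa [glue_of_nonpos le_rfl] at this

lemma glue_le_abs (s : ℝ) : glue s ≤ |s| := by
  rcases le_total s 0 with h | h
  · rw [glue_of_nonpos h]; positivity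
  · have hm : Monotone fun s => s - glue s :=
      monotone_of_deriv_nonneg (differentiable_id.sub differentiable_glue) fun s => by
        rw [deriv_fun_sub differentiableAt_fun_id (differentiable_glue s), deriv_glue]
        simp [Real.smoothTransition.le_one s]
    have := hm h
    simp only [glue_of_nonpos le_rfl] at this
    rw [abs_of_nonneg h]; linarith

lemma glue_of_one_le {s : ℝ} (hs : 1 ≤ s) : glue s = s + (glue 1 - 1) := by
  have hi : ∀ a b, IntervalIntegrable Real.smoothTransition volume a b := fun a b =>
    Real.smoothTransition.continuous.intervalIntegrable a b
  have h1 : glue s = glue 1 + ∫ t in (1 : ℝ)..s, Real.smoothTransition t := by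
    unfold glue
    rw [intervalIntegral.integral_add_adjacent_intervals (hi 0 1) (hi 1 s)]
  have h2 : ∫ t in (1 : ℝ)..s, Real.smoothTransition t = ∫ _ in (1 : ℝ)..s, (1 : ℝ) := by
    refine intervalIntegral.integral_congr fun t ht => ?_
    rw [Set.uIcc_of_le hs] at ht
    exact Real.smoothTransition.one_of_one_le ht.1
  rw [h1, h2]; simp; ring

/-! ### Decreasing smooth approximations and localization -/

namespace MixedForm

variable {ι σ : Type*} [Fintype ι] [DecidableEq ι] [Fintype σ] [DecidableEq σ]
variable (𝓜 : MixedForm ι σ)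

/-- `w` is a sequence of smooth functions converging to `v` on `Ω`, which locally in `Ω` is
eventually plurisubharmonic and decreasing; `v` is locally bounded from below. -/
structure Approx (Ω : Set (EuclideanSpace ℝ ι)) (v : EuclideanSpace ℝ ι → ℝ)
    (w : ℕ → EuclideanSpace ℝ ι → ℝ) : Prop where
  contDiff : ∀ j, ContDiff ℝ ∞ (w j)
  local_psh : ∀ x ∈ Ω, ∃ V ∈ 𝓝 x, ∃ J, ∀ j ≥ J, ∀ y ∈ V, hess (w j) y ∈ 𝓜.cone ∧
    w (j + 1) y ≤ w j y
  tendsto : ∀ x ∈ Ω, Tendsto (fun j => w j x) atTop (𝓝 (v x))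
  bdd_below : ∀ x ∈ Ω, ∃ V ∈ 𝓝 x, ∃ C : ℝ, ∀ y ∈ V, -C ≤ v y

variable {𝓜} {Ω : Set (EuclideanSpace ℝ ι)}

lemma antitone_tail {a : ℕ → ℝ} {J : ℕ} (h : ∀ j ≥ J, a (j + 1) ≤ a j) {i j : ℕ} (hi : J ≤ i)
    (hij : i ≤ j) : a j ≤ a i := by
  induction j, hij using Nat.le_induction with
  | base => exact le_rfl
  | succ j hj ih => exact (h j (hi.trans hj)).trans ih

lemma tail_ge_of_tendsto {a : ℕ → ℝ} {J : ℕ} (h : ∀ j ≥ J, a (j + 1) ≤ a j) {l : ℝ}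
    (hl : Tendsto a atTop (𝓝 l)) {i : ℕ} (hi : J ≤ i) : l ≤ a i :=
  le_of_tendsto hl (eventually_atTop.2 ⟨i, fun _ hj => antitone_tail h hi hj⟩)

lemma contDiff_normSq_sub (x₀ : EuclideanSpace ℝ ι) (A c : ℝ) :
    ContDiff ℝ ∞ fun x : EuclideanSpace ℝ ι => A * (‖x - x₀‖ ^ 2 - c) :=
  contDiff_const.mul (((contDiff_id.sub contDiff_const).norm_sq ℝ).sub contDiff_const)

/-- An approximating sequence coincides near a given point, up to a constant, with a sequence
which does not depend on the index away from the point. -/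
lemma Approx.localize (hΩ : IsOpen Ω) {v : EuclideanSpace ℝ ι → ℝ} {w : ℕ → EuclideanSpace ℝ ι → ℝ}
    (hw : 𝓜.Approx Ω v w) {x₀ : EuclideanSpace ℝ ι} (hx₀ : x₀ ∈ Ω) :
    ∃ R₀ > 0, ∃ J₀, ∀ R, 0 < R → R ≤ R₀ → ∀ J ≥ J₀,
      ∃ u, 𝓜.LocalSeq (Metric.closedBall x₀ R) u ∧
        ∃ c : ℝ, ∀ j, ∀ y ∈ Metric.ball x₀ (R / 2), u j y = w (J + j) y + c := by
  obtain ⟨V, hV, J₀, hJ₀⟩ := hw.local_psh x₀ hx₀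
  obtain ⟨V', hV', C, hC⟩ := hw.bdd_below x₀ hx₀
  obtain ⟨R₀, hR₀, hball⟩ := Metric.nhds_basis_closedBall.mem_iff.1
    (Filter.inter_mem (Filter.inter_mem hV hV') (hΩ.mem_nhds hx₀))
  obtain ⟨M₁, hM₁⟩ := (isCompact_closedBall x₀ R₀).exists_bound_of_continuousOn
    (hw.contDiff J₀).continuous.continuousOn
  refine ⟨R₀, hR₀, J₀, fun R hR hRR J hJ => ?_⟩
  set M := |M₁| + |C|
  have hM0 : 0 ≤ M := by positivity
  have hsub : Metric.closedBall x₀ R ⊆ Metric.closedBall x₀ R₀ := Metric.closedBall_subset_closedBall hRR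
  have hanti : ∀ y ∈ Metric.closedBall x₀ R, ∀ j ≥ J₀, w (j + 1) y ≤ w j y := fun y hy j hj =>
    (hJ₀ j hj y (hball (hsub hy)).1.1).2
  have hbd : ∀ y ∈ Metric.closedBall x₀ R, ∀ j ≥ J₀, |w j y| ≤ M := by
    intro y hy j hj
    have h1 := antitone_tail (a := fun j => w j y) (hanti y hy) le_rfl hj
    have h2 := hM₁ y (hsub hy)
    have h3 := tail_ge_of_tendsto (a := fun j => w j y) (hanti y hy) (hw.tendsto y (hball (hsub hy)).2) hj
    have h4 := hC y (hball (hsub hy)).1.2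
    rw [Real.norm_eq_abs] at h2
    rw [abs_le]
    constructor
    · have := le_abs_self C
      have := abs_nonneg M₁
      simp only [M]; linarith
    · have := le_abs_self (w J₀ y)
      have := le_abs_self M₁
      have := abs_nonneg C
      simp only [M]; linarith
  -- The paraboloid `ρ` vanishes at radius `3 / 4 * R`. It has to be at most `-(M + 1)` up to radius
  -- `R / 2` and at least `M` from radius `7 / 8 * R` on. The available gaps are `9/16 - 1/4 = 5/16`
  -- and `49/64 - 9/16 = 13/64` times `A * R ^ 2`, and the factor `5` suffices since `5 * 13 / 64 >
  -- 1`.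
  set A : ℝ := 5 * (M + 1) / R ^ 2
  have hA0 : 0 ≤ A := by positivity
  have hAR : A * R ^ 2 = 5 * (M + 1) := by simp only [A]; field_simp
  set ρ : EuclideanSpace ℝ ι → ℝ := fun x => A * (‖x - x₀‖ ^ 2 - 9 / 16 * R ^ 2) with hρ
  have hρs : ContDiff ℝ ∞ ρ := contDiff_normSq_sub x₀ A _
  have hρh : ∀ x, hess ρ x = (2 * A) • (1 : Matrix ι ι ℝ) := fun x => hess_normSq_sub x₀ x A _
  have hρc : ∀ x, hess ρ x ∈ 𝓜.cone := fun x => by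
    rw [hρh]; exact 𝓜.smul_mem _ _ (by positivity) (𝓜.psd_mem _ Matrix.PosSemidef.one)
  have hin : ∀ y ∈ Metric.ball x₀ (R / 2), ρ y ≤ -(M + 1) := by
    intro y hy
    rw [mem_ball_iff_norm] at hy
    have : ‖y - x₀‖ ^ 2 ≤ R ^ 2 / 4 := by nlinarith [norm_nonneg (y - x₀)]
    have h2 : ρ y ≤ A * (R ^ 2 / 4 - 9 / 16 * R ^ 2) :=
      mul_le_mul_of_nonneg_left (by linarith) hA0
    nlinarith
  have hout : ∀ y, 7 / 8 * R ≤ ‖y - x₀‖ → M ≤ ρ y := by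
    intro y hy
    have : 49 / 64 * R ^ 2 ≤ ‖y - x₀‖ ^ 2 := by nlinarith [norm_nonneg (y - x₀)]
    have h2 : A * (49 / 64 * R ^ 2 - 9 / 16 * R ^ 2) ≤ ρ y :=
      mul_le_mul_of_nonneg_left (by linarith) hA0
    nlinarith
  have hρb : ∀ y ∈ Metric.closedBall x₀ R, |ρ y| ≤ 5 * (M + 1) := by
    intro y hy
    rw [mem_closedBall_iff_norm] at hy
    have : ‖y - x₀‖ ^ 2 ≤ R ^ 2 := by nlinarith [norm_nonneg (y - x₀)]
    have h0 : 0 ≤ ‖y - x₀‖ ^ 2 := by positivity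
    simp only [hρ]
    rw [abs_mul, abs_of_nonneg hA0, ← hAR]
    refine mul_le_mul_of_nonneg_left ?_ hA0
    rw [abs_le]
    constructor <;> nlinarith [sq_nonneg R]
  classical
  -- A smooth substitute for the maximum of `w` and `ρ`: it equals `ρ` where `w ≤ ρ`, and `w` plus a
  -- constant where `w ≥ ρ + 1`. Beyond the ball `w` is not controlled, so `u` switches to `ρ`
  -- there; near the sphere the two definitions agree.
  set G : ℕ → EuclideanSpace ℝ ι → ℝ := fun j y => ρ y + glue (w (J + j) y - ρ y) with hG
  set u : ℕ → EuclideanSpace ℝ ι → ℝ := fun j y => if y ∈ Metric.ball x₀ R then G j y else ρ y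
    with hu
  have hGs : ∀ j, ContDiff ℝ ∞ (G j) := fun j =>
    hρs.add (contDiff_glue.comp ((hw.contDiff _).sub hρs))
  have huG : ∀ j, ∀ y ∈ Metric.ball x₀ R, u j =ᶠ[𝓝 y] G j := by
    intro j y hy
    filter_upwards [Metric.isOpen_ball.mem_nhds hy] with z hz
    simp only [hu, hz, if_true]
  have huρ : ∀ j, ∀ y, y ∉ Metric.ball x₀ R → u j =ᶠ[𝓝 y] ρ := by
    intro j y hy
    have hy' : 7 / 8 * R < ‖y - x₀‖ := by
      rw [mem_ball_iff_norm, not_lt] at hy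
      linarith
    have hcont : Continuous fun z : EuclideanSpace ℝ ι => ‖z - x₀‖ := by fun_prop
    filter_upwards [(isOpen_lt continuous_const hcont).mem_nhds hy'] with z hz
    simp only [hu]
    split_ifs with h
    · have h1 := hout z (le_of_lt hz)
      have h2 := (abs_le.1 (hbd z (Metric.ball_subset_closedBall h) (J + j) (by omega))).2
      simp only [hG]
      rw [glue_of_nonpos (by linarith), add_zero]
    · rfl
  have hJ' : ∀ j, J₀ ≤ J + j := fun j => by omega
  refine ⟨u, ⟨fun j => ⟨?_, fun x => ?_⟩, fun x => ?_, fun i j => ?_, ?_⟩, ?_⟩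
  · refine contDiff_iff_contDiffAt.2 fun y => ?_
    by_cases hy : y ∈ Metric.ball x₀ R
    · exact (hGs j).contDiffAt.congr_of_eventuallyEq (huG j y hy)
    · exact hρs.contDiffAt.congr_of_eventuallyEq (huρ j y hy)
  · by_cases hy : x ∈ Metric.ball x₀ R
    · rw [hess_congr (huG j x hy)]
      have hws := hw.contDiff (J + j)
      have hd : ContDiff ℝ ∞ fun y => w (J + j) y - ρ y := hws.sub hρs
      simp only [hG]
      rw [hess_add (g := fun y => glue (w (J + j) y - ρ y)) hρs (contDiff_glue.comp hd), hess_comp contDiff_glue hd, hess_sub hws hρs,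
        deriv_glue]
      set s := Real.smoothTransition (w (J + j) x - ρ x)
      have hs0 : 0 ≤ s := Real.smoothTransition.nonneg _
      have hs1 : s ≤ 1 := Real.smoothTransition.le_one _
      have hcw := (hJ₀ (J + j) (hJ' j) x
        (hball (hsub (Metric.ball_subset_closedBall hy))).1.1).1
      -- The Hessian of `G j` is a convex combination of those of `ρ` and `w`, plus a nonnegative
      -- multiple of a rank-one positive semidefinite matrix.
      have e : ∀ X Y Z : Matrix ι ι ℝ, X + (s • (Y - X) + Z) = (1 - s) • X + s • Y + Z := by
        intro X Y Z
        rw [smul_sub, sub_smul, one_smul]; abel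
      rw [e]
      refine 𝓜.add_mem _ _ (𝓜.add_mem _ _ (𝓜.smul_mem _ _ (by linarith) (hρc x))
        (𝓜.smul_mem _ _ hs0 hcw)) (𝓜.smul_mem _ _ ?_ (𝓜.psd_mem _ (posSemidef_vecMulVec _)))
      exact Real.smoothTransition.monotone.deriv_nonneg
    · rw [hess_congr (huρ j x hy)]
      exact hρc x
  · refine antitone_nat_of_succ_le fun j => ?_
    simp only [hu]
    split_ifs with h
    · have := hanti x (Metric.ball_subset_closedBall h) (J + j) (hJ' j)
      simp only [hG]
      gcongr
      refine monotone_glue ?_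
      have h2 : J + (j + 1) = J + j + 1 := by ring
      rw [h2]; linarith
    · exact le_rfl
  · refine closure_minimal (fun y hy => ?_) Metric.isClosed_closedBall
    by_contra hn
    have hn' : y ∉ Metric.ball x₀ R := fun h => hn (Metric.ball_subset_closedBall h)
    exact hy (by simp only [hu, if_neg hn', sub_self])
  · refine ⟨5 * (M + 1) + (M + 5 * (M + 1)), fun j y hy => ?_⟩
    have h1 := hρb y hy
    have h2 := hbd y hy (J + j) (hJ' j)
    simp only [hu]
    split_ifs with h
    · simp only [hG]
      refine (abs_add_le _ _).trans (add_le_add h1 ?_)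
      rw [abs_of_nonneg (glue_nonneg _)]
      exact (glue_le_abs _).trans ((abs_sub _ _).trans (add_le_add h2 h1))
    · linarith
  · refine ⟨glue 1 - 1, fun j y hy => ?_⟩
    have h1 := hin y hy
    have hy' : y ∈ Metric.ball x₀ R := Metric.ball_subset_ball (by linarith) hy
    have h2 := (abs_le.1 (hbd y (Metric.ball_subset_closedBall hy') (J + j) (hJ' j))).1
    simp only [hu, hy', if_true, hG]
    rw [glue_of_one_le (by linarith)]
    ring

/-- The local form of the two convergence statements. -/
lemma Approx.local_convergence (hΩ : IsOpen Ω) {v : σ → EuclideanSpace ℝ ι → ℝ}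
    {w : σ → ℕ → EuclideanSpace ℝ ι → ℝ} (hw : ∀ t, 𝓜.Approx Ω (v t) (w t))
    {v₀ : EuclideanSpace ℝ ι → ℝ} {w₀ : ℕ → EuclideanSpace ℝ ι → ℝ} (hw₀ : 𝓜.Approx Ω v₀ w₀)
    {x₀ : EuclideanSpace ℝ ι} (hx₀ : x₀ ∈ Ω) :
    ∃ r > 0, ∀ f : EuclideanSpace ℝ ι → ℝ, Continuous f → HasCompactSupport f →
      tsupport f ⊆ Metric.ball x₀ r →
      (CauchySeq fun j => ∫ x, f x * 𝓜.ma (fun t => w t j) x) ∧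
      ∀ δ > 0, ∃ I, ∀ i j, I ≤ i → i ≤ j →
        |∫ x, f x * ((w₀ i x - w₀ j x) * 𝓜.ma (fun t => w t j) x)| ≤ δ := by
  obtain ⟨R₀, hR₀, J₀, hloc₀⟩ := hw₀.localize hΩ hx₀
  choose Rt hRt Jt hloct using fun t => (hw t).localize hΩ hx₀
  obtain ⟨R, hR, hR0, hRle⟩ : ∃ R > 0, R ≤ R₀ ∧ ∀ t, R ≤ Rt t := by
    have : ∀ᶠ R : ℝ in 𝓝[>] 0, R ≤ R₀ ∧ ∀ t, R ≤ Rt t := by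
      refine nhdsWithin_le_nhds ?_
      refine Filter.Eventually.and (Iic_mem_nhds hR₀) ?_
      rw [eventually_all]
      exact fun t => Iic_mem_nhds (hRt t)
    obtain ⟨R, hR, hpos⟩ := (this.and self_mem_nhdsWithin).exists
    exact ⟨R, hpos, hR.1, hR.2⟩
  set J := J₀ + ∑ t, Jt t
  have hJt : ∀ t, Jt t ≤ J := fun t =>
    (Finset.single_le_sum (f := Jt) (fun _ _ => Nat.zero_le _) (Finset.mem_univ t)).trans
      (Nat.le_add_left _ _)
  obtain ⟨u₀, hu₀, c₀, hc₀⟩ := hloc₀ R hR hR0 J (Nat.le_add_right _ _)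
  choose u hu c hcu using fun t => hloct t R hR (hRle t) J (hJt t)
  have hB : IsCompact (Metric.closedBall x₀ R) := isCompact_closedBall x₀ R
  have hma : ∀ j, ∀ y ∈ Metric.ball x₀ (R / 2),
      𝓜.ma (fun t => w t (J + j)) y = 𝓜.ma (fun t => u t j) y := by
    intro j y hy
    unfold ma
    congr 1
    funext t
    have : u t j =ᶠ[𝓝 y] fun z => w t (J + j) z + c t := by
      filter_upwards [Metric.isOpen_ball.mem_nhds hy] with z hz using hcu t j z hz
    rw [hess_congr this, hess_add_const ((hw t).contDiff _)]
  refine ⟨R / 2, by positivity, fun f hf hfc hfs => ?_⟩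
  have hzero : ∀ y, y ∉ Metric.ball x₀ (R / 2) → f y = 0 := fun y hy =>
    image_eq_zero_of_notMem_tsupport fun h => hy (hfs h)
  constructor
  · have h1 := LocalSeq.cauchySeq hB hu hf hfc
      (hfs.trans (Metric.ball_subset_closedBall.trans
        (Metric.closedBall_subset_closedBall (by linarith))))
    have h2 : (fun j => ∫ x, f x * 𝓜.ma (fun t => u t j) x) =
        fun j => ∫ x, f x * 𝓜.ma (fun t => w t (J + j)) x := by
      funext j
      congr 1
      funext x
      by_cases hx : x ∈ Metric.ball x₀ (R / 2)
      · rw [hma j x hx]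
      · rw [hzero x hx, zero_mul, zero_mul]
    rw [h2] at h1
    obtain ⟨l, hl⟩ := cauchySeq_tendsto_of_complete h1
    have h3 : Tendsto (fun j => ∫ x, f x * 𝓜.ma (fun t => w t (j + J)) x) atTop (𝓝 l) := by
      simpa only [add_comm] using hl
    exact ((tendsto_add_atTop_iff_nat (f := fun j => ∫ x, f x * 𝓜.ma (fun t => w t j) x)
      J).1 h3).cauchySeq
  · intro δ hδ
    obtain ⟨Cf, hCf⟩ := hf.bounded_above_of_compact_support hfc
    choose M hM using fun t => (hu t).bdd
    set M' : ℝ := ∑ t, |M t|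
    have hM't : ∀ t j, ∀ x ∈ Metric.closedBall x₀ R, |u t j x| ≤ M' := fun t j x hx =>
      (hM t j x hx).trans <| (le_abs_self _).trans <|
        (Finset.single_le_sum (f := fun t => |M t|) (fun _ _ => abs_nonneg _)
          (Finset.mem_univ t))
    have hCf0 : 0 ≤ Cf := (norm_nonneg _).trans (hCf 0)
    obtain ⟨I, hI⟩ := hu₀.uniform_small hB M'
      (∫ x in Metric.closedBall x₀ R, 𝓜.ma (fun t => u t 0) x) (δ := δ / (Cf + 1)) (by positivity)
    refine ⟨J + I, fun i j hi hij => ?_⟩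
    obtain ⟨i', rfl⟩ : ∃ i', i = J + i' := ⟨i - J, by omega⟩
    obtain ⟨j', rfl⟩ : ∃ j', j = J + j' := ⟨j - J, by omega⟩
    have hi' : I ≤ i' := by omega
    have hij' : i' ≤ j' := by omega
    have h1 := hI i' j' hi' hij' (fun t => u t j') (fun t => (hu t).psh j')
      (fun t => hM't t j') (le_of_eq (𝓜.setIntegral_ma_eq hB
        (fun t => ((hu t).psh 0).contDiff) (fun t => ((hu t).psh j').contDiff)
        (fun t => (hu t).tsupp j' 0)))
    have h2 : ∫ x, f x * ((w₀ (J + i') x - w₀ (J + j') x) * 𝓜.ma (fun t => w t (J + j')) x) =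
        ∫ x, f x * ((u₀ i' x - u₀ j' x) * 𝓜.ma (fun t => u t j') x) := by
      congr 1
      funext x
      by_cases hx : x ∈ Metric.ball x₀ (R / 2)
      · rw [hma j' x hx, hc₀ i' x hx, hc₀ j' x hx]; ring
      · rw [hzero x hx, zero_mul, zero_mul]
    rw [h2]
    have hcs : HasCompactSupport fun x => u₀ i' x - u₀ j' x :=
      hB.of_isClosed_subset (isClosed_tsupport _) (hu₀.tsupp i' j')
    have hcont : Continuous fun x => u₀ i' x - u₀ j' x :=
      (hu₀.psh i').contDiff.continuous.sub (hu₀.psh j').contDiff.continuous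
    have hintg := 𝓜.integrable_mul_ma (w := fun t => u t j')
      (fun t => ((hu t).psh j').contDiff) hcont hcs
    have hcma := (𝓜.ma_contDiff fun t => ((hu t).psh j').contDiff).continuous
    calc _ ≤ ∫ x, |f x * ((u₀ i' x - u₀ j' x) * 𝓜.ma (fun t => u t j') x)| :=
          abs_integral_le_integral_abs
      _ ≤ ∫ x, Cf * ((u₀ i' x - u₀ j' x) * 𝓜.ma (fun t => u t j') x) := by
        refine integral_mono ?_ (hintg.const_mul _) fun x => ?_
        · exact ((hf.mul (hcont.mul hcma)).integrable_of_hasCompactSupport hfc.mul_right).abs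
        · have h0 : 0 ≤ u₀ i' x - u₀ j' x := sub_nonneg.2 (hu₀.anti x hij')
          have h00 := mul_nonneg h0 (𝓜.ma_nonneg (fun t => (hu t).psh j') x)
          change |f x * _| ≤ _
          rw [abs_mul, abs_of_nonneg h00]
          exact mul_le_mul_of_nonneg_right (hCf x) h00
      _ = Cf * ∫ x, (u₀ i' x - u₀ j' x) * 𝓜.ma (fun t => u t j') x := integral_const_mul _ _
      _ ≤ Cf * (δ / (Cf + 1)) := mul_le_mul_of_nonneg_left h1 hCf0
      _ ≤ δ := by
        rw [mul_div_assoc', div_le_iff₀ (by positivity)]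
        nlinarith

/-- A property of continuous functions with compact support in `Ω` which is additive and holds
locally holds globally. -/
lemma of_local {P : (EuclideanSpace ℝ ι → ℝ) → Prop}
    (hadd : ∀ f g : EuclideanSpace ℝ ι → ℝ, Continuous f → HasCompactSupport f → Continuous g →
      HasCompactSupport g → P f → P g → P (fun x => f x + g x)) (h0 : P fun _ => 0)
    (hloc : ∀ x ∈ Ω, ∃ r > 0, ∀ f, Continuous f → HasCompactSupport f →
      tsupport f ⊆ Metric.ball x r → P f)
    {f : EuclideanSpace ℝ ι → ℝ} (hf : Continuous f) (hc : HasCompactSupport f)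
    (hfΩ : tsupport f ⊆ Ω) : P f := by
  choose! r hr hP using hloc
  obtain ⟨T, hT⟩ := hc.elim_nhds_subcover' (fun x _ => Metric.ball x (r x))
    (fun x hx => Metric.ball_mem_nhds x (hr x (hfΩ hx)))
  set e := T.equivFin.symm
  obtain ⟨φ, hφs, hφ1, -, hφc⟩ := exists_continuous_sum_one_of_isOpen_isCompact
    (s := fun k => Metric.ball ((e k : tsupport f) : EuclideanSpace ℝ ι) (r (e k : tsupport f)))
    (fun _ => Metric.isOpen_ball) hc (fun y hy => by
      obtain ⟨z, hz, hyz⟩ := Set.mem_iUnion₂.1 (hT hy)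
      exact Set.mem_iUnion.2 ⟨e.symm ⟨z, hz⟩, by simpa using hyz⟩)
  have hsum : f = fun x => ∑ k, φ k x * f x := by
    funext x
    by_cases hx : x ∈ tsupport f
    · rw [← Finset.sum_mul]
      have := hφ1 hx
      simp only [Finset.sum_apply, Pi.one_apply] at this
      rw [this, one_mul]
    · simp [image_eq_zero_of_notMem_tsupport hx]
  have hk : ∀ k, Continuous (fun x => φ k x * f x) ∧ HasCompactSupport (fun x => φ k x * f x) ∧
      P fun x => φ k x * f x := by
    intro k
    have h1 : Continuous fun x => φ k x * f x := (φ k).continuous.mul hf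
    have h2 : HasCompactSupport fun x => φ k x * f x := hc.mul_left
    refine ⟨h1, h2, hP _ (hfΩ (e k : tsupport f).2) _ h1 h2 ?_⟩
    exact (closure_mono (Function.support_mul_subset_left _ _)).trans (hφs k)
  have key : ∀ s : Finset (Fin T.card), Continuous (fun x => ∑ k ∈ s, φ k x * f x) ∧
      HasCompactSupport (fun x => ∑ k ∈ s, φ k x * f x) ∧
      P fun x => ∑ k ∈ s, φ k x * f x := by
    intro s
    induction s using Finset.induction_on with
    | empty => exact ⟨by simpa using continuous_const, by
        simp only [Finset.sum_empty]; exact HasCompactSupport.zero,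
        by simpa using h0⟩
    | insert k s hks ih =>
      simp only [Finset.sum_insert hks]
      exact ⟨(hk k).1.add ih.1, (hk k).2.1.add ih.2.1,
        hadd _ _ (hk k).1 (hk k).2.1 ih.1 ih.2.1 (hk k).2.2 ih.2.2⟩
  rw [hsum]
  exact (key Finset.univ).2.2

lemma Approx.cauchySeq (hΩ : IsOpen Ω) {v : σ → EuclideanSpace ℝ ι → ℝ}
    {w : σ → ℕ → EuclideanSpace ℝ ι → ℝ} (hw : ∀ t, 𝓜.Approx Ω (v t) (w t))
    {f : EuclideanSpace ℝ ι → ℝ} (hf : Continuous f) (hc : HasCompactSupport f)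
    (hfΩ : tsupport f ⊆ Ω) :
    CauchySeq fun j => ∫ x, f x * 𝓜.ma (fun t => w t j) x := by
  -- A dummy for `w₀` in `Approx.local_convergence`, whose first conclusion does not involve `w₀`.
  have hzero : 𝓜.Approx Ω (fun _ => 0) (fun _ _ => 0) :=
    ⟨fun _ => contDiff_const, fun x _ => ⟨Set.univ, univ_mem, 0, fun j _ y _ =>
      ⟨by simpa using 𝓜.psd_mem _ Matrix.PosSemidef.zero, le_rfl⟩⟩, fun x _ => tendsto_const_nhds,
      fun x _ => ⟨Set.univ, univ_mem, 0, by simp⟩⟩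
  refine of_local (Ω := Ω) (P := fun f => CauchySeq fun j => ∫ x, f x * 𝓜.ma (fun t => w t j) x)
    ?_ ?_ ?_ hf hc hfΩ
  · intro f g hf hfc hg hgc h1 h2
    have h3 := h1.add h2
    convert h3 using 1
    funext j
    have hs := fun t => (hw t).contDiff j
    change _ = (∫ x, f x * 𝓜.ma (fun t => w t j) x) + ∫ x, g x * 𝓜.ma (fun t => w t j) x
    rw [← integral_add (𝓜.integrable_mul_ma hs hf hfc) (𝓜.integrable_mul_ma hs hg hgc)]
    simp only [add_mul]
  · simpa using cauchySeq_const (0 : ℝ)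
  · intro x hx
    obtain ⟨r, hr, h⟩ := Approx.local_convergence hΩ hw hzero hx
    exact ⟨r, hr, fun f hf hfc hfs => (h f hf hfc hfs).1⟩

lemma Approx.uniform_small (hΩ : IsOpen Ω) {v : σ → EuclideanSpace ℝ ι → ℝ}
    {w : σ → ℕ → EuclideanSpace ℝ ι → ℝ} (hw : ∀ t, 𝓜.Approx Ω (v t) (w t))
    {v₀ : EuclideanSpace ℝ ι → ℝ} {w₀ : ℕ → EuclideanSpace ℝ ι → ℝ} (hw₀ : 𝓜.Approx Ω v₀ w₀)
    {f : EuclideanSpace ℝ ι → ℝ} (hf : Continuous f) (hc : HasCompactSupport f)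
    (hfΩ : tsupport f ⊆ Ω) {δ : ℝ} (hδ : 0 < δ) :
    ∃ I, ∀ i j, I ≤ i → i ≤ j →
        |∫ x, f x * ((w₀ i x - w₀ j x) * 𝓜.ma (fun t => w t j) x)| ≤ δ := by
  refine of_local (Ω := Ω) (P := fun f => ∀ δ > 0, ∃ I, ∀ i j, I ≤ i → i ≤ j →
        |∫ x, f x * ((w₀ i x - w₀ j x) * 𝓜.ma (fun t => w t j) x)| ≤ δ)
    ?_ ?_ ?_ hf hc hfΩ δ hδ
  · intro f g hf hfc hg hgc h1 h2 δ hδ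
    obtain ⟨I₁, hI₁⟩ := h1 (δ / 2) (by positivity)
    obtain ⟨I₂, hI₂⟩ := h2 (δ / 2) (by positivity)
    refine ⟨max I₁ I₂, fun i j hi hij => ?_⟩
    have e1 := hI₁ i j (le_of_max_le_left hi) hij
    have e2 := hI₂ i j (le_of_max_le_right hi) hij
    have hcont : Continuous fun x => (w₀ i x - w₀ j x) * 𝓜.ma (fun t => w t j) x :=
      ((hw₀.contDiff i).continuous.sub (hw₀.contDiff j).continuous).mul
        (𝓜.ma_contDiff fun t => (hw t).contDiff j).continuous
    have hi : ∀ φ : EuclideanSpace ℝ ι → ℝ, Continuous φ → HasCompactSupport φ →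
        Integrable fun x => φ x * ((w₀ i x - w₀ j x) * 𝓜.ma (fun t => w t j) x) :=
      fun φ h1 h2 => (h1.mul hcont).integrable_of_hasCompactSupport h2.mul_right
    simp only [add_mul]
    rw [integral_add (hi f hf hfc) (hi g hg hgc)]
    exact (abs_add_le _ _).trans (by linarith)
  · intro δ hδ
    exact ⟨0, fun i j _ _ => by simpa using hδ.le⟩
  · intro x hx
    obtain ⟨r, hr, h⟩ := Approx.local_convergence hΩ hw hw₀ hx
    exact ⟨r, hr, fun f hf hfc hfs => (h f hf hfc hfs).2⟩

end MixedForm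

/-! ### The limiting measure -/

namespace MixedForm

variable {ι σ : Type*} [Fintype ι] [DecidableEq ι] [Fintype σ] [DecidableEq σ]
variable {𝓜 : MixedForm ι σ} {Ω : Set (EuclideanSpace ℝ ι)}

namespace Approx

variable {v : EuclideanSpace ℝ ι → ℝ} {w : ℕ → EuclideanSpace ℝ ι → ℝ}
  {K : Set (EuclideanSpace ℝ ι)}

lemma psh_on_compact (hw : 𝓜.Approx Ω v w) (hK : IsCompact K) (hKΩ : K ⊆ Ω) :
    ∃ J, ∀ j ≥ J, ∀ y ∈ K, hess (w j) y ∈ 𝓜.cone ∧ w (j + 1) y ≤ w j y := by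
  refine hK.induction_on (p := fun K => ∃ J, ∀ j ≥ J, ∀ y ∈ K, hess (w j) y ∈ 𝓜.cone ∧
    w (j + 1) y ≤ w j y) ⟨0, by simp⟩ ?_ ?_ ?_
  · rintro s t hst ⟨J, hJ⟩
    exact ⟨J, fun j hj y hy => hJ j hj y (hst hy)⟩
  · rintro s t ⟨J, hJ⟩ ⟨J', hJ'⟩
    refine ⟨max J J', fun j hj y hy => ?_⟩
    rcases hy with hy | hy
    · exact hJ j (le_of_max_le_left hj) y hy
    · exact hJ' j (le_of_max_le_right hj) y hy
  · intro x hx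
    obtain ⟨V, hV, J, hJ⟩ := hw.local_psh x (hKΩ hx)
    exact ⟨V, mem_nhdsWithin_of_mem_nhds hV, J, hJ⟩

lemma le_on_compact (hw : 𝓜.Approx Ω v w) (hK : IsCompact K) (hKΩ : K ⊆ Ω) :
    ∃ J, ∀ j ≥ J, ∀ y ∈ K, v y ≤ w j y := by
  obtain ⟨J, hJ⟩ := hw.psh_on_compact hK hKΩ
  exact ⟨J, fun j hj y hy => tail_ge_of_tendsto (a := fun j => w j y)
    (fun i hi => (hJ i hi y hy).2) (hw.tendsto y (hKΩ hy)) hj⟩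

lemma bdd_below_on_compact (hw : 𝓜.Approx Ω v w) (hK : IsCompact K) (hKΩ : K ⊆ Ω) :
    ∃ C : ℝ, ∀ y ∈ K, -C ≤ v y := by
  refine hK.induction_on (p := fun K => ∃ C : ℝ, ∀ y ∈ K, -C ≤ v y) ⟨0, by simp⟩ ?_ ?_ ?_
  · rintro s t hst ⟨C, hC⟩
    exact ⟨C, fun y hy => hC y (hst hy)⟩
  · rintro s t ⟨C, hC⟩ ⟨C', hC'⟩
    refine ⟨max C C', fun y hy => ?_⟩
    rcases hy with hy | hy
    · exact (neg_le_neg (le_max_left _ _)).trans (hC y hy)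
    · exact (neg_le_neg (le_max_right _ _)).trans (hC' y hy)
  · intro x hx
    obtain ⟨V, hV, C, hC⟩ := hw.bdd_below x (hKΩ hx)
    exact ⟨V, mem_nhdsWithin_of_mem_nhds hV, C, hC⟩

lemma bound_on_compact (hw : 𝓜.Approx Ω v w) (hK : IsCompact K) (hKΩ : K ⊆ Ω) :
    ∃ J, ∃ M : ℝ, ∀ j ≥ J, ∀ y ∈ K, |w j y| ≤ M := by
  obtain ⟨J, hJ⟩ := hw.psh_on_compact hK hKΩ
  obtain ⟨J', hJ'⟩ := hw.le_on_compact hK hKΩ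
  obtain ⟨C, hC⟩ := hw.bdd_below_on_compact hK hKΩ
  obtain ⟨M, hM⟩ := hK.exists_bound_of_continuousOn (hw.contDiff J).continuous.continuousOn
  refine ⟨max J J', max C M, fun j hj y hy => abs_le.2 ⟨?_, ?_⟩⟩
  · exact (neg_le_neg (le_max_left _ _)).trans
      ((hC y hy).trans (hJ' j (le_of_max_le_right hj) y hy))
  · exact ((antitone_tail (a := fun j => w j y) (fun i hi => (hJ i hi y hy).2) le_rfl
      (le_of_max_le_left hj)).trans ((le_abs_self _).trans (hM y hy))).trans (le_max_right _ _)

/-- As in Dini's theorem: one member is below `c` at `x`, hence near `x` by its continuity, and the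
later members lie below it. -/
lemma eventually_lt (hw : 𝓜.Approx Ω v w) {x : EuclideanSpace ℝ ι} (hx : x ∈ Ω) {c : ℝ}
    (hc : v x < c) : ∀ᶠ p : ℕ × EuclideanSpace ℝ ι in atTop ×ˢ 𝓝 x, w p.1 p.2 < c := by
  obtain ⟨V, hV, J, hJ⟩ := hw.local_psh x hx
  obtain ⟨i, hi, hiJ⟩ := (((hw.tendsto x hx).eventually_lt_const hc).and
    (eventually_ge_atTop J)).exists
  have h1 : ∀ᶠ y in 𝓝 x, w i y < c ∧ y ∈ V :=
    ((hw.contDiff i).continuous.continuousAt.eventually_lt_const hi).and hV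
  filter_upwards [(eventually_ge_atTop i).prod_mk h1] with p hp
  exact (antitone_tail (a := fun j => w j p.2) (fun j hj => (hJ j hj p.2 hp.2.2).2) hiJ
    hp.1).trans_lt hp.2.1

lemma aestronglyMeasurable (hw : 𝓜.Approx Ω v w) {μ : Measure (EuclideanSpace ℝ ι)}
    {s : Set (EuclideanSpace ℝ ι)} (hs : MeasurableSet s) (hsΩ : s ⊆ Ω) :
    AEStronglyMeasurable v (μ.restrict s) := by
  refine aestronglyMeasurable_of_tendsto_ae atTop (f := w)
    (fun j => (hw.contDiff j).continuous.aestronglyMeasurable) ?_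
  filter_upwards [ae_restrict_mem hs] with x hx using hw.tendsto x (hsΩ hx)

end Approx

lemma integral_mul_ma_nonneg {v : σ → EuclideanSpace ℝ ι → ℝ} {w : σ → ℕ → EuclideanSpace ℝ ι → ℝ}
    (hw : ∀ t, 𝓜.Approx Ω (v t) (w t)) {f : EuclideanSpace ℝ ι → ℝ} (hc : HasCompactSupport f)
    (hfΩ : tsupport f ⊆ Ω) (h0 : ∀ x, 0 ≤ f x) :
    ∀ᶠ j in atTop, 0 ≤ ∫ x, f x * 𝓜.ma (fun t => w t j) x := by
  choose J hJ using fun t => (hw t).psh_on_compact hc hfΩ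
  have : ∀ᶠ j in atTop, ∀ t, J t ≤ j := by
    rw [eventually_all]; exact fun t => eventually_ge_atTop (J t)
  filter_upwards [this] with j hj
  refine integral_nonneg fun x => ?_
  by_cases hx : x ∈ tsupport f
  · exact mul_nonneg (h0 x) (𝓜.disc_nonneg fun t => (hJ t j (hj t) x hx).1)
  · simp [image_eq_zero_of_notMem_tsupport hx]

/-- `μ` is the weak limit of the mixed Monge–Ampère densities of `w`. -/
structure IsLimitMeasure (𝓜 : MixedForm ι σ) (Ω : Set (EuclideanSpace ℝ ι))
    (w : σ → ℕ → EuclideanSpace ℝ ι → ℝ) (μ : Measure (EuclideanSpace ℝ ι)) : Prop where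
  lt_top : ∀ K, IsCompact K → K ⊆ Ω → μ K < ⊤
  tendsto : ∀ f : EuclideanSpace ℝ ι → ℝ, Continuous f → HasCompactSupport f → tsupport f ⊆ Ω →
    Tendsto (fun j => ∫ x, f x * 𝓜.ma (fun t => w t j) x) atTop (𝓝 (∫ x in Ω, f x ∂μ))

/-- The limits against test functions exist by `Approx.cauchySeq`. They define a linear functional
on compactly supported continuous functions on `Ω`, which is positive because the densities are
eventually nonnegative on any compact subset of `Ω`. The Riesz measure on the subtype is then pushed
forward to the whole space. -/
lemma exists_isLimitMeasure (hΩ : IsOpen Ω) {v : σ → EuclideanSpace ℝ ι → ℝ}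
    {w : σ → ℕ → EuclideanSpace ℝ ι → ℝ} (hw : ∀ t, 𝓜.Approx Ω (v t) (w t)) :
    ∃ μ, IsLimitMeasure 𝓜 Ω w μ := by
  have : LocallyCompactSpace ↥Ω := hΩ.locallyCompactSpace
  have hemb : IsOpenEmbedding (Subtype.val : ↥Ω → EuclideanSpace ℝ ι) := hΩ.isOpenEmbedding_subtypeVal
  set ext : CompactlySupportedContinuousMap ↥Ω ℝ → EuclideanSpace ℝ ι → ℝ := fun g => Function.extend Subtype.val g 0
  have hext : ∀ g (y : ↥Ω), ext g y = g y := fun g y => Subtype.val_injective.extend_apply _ _ _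
  have hext0 : ∀ g y, y ∉ Ω → ext g y = 0 := fun g y hy =>
    Function.extend_apply' _ _ _ (by rintro ⟨z, rfl⟩; exact hy z.2)
  have hcont : ∀ g, Continuous (ext g) := fun g =>
    g.hasCompactSupport.continuous_extend_zero hΩ g.continuous
  have hcs : ∀ g, HasCompactSupport (ext g) := fun g =>
    HasCompactSupport.extend_zero g.hasCompactSupport continuous_subtype_val
  have hts : ∀ g, tsupport (ext g) ⊆ Ω := fun g =>
    (g.hasCompactSupport.tsupport_extend_zero_subset continuous_subtype_val).trans
      (Subtype.coe_image_subset _ _)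
  choose L hL using fun g => cauchySeq_tendsto_of_complete
    (Approx.cauchySeq hΩ hw (hcont g) (hcs g) (hts g))
  have hintg : ∀ g j, Integrable fun x => ext g x * 𝓜.ma (fun t => w t j) x := fun g j =>
    𝓜.integrable_mul_ma (fun t => (hw t).contDiff j) (hcont g) (hcs g)
  set Λ : CompactlySupportedContinuousMap ↥Ω ℝ →ₗ[ℝ] ℝ :=
    { toFun := L
      map_add' := fun f g => by
        refine tendsto_nhds_unique (hL (f + g)) (((hL f).add (hL g)).congr fun j => ?_)
        rw [← integral_add (hintg f j) (hintg g j)]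
        refine integral_congr_ae (Eventually.of_forall fun x => ?_)
        by_cases hx : x ∈ Ω
        · have h1 := hext (f + g) ⟨x, hx⟩
          have h2 := hext f ⟨x, hx⟩
          have h3 := hext g ⟨x, hx⟩
          simp only at h1 h2 h3 ⊢
          rw [h1, h2, h3]; simp [add_mul]
        · simp [hext0 _ x hx]
      map_smul' := fun c f => by
        refine tendsto_nhds_unique (hL (c • f)) (((hL f).const_mul c).congr fun j => ?_)
        rw [← integral_const_mul]
        refine integral_congr_ae (Eventually.of_forall fun x => ?_)
        by_cases hx : x ∈ Ω
        · have h1 := hext (c • f) ⟨x, hx⟩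
          have h2 := hext f ⟨x, hx⟩
          simp only at h1 h2 ⊢
          rw [h1, h2]; simp [mul_assoc]
        · simp [hext0 _ x hx] }
  set Λp : CompactlySupportedContinuousMap ↥Ω ℝ →ₚ[ℝ] ℝ := PositiveLinearMap.mk₀ Λ (by
    intro f hf
    refine ge_of_tendsto (hL f) (integral_mul_ma_nonneg hw (hcs f) (hts f) fun x => ?_)
    by_cases hx : x ∈ Ω
    · rw [show x = ((⟨x, hx⟩ : ↥Ω) : EuclideanSpace ℝ ι) from rfl, hext]; exact hf ⟨x, hx⟩
    · exact (hext0 _ x hx).ge)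
  have hme : MeasurableEmbedding (Subtype.val : ↥Ω → EuclideanSpace ℝ ι) :=
    MeasurableEmbedding.subtype_coe hΩ.measurableSet
  refine ⟨(RealRMK.rieszMeasure Λp).map Subtype.val, fun K hK hKΩ => ?_, fun f hf hc hfΩ => ?_⟩
  · rw [hme.map_apply]
    have := RealRMK.regular_rieszMeasure Λp
    refine IsCompact.measure_lt_top ?_
    rw [Topology.IsInducing.isCompact_iff hemb.isInducing, Subtype.image_preimage_coe,
      Set.inter_eq_right.2 hKΩ]
    exact hK
  · have hcf : HasCompactSupport fun y : ↥Ω => f y := by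
      refine HasCompactSupport.intro (K := Subtype.val ⁻¹' tsupport f) ?_ fun x hx =>
        image_eq_zero_of_notMem_tsupport hx
      rw [Topology.IsInducing.isCompact_iff hemb.isInducing, Subtype.image_preimage_coe,
        Set.inter_eq_right.2 hfΩ]
      exact hc
    set g : CompactlySupportedContinuousMap ↥Ω ℝ := ⟨⟨fun y => f y, hf.comp continuous_subtype_val⟩, hcf⟩
    have hg : ext g = f := by
      funext x
      by_cases hx : x ∈ Ω
      · exact hext g ⟨x, hx⟩
      · rw [hext0 _ _ hx, image_eq_zero_of_notMem_tsupport fun h => hx (hfΩ h)]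
    rw [hme.setIntegral_map, Subtype.coe_preimage_self, Measure.restrict_univ]
    have h1 := RealRMK.integral_rieszMeasure Λp g
    have h2 : Λp g = L g := rfl
    change Tendsto _ _ (𝓝 (∫ x, g x ∂(RealRMK.rieszMeasure Λp)))
    rw [h1, h2, ← hg]
    exact hL g

/-- Since `v₀` need not be continuous, weak convergence does not apply to `f * v₀`. Instead the
index of `w₀` is frozen at `i`, with an error that is small uniformly in `j ≥ i` by
`Approx.uniform_small`. Then `j → ∞` with the continuous test function `f * w₀ i`, and `i → ∞` by
dominated convergence. -/
lemma IsLimitMeasure.tendsto_mul (hΩ : IsOpen Ω) {v : σ → EuclideanSpace ℝ ι → ℝ}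
    {w : σ → ℕ → EuclideanSpace ℝ ι → ℝ} (hw : ∀ t, 𝓜.Approx Ω (v t) (w t))
    {v₀ : EuclideanSpace ℝ ι → ℝ} {w₀ : ℕ → EuclideanSpace ℝ ι → ℝ} (hw₀ : 𝓜.Approx Ω v₀ w₀)
    {μ : Measure (EuclideanSpace ℝ ι)} (hμ : IsLimitMeasure 𝓜 Ω w μ)
    {f : EuclideanSpace ℝ ι → ℝ} (hf : Continuous f) (hc : HasCompactSupport f)
    (hfΩ : tsupport f ⊆ Ω) :
    Tendsto (fun j => ∫ x, f x * (w₀ j x * 𝓜.ma (fun t => w t j) x)) atTop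
      (𝓝 (∫ x in Ω, f x * v₀ x ∂μ)) := by
  have hcw : ∀ i, Continuous (w₀ i) := fun i => (hw₀.contDiff i).continuous
  have hcm : ∀ j, Continuous (𝓜.ma fun t => w t j) := fun j =>
    (𝓜.ma_contDiff fun t => (hw t).contDiff j).continuous
  have hintg : ∀ i j, Integrable fun x => f x * (w₀ i x * 𝓜.ma (fun t => w t j) x) := fun i j =>
    (hf.mul ((hcw i).mul (hcm j))).integrable_of_hasCompactSupport hc.mul_right
  have hlim1 : ∀ i, Tendsto (fun j => ∫ x, f x * (w₀ i x * 𝓜.ma (fun t => w t j) x)) atTop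
      (𝓝 (∫ x in Ω, f x * w₀ i x ∂μ)) := by
    intro i
    have := hμ.tendsto (fun x => f x * w₀ i x) (hf.mul (hcw i)) hc.mul_right
      ((closure_mono (Function.support_mul_subset_left _ _)).trans hfΩ)
    simpa only [mul_assoc] using this
  have hlim2 : Tendsto (fun i => ∫ x in Ω, f x * w₀ i x ∂μ) atTop
      (𝓝 (∫ x in Ω, f x * v₀ x ∂μ)) := by
    have hz : ∀ g : EuclideanSpace ℝ ι → ℝ, ∫ x in Ω, f x * g x ∂μ =
        ∫ x in tsupport f, f x * g x ∂μ := fun g =>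
      (setIntegral_eq_of_subset_of_forall_sdiff_eq_zero hΩ.measurableSet hfΩ fun x hx => by
        rw [image_eq_zero_of_notMem_tsupport hx.2, zero_mul])
    simp only [hz]
    obtain ⟨J, M, hM⟩ := hw₀.bound_on_compact hc hfΩ
    obtain ⟨C, hC⟩ := hf.bounded_above_of_compact_support hc
    have hfin : μ (tsupport f) < ⊤ := hμ.lt_top _ hc hfΩ
    rw [← tendsto_add_atTop_iff_nat J]
    refine tendsto_integral_of_dominated_convergence (fun _ => C * M) (fun i => ?_) ?_
      (fun i => ?_) ?_
    · exact (hf.mul (hcw _)).aestronglyMeasurable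
    · exact integrableOn_const hfin.ne
    · filter_upwards [ae_restrict_mem (isClosed_tsupport f).measurableSet] with x hx
      rw [norm_mul]
      exact mul_le_mul (hC x) (hM _ (by omega) x hx) (norm_nonneg _)
        ((norm_nonneg _).trans (hC x))
    · filter_upwards [ae_restrict_mem (isClosed_tsupport f).measurableSet] with x hx
      exact ((tendsto_add_atTop_iff_nat J).2 (hw₀.tendsto x (hfΩ hx))).const_mul _
  rw [Metric.tendsto_atTop]
  intro ε hε
  obtain ⟨I, hI⟩ := Approx.uniform_small hΩ hw hw₀ hf hc hfΩ (δ := ε / 4) (by positivity)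
  obtain ⟨I', hI'⟩ := Metric.tendsto_atTop.1 hlim2 (ε / 4) (by positivity)
  set i := max I I'
  obtain ⟨J, hJ⟩ := Metric.tendsto_atTop.1 (hlim1 i) (ε / 4) (by positivity)
  refine ⟨max J i, fun j hj => ?_⟩
  have h1 := hI i j (le_max_left _ _) (le_of_max_le_right hj)
  have h2 := hI' i (le_max_right _ _)
  have h3 := hJ j (le_of_max_le_left hj)
  rw [Real.dist_eq] at h2 h3 ⊢
  have h4 : ∫ x, f x * ((w₀ i x - w₀ j x) * 𝓜.ma (fun t => w t j) x) =
      (∫ x, f x * (w₀ i x * 𝓜.ma (fun t => w t j) x)) -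
        ∫ x, f x * (w₀ j x * 𝓜.ma (fun t => w t j) x) := by
    rw [← integral_sub (hintg i j) (hintg j j)]
    congr 1; funext x; ring
  rw [h4] at h1
  rw [abs_lt] at h2 h3 ⊢
  rw [abs_le] at h1
  constructor <;> linarith [h1.1, h1.2, h2.1, h2.2, h3.1, h3.2]

end MixedForm

/-! ### Diagonal sequences -/

/-- An open subset of `ℝ^ι` is exhausted by compact sets. -/
lemma exists_compact_exhaustion {ι : Type*} [Fintype ι] {Ω : Set (EuclideanSpace ℝ ι)}
    (hΩ : IsOpen Ω) : ∃ K : ℕ → Set (EuclideanSpace ℝ ι), (∀ m, IsCompact (K m)) ∧ Monotone K ∧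
      (∀ m, K m ⊆ Ω) ∧ ∀ x ∈ Ω, ∃ m, K m ∈ 𝓝 x := by
  have : LocallyCompactSpace ↥Ω := hΩ.locallyCompactSpace
  set e := CompactExhaustion.choice ↥Ω
  refine ⟨fun m => Subtype.val '' e m, fun m => (e.isCompact m).image continuous_subtype_val,
    fun m m' h => Set.image_mono (e.subset h), fun m => Subtype.coe_image_subset _ _,
    fun x hx => ?_⟩
  obtain ⟨m, hm⟩ := e.exists_mem_nhds ⟨x, hx⟩
  refine ⟨m, ?_⟩
  have := hΩ.isOpenEmbedding_subtypeVal.isOpenMap.image_mem_nhds hm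
  exact this

namespace MixedForm

variable {ι σ : Type*} [Fintype ι] [DecidableEq ι] [Fintype σ] [DecidableEq σ]

/-- Smooth functions `w i` which on `K` eventually are plurisubharmonic majorants of `v`, and whose
upper limit on `K` is at most `v`. -/
structure Majorant (𝓜 : MixedForm ι σ) (K : Set (EuclideanSpace ℝ ι))
    (v : EuclideanSpace ℝ ι → ℝ) (w : ℕ → EuclideanSpace ℝ ι → ℝ) : Prop where
  contDiff : ∀ i, ContDiff ℝ ∞ (w i)
  psh : ∀ᶠ i in atTop, ∀ y ∈ K, hess (w i) y ∈ 𝓜.cone ∧ v y ≤ w i y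
  lt : ∀ x ∈ K, ∀ c, v x < c → ∀ᶠ p : ℕ × EuclideanSpace ℝ ι in atTop ×ˢ 𝓝 x, w p.1 p.2 < c

variable {𝓜 : MixedForm ι σ} {Ω : Set (EuclideanSpace ℝ ι)}

lemma Approx.majorant {v : EuclideanSpace ℝ ι → ℝ} {w : ℕ → EuclideanSpace ℝ ι → ℝ}
    (hw : 𝓜.Approx Ω v w) {K : Set (EuclideanSpace ℝ ι)} (hK : IsCompact K) (hKΩ : K ⊆ Ω) :
    𝓜.Majorant K v w := by
  refine ⟨hw.contDiff, ?_, fun x hx c hc => hw.eventually_lt (hKΩ hx) hc⟩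
  obtain ⟨J, hJ⟩ := hw.psh_on_compact hK hKΩ
  obtain ⟨J', hJ'⟩ := hw.le_on_compact hK hKΩ
  filter_upwards [eventually_ge_atTop J, eventually_ge_atTop J'] with i h1 h2 y hy
  exact ⟨(hJ i h1 y hy).1, hJ' i h2 y hy⟩

lemma Majorant.mono {v : EuclideanSpace ℝ ι → ℝ} {w : ℕ → EuclideanSpace ℝ ι → ℝ}
    {K K' : Set (EuclideanSpace ℝ ι)} (hw : 𝓜.Majorant K v w) (h : K' ⊆ K) :
    𝓜.Majorant K' v w :=
  ⟨hw.contDiff, hw.psh.mono fun _ hi y hy => hi y (h hy), fun x hx => hw.lt x (h hx)⟩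

lemma Majorant.eventually_lt {v : EuclideanSpace ℝ ι → ℝ} {w : ℕ → EuclideanSpace ℝ ι → ℝ}
    {K : Set (EuclideanSpace ℝ ι)} (hw : 𝓜.Majorant K v w) (hK : IsCompact K)
    {g : EuclideanSpace ℝ ι → ℝ} (hg : Continuous g) (hvg : ∀ y ∈ K, v y < g y) :
    ∀ᶠ i in atTop, ∀ y ∈ K, w i y < g y := by
  refine hK.induction_on (p := fun s => ∀ᶠ i in atTop, ∀ y ∈ s, w i y < g y) (by simp) ?_ ?_ ?_
  · exact fun s t hst h => h.mono fun i hi y hy => hi y (hst hy)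
  · intro s t hs ht
    filter_upwards [hs, ht] with i h1 h2 y hy
    exact hy.elim (h1 y) (h2 y)
  · intro x hx
    obtain ⟨c, hc1, hc2⟩ := exists_between (hvg x hx)
    obtain ⟨p, hp, q, hq, h⟩ := eventually_prod_iff.1 (hw.lt x hx c hc1)
    refine ⟨{y | q y ∧ c < g y}, mem_nhdsWithin_of_mem_nhds
      (hq.and (hg.continuousAt.eventually_const_lt hc2)), ?_⟩
    filter_upwards [hp] with i hi y hy
    exact (h hi hy.1).trans hy.2

/-- Majorants `w m i` of the members `v m` of a decreasing sequence of functions have a diagonal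
sequence which, after a small correction, decreases to the limit of `v m`. -/
lemma exists_diagonal {τ : Type*} [Finite τ] {K : ℕ → Set (EuclideanSpace ℝ ι)}
    (hK : ∀ m, IsCompact (K m)) (hKm : Monotone K) (hKΩ : ∀ m, K m ⊆ Ω)
    (hKn : ∀ x ∈ Ω, ∃ m, K m ∈ 𝓝 x) {v : τ → ℕ → EuclideanSpace ℝ ι → ℝ}
    {vl : τ → EuclideanSpace ℝ ι → ℝ} (hv : ∀ t m, ∀ x ∈ Ω, v t (m + 1) x ≤ v t m x)
    (hvl : ∀ t, ∀ x ∈ Ω, Tendsto (fun m => v t m x) atTop (𝓝 (vl t x)))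
    (hbd : ∀ t, ∀ x ∈ Ω, ∃ V ∈ 𝓝 x, ∃ C : ℝ, ∀ y ∈ V, -C ≤ vl t y)
    {w : τ → ℕ → ℕ → EuclideanSpace ℝ ι → ℝ} (hw : ∀ t m, 𝓜.Majorant (K m) (v t m) (w t m))
    {Q : ℕ → ℕ → Prop} (hQ : ∀ m, ∀ᶠ i in atTop, Q m i) :
    ∃ i : ℕ → ℕ, (∀ m, Q m (i m)) ∧
      ∀ t, 𝓜.Approx Ω (vl t) (fun m x => w t m (i m) x + (1 / 2) ^ m) := by
  have hvm : ∀ t x, x ∈ Ω → Antitone fun m => v t m x := fun t x hx =>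
    antitone_nat_of_succ_le fun m => hv t m x hx
  set good : ℕ → ℕ → Prop := fun m i => ∀ t, ∀ y ∈ K m,
    hess (w t m i) y ∈ 𝓜.cone ∧ v t m y ≤ w t m i y with hgood
  -- `A` makes consecutive diagonal members decrease once `(1/2)^m` is added, because `(1/2)^m` is
  -- twice `(1/2)^(m+1)`. The premise `good m i'` lets the requirement hold for all large `i`
  -- whatever `i'` is, as the recursive choice needs.
  set A : ℕ → ℕ → ℕ → Prop := fun m i' i => good m i' → ∀ t, ∀ y ∈ K m,
    w t (m + 1) i y < w t m i' y + (1 / 2) ^ (m + 1)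
  -- `B` keeps the diagonal member below the `m`-th majorant of each earlier `v t m'`. For fixed
  -- `m'` these majorants have upper limit at most `v t m'`, which forces the diagonal limit down to
  -- `vl t`.
  set B : ℕ → ℕ → Prop := fun m i => ∀ t, ∀ m' ≤ m, (∀ y ∈ K m', v t m' y ≤ w t m' m y) →
    ∀ y ∈ K m', w t m i y < w t m' m y + (1 / 2) ^ m
  have hA : ∀ m i', ∀ᶠ i in atTop, A m i' i := by
    intro m i'
    by_cases hg : good m i'
    · have : ∀ᶠ i in atTop, ∀ t, ∀ y ∈ K m, w t (m + 1) i y < w t m i' y + (1 / 2) ^ (m + 1) := by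
        rw [eventually_all]
        intro t
        refine ((hw t (m + 1)).mono (hKm m.le_succ)).eventually_lt (hK m)
          (((hw t m).contDiff i').continuous.add continuous_const) fun y hy => ?_
        have := (hg t y hy).2
        have h2 := hv t m y (hKΩ m hy)
        have : (0 : ℝ) < (1 / 2) ^ (m + 1) := by positivity
        linarith
      exact this.mono fun i hi _ => hi
    · exact Eventually.of_forall fun i h => absurd h hg
  have hB : ∀ m, ∀ᶠ i in atTop, B m i := by
    intro m
    simp only [B]
    rw [eventually_all]
    intro t
    have : ∀ m' ∈ Finset.Iic m, ∀ᶠ i in atTop, (∀ y ∈ K m', v t m' y ≤ w t m' m y) →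
        ∀ y ∈ K m', w t m i y < w t m' m y + (1 / 2) ^ m := by
      intro m' hm'
      rw [Finset.mem_Iic] at hm'
      by_cases hg : ∀ y ∈ K m', v t m' y ≤ w t m' m y
      · refine (((hw t m).mono (hKm hm')).eventually_lt (hK m')
          (((hw t m').contDiff m).continuous.add continuous_const) fun y hy => ?_).mono
          fun i hi _ => hi
        have h1 := hg y hy
        have h2 := hvm t y (hKΩ m' hy) hm'
        have : (0 : ℝ) < (1 / 2) ^ m := by positivity
        simp only [Pi.add_apply] at h2 ⊢
        linarith
      · exact Eventually.of_forall fun i h => absurd h hg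
    have h2 := (Finset.eventually_all _).2 this
    filter_upwards [h2] with i hi m' hm'
    exact hi m' (Finset.mem_Iic.2 hm')
  have hG : ∀ m, ∀ᶠ i in atTop, good m i := by
    intro m
    simp only [hgood]
    rw [eventually_all]
    exact fun t => (hw t m).psh
  choose i₀ hi₀ using (((hG 0).and (hB 0)).and (hQ 0)).exists
  choose nx hnx using fun m i' => ((((hG (m + 1)).and (hB (m + 1))).and (hQ (m + 1))).and
    (hA m i')).exists
  set i : ℕ → ℕ := fun m => Nat.rec i₀ nx m with hi
  have his : ∀ m, i (m + 1) = nx m (i m) := fun m => rfl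
  have hD : ∀ m, (good m (i m) ∧ B m (i m)) ∧ Q m (i m) := by
    intro m
    cases m with
    | zero => exact hi₀
    | succ m => rw [his]; exact (hnx m (i m)).1
  have hA' : ∀ m, ∀ t, ∀ y ∈ K m, w t (m + 1) (i (m + 1)) y < w t m (i m) y + (1 / 2) ^ (m + 1) :=
    fun m => by
      rw [his]
      exact (hnx m (i m)).2 (hD m).1.1
  refine ⟨i, fun m => (hD m).2, fun t => ⟨fun m => ((hw t m).contDiff _).add contDiff_const,
    fun x hx => ?_, fun x hx => ?_, hbd t⟩⟩
  · obtain ⟨m₀, hm₀⟩ := hKn x hx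
    refine ⟨K m₀, hm₀, m₀, fun m hm y hy => ⟨?_, ?_⟩⟩
    · rw [hess_add_const ((hw t m).contDiff _)]
      exact ((hD m).1.1 t y (hKm hm hy)).1
    · have := hA' m t y (hKm hm hy)
      have h2 : ((1 : ℝ) / 2) ^ m = (1 / 2) ^ (m + 1) + (1 / 2) ^ (m + 1) := by
        rw [pow_succ]; ring
      rw [h2]
      linarith
  · obtain ⟨m₀, hm₀⟩ := hKn x hx
    have hxm : ∀ m ≥ m₀, x ∈ K m := fun m hm => hKm hm (mem_of_mem_nhds hm₀)
    have hpow : Tendsto (fun m : ℕ => ((1 : ℝ) / 2) ^ m) atTop (𝓝 0) :=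
      tendsto_pow_atTop_nhds_zero_of_lt_one (by norm_num) (by norm_num)
    rw [tendsto_order]
    constructor
    · intro a ha
      filter_upwards [eventually_ge_atTop m₀] with m hm
      have h1 := ((hD m).1.1 t x (hxm m hm)).2
      have h2 := (hvm t x hx).le_of_tendsto (hvl t x hx) m
      have : (0 : ℝ) < (1 / 2) ^ m := by positivity
      linarith
    · intro a ha
      obtain ⟨b, hb1, hb2⟩ := exists_between ha
      obtain ⟨m', hm', hm'₀⟩ := (((hvl t x hx).eventually_lt_const hb1).and
        (eventually_ge_atTop m₀)).exists
      obtain ⟨p, hp, q, hq, h⟩ := eventually_prod_iff.1 ((hw t m').lt x (hxm m' hm'₀) b hm')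
      have h2 : ∀ᶠ m : ℕ in atTop, ((1 : ℝ) / 2) ^ m < (a - b) / 2 :=
        hpow.eventually_lt_const (by linarith)
      filter_upwards [hp, h2, eventually_ge_atTop m', (hw t m').psh] with m h3 h4 h5 h6
      have h7 := (hD m).1.2 t m' h5 (fun y hy => (h6 y hy).2) x (hxm m' hm'₀)
      have h8 : w t m' m x < b := h h3 hq.self_of_nhds
      linarith

lemma ma_add_const {w : σ → EuclideanSpace ℝ ι → ℝ} (hw : ∀ t, ContDiff ℝ ∞ (w t)) (c : ℝ)
    (x : EuclideanSpace ℝ ι) : 𝓜.ma (fun t y => w t y + c) x = 𝓜.ma w x := by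
  unfold ma
  congr 1
  funext t
  exact hess_add_const (hw t) _

/-- The weak limit of the Monge–Ampère densities does not depend on the approximating
sequences. -/
lemma Approx.tendsto_of_tendsto (hΩ : IsOpen Ω) {v : σ → EuclideanSpace ℝ ι → ℝ}
    {w w' : σ → ℕ → EuclideanSpace ℝ ι → ℝ} (hw : ∀ t, 𝓜.Approx Ω (v t) (w t))
    (hw' : ∀ t, 𝓜.Approx Ω (v t) (w' t)) {f : EuclideanSpace ℝ ι → ℝ} (hf : Continuous f)
    (hc : HasCompactSupport f) (hfΩ : tsupport f ⊆ Ω) {l : ℝ}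
    (hl : Tendsto (fun j => ∫ x, f x * 𝓜.ma (fun t => w t j) x) atTop (𝓝 l)) :
    Tendsto (fun j => ∫ x, f x * 𝓜.ma (fun t => w' t j) x) atTop (𝓝 l) := by
  obtain ⟨K, hK, hKm, hKΩ, hKn⟩ := exists_compact_exhaustion hΩ
  obtain ⟨l', hl'⟩ := cauchySeq_tendsto_of_complete (Approx.cauchySeq hΩ hw' hf hc hfΩ)
  -- Alternating between `w` and `w'` gives, along a diagonal, a single approximating sequence,
  -- whose integrals converge. Its even terms have the limit of `w` and its odd terms that of `w'`;
  -- `Q` sends the inner indices to infinity.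
  obtain ⟨i, hi, hdiag⟩ := exists_diagonal (𝓜 := 𝓜) (v := fun t _ => v t) (vl := v)
    (w := fun t m => if Even m then w t else w' t) hK hKm hKΩ hKn
    (fun _ _ _ _ => le_rfl) (fun _ _ _ => tendsto_const_nhds) (fun t => (hw t).bdd_below)
    (fun t m => by
      split_ifs
      · exact (hw t).majorant (hK m) (hKΩ m)
      · exact (hw' t).majorant (hK m) (hKΩ m)) (Q := fun m i => m ≤ i) fun m => eventually_ge_atTop m
  obtain ⟨l'', hl''⟩ := cauchySeq_tendsto_of_complete (Approx.cauchySeq hΩ hdiag hf hc hfΩ)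
  have hitop : Tendsto i atTop atTop := tendsto_atTop_mono hi tendsto_id
  have heven : Tendsto (fun m : ℕ => 2 * m) atTop atTop :=
    tendsto_atTop_mono (fun m => by simp only [id]; omega) tendsto_id
  have hodd : Tendsto (fun m : ℕ => 2 * m + 1) atTop atTop :=
    tendsto_atTop_mono (fun m => by simp only [id]; omega) tendsto_id
  have h1 : l'' = l := by
    refine tendsto_nhds_unique (hl''.comp heven) ((hl.comp (hitop.comp heven)).congr fun m => ?_)
    have he : Even (2 * m) := even_two_mul m
    simp only [Function.comp, he, if_true]
    congr 1
    funext x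
    rw [ma_add_const fun t => (hw t).contDiff _]
  have h2 : l'' = l' := by
    refine tendsto_nhds_unique (hl''.comp hodd) ((hl'.comp (hitop.comp hodd)).congr fun m => ?_)
    have he : ¬ Even (2 * m + 1) := by simp
    simp only [Function.comp, he, if_false]
    congr 1
    funext x
    rw [ma_add_const fun t => (hw' t).contDiff _]
  rw [← h1, h2]
  exact hl'

end MixedForm

/-! ### Determinants of complexified quaternionic matrices -/

open scoped ComplexOrder

/-- The complex `2 × 2` matrix representing a quaternion. -/
def quatMat (z w : ℂ) : Matrix (Fin 2) (Fin 2) ℂ :=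
  !![z, w; -(starRingEnd ℂ) w, (starRingEnd ℂ) z]

lemma quatMat_mul (z w z' w' : ℂ) : quatMat z w * quatMat z' w' =
    quatMat (z * z' - w * (starRingEnd ℂ) w') (z * w' + w * (starRingEnd ℂ) z') := by
  ext i j
  fin_cases i <;> fin_cases j <;> simp [quatMat, Matrix.mul_apply, Fin.sum_univ_two] <;> ring

lemma quatMat_sub (z w z' w' : ℂ) : quatMat z w - quatMat z' w' = quatMat (z - z') (w - w') := by
  ext i j
  fin_cases i <;> fin_cases j <;> (simp [quatMat]; try ring)

lemma det_quatMat (z w : ℂ) :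
    (quatMat z w).det = ((Complex.normSq z + Complex.normSq w : ℝ) : ℂ) := by
  rw [quatMat, Matrix.det_fin_two_of]
  push_cast
  rw [Complex.normSq_eq_conj_mul_self, Complex.normSq_eq_conj_mul_self]
  ring

lemma exists_quatMat_inv {z w : ℂ} (h : z ≠ 0) :
    ∃ z' w', quatMat z' w' * quatMat z w = 1 := by
  set r : ℂ := ((Complex.normSq z + Complex.normSq w : ℝ) : ℂ)
  have hr : r ≠ 0 := by
    have : 0 < Complex.normSq z := Complex.normSq_pos.2 h
    have := Complex.normSq_nonneg w
    exact Complex.ofReal_ne_zero.2 (by linarith)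
  have hrr : (starRingEnd ℂ) r = r := Complex.conj_ofReal _
  have h1 : r = (starRingEnd ℂ) z * z + (starRingEnd ℂ) w * w := by
    simp only [r]; push_cast
    rw [Complex.normSq_eq_conj_mul_self, Complex.normSq_eq_conj_mul_self]
  refine ⟨r⁻¹ * (starRingEnd ℂ) z, -(r⁻¹ * w), ?_⟩
  rw [quatMat_mul]
  ext i j
  fin_cases i <;> fin_cases j <;> simp [quatMat, hrr]
  · field_simp; rw [h1]; ring
  · ring
  · ring
  · field_simp; rw [h1]; ring

/-- A matrix of quaternions, written as a complex matrix, has a nonnegative determinant. -/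
lemma det_quatMat_nonneg (n : ℕ) : ∀ Z W : Fin n → Fin n → ℂ,
    0 ≤ (Matrix.of fun (p q : Fin n × Fin 2) => quatMat (Z p.1 q.1) (W p.1 q.1) p.2 q.2).det := by
  induction n with
  | zero => intro Z W; simp
  | succ n ih =>
    have key : ∀ Z W : Fin (n + 1) → Fin (n + 1) → ℂ, Z 0 0 ≠ 0 → 0 ≤ (Matrix.of fun
        (p q : Fin (n + 1) × Fin 2) => quatMat (Z p.1 q.1) (W p.1 q.1) p.2 q.2).det := by
      intro Z W h0
      set e : Fin 2 ⊕ (Fin n × Fin 2) ≃ Fin (n + 1) × Fin 2 :=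
        { toFun := Sum.elim (fun a => (0, a)) fun p => (p.1.succ, p.2)
          invFun := fun p => Fin.cases (motive := fun _ => Fin 2 ⊕ (Fin n × Fin 2))
            (Sum.inl p.2) (fun i => Sum.inr (i, p.2)) p.1
          left_inv := by rintro (a | ⟨i, a⟩) <;> simp
          right_inv := by
            rintro ⟨i, a⟩
            induction i using Fin.cases <;> simp } with he
      obtain ⟨z', w', hinv⟩ := exists_quatMat_inv (z := Z 0 0) (w := W 0 0) h0
      let _ : Invertible (quatMat (Z 0 0) (W 0 0)) := ⟨quatMat z' w', hinv, mul_eq_one_comm.mp hinv⟩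
      rw [← Matrix.det_submatrix_equiv_self e]
      have hblock : (Matrix.of fun (p q : Fin (n + 1) × Fin 2) =>
          quatMat (Z p.1 q.1) (W p.1 q.1) p.2 q.2).submatrix e e = Matrix.fromBlocks
            (quatMat (Z 0 0) (W 0 0))
            (Matrix.of fun a (q : Fin n × Fin 2) => quatMat (Z 0 q.1.succ) (W 0 q.1.succ) a q.2)
            (Matrix.of fun (p : Fin n × Fin 2) b => quatMat (Z p.1.succ 0) (W p.1.succ 0) p.2 b)
            (Matrix.of fun (p q : Fin n × Fin 2) =>
              quatMat (Z p.1.succ q.1.succ) (W p.1.succ q.1.succ) p.2 q.2) := by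
        ext (a | p) (b | q) <;> simp [he]
      -- Schur complement: the pivot block has determinant `|z|² + |w|²`, and the complement again
      -- consists of quaternionic blocks, since these are closed under products and differences.
      rw [hblock, Matrix.det_fromBlocks₁₁, det_quatMat]
      refine mul_nonneg (Complex.zero_le_real.2
        (add_nonneg (Complex.normSq_nonneg _) (Complex.normSq_nonneg _))) ?_
      have hinvOf : ⅟(quatMat (Z 0 0) (W 0 0)) = quatMat z' w' := rfl
      have hclosed : ∀ i j : Fin n, ∃ x : ℂ × ℂ, quatMat (Z i.succ j.succ) (W i.succ j.succ) -
          quatMat (Z i.succ 0) (W i.succ 0) * quatMat z' w' * quatMat (Z 0 j.succ) (W 0 j.succ) =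
          quatMat x.1 x.2 := by
        intro i j
        rw [quatMat_mul, quatMat_mul, quatMat_sub]
        exact ⟨(_, _), rfl⟩
      choose x hx using hclosed
      convert ih (fun i j => (x i j).1) (fun i j => (x i j).2) using 2
      ext p q
      have := congrFun (congrFun (hx p.1 q.1) p.2) q.2
      simp only [Matrix.of_apply]
      rw [← this, hinvOf]
      simp [Matrix.mul_apply]
    intro Z W
    by_cases h0 : Z 0 0 = 0
    -- A vanishing pivot is avoided by adding `ε` to all entries of `Z` and letting `ε → 0`.
    · set D : ℝ → ℂ := fun ε => (Matrix.of fun (p q : Fin (n + 1) × Fin 2) =>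
        quatMat (Z p.1 q.1 + ε) (W p.1 q.1) p.2 q.2).det
      have hD : Continuous D := by
        refine Continuous.matrix_det (continuous_matrix fun p q => ?_)
        simp only [Matrix.of_apply, quatMat]
        obtain ⟨i, a⟩ := p
        obtain ⟨j, b⟩ := q
        fin_cases a <;> fin_cases b <;> simp <;> fun_prop
      have h1 : Tendsto D (𝓝[≠] 0) (𝓝 (D 0)) := hD.continuousAt.mono_left nhdsWithin_le_nhds
      have h2 : ∀ᶠ ε in 𝓝[≠] (0 : ℝ), 0 ≤ D ε := by
        filter_upwards [self_mem_nhdsWithin] with ε hε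
        exact key (fun i j => Z i j + ε) W (by simpa [h0] using hε)
      have h3 := ge_of_tendsto h1 h2
      simpa [D] using h3
    · exact key Z W h0

/-! ### Exterior multiplication operators -/

/-- The exterior algebra of `ℂ²ⁿ`, an element being given by its coefficients. -/
abbrev ExtAlg (n : ℕ) : Type := Finset (Fin (2 * n)) → ℂ

/-- The exterior multiplication by `ω^j`. -/
def wedgeOp {n : ℕ} (j : Fin (2 * n)) : Module.End ℂ (ExtAlg n) where
  toFun F J := if j ∈ J then (-1 : ℂ) ^ (J.filter (· < j)).card * F (J.erase j) else 0
  map_add' F G := by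
    funext J
    simp only [Pi.add_apply]
    split_ifs <;> ring
  map_smul' c F := by
    funext J
    simp only [Pi.smul_apply, smul_eq_mul, RingHom.id_apply]
    split_ifs <;> ring

lemma wedgeOp_apply {n : ℕ} (j : Fin (2 * n)) (F : ExtAlg n) (J : Finset (Fin (2 * n))) :
    wedgeOp j F J = if j ∈ J then (-1 : ℂ) ^ (J.filter (· < j)).card * F (J.erase j) else 0 := rfl

/-- Erasing the smaller index first lowers by one the number of elements below the larger index;
erasing the larger first does not affect the count for the smaller. This is the only difference
between the two signs. -/
lemma wedgeOp_anti {n : ℕ} (i j : Fin (2 * n)) :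
    wedgeOp i * wedgeOp j = -(wedgeOp j * wedgeOp i) := by
  wlog hij : i ≤ j generalizing i j
  · rw [this j i (le_of_not_ge hij), neg_neg]
  refine LinearMap.ext fun F => funext fun J => ?_
  simp only [Module.End.mul_apply, LinearMap.neg_apply, Pi.neg_apply, wedgeOp_apply,
    Finset.mem_erase]
  rcases hij.eq_or_lt with rfl | hlt
  · simp
  · by_cases hi : i ∈ J
    · by_cases hj : j ∈ J
      · have h1 : (J.erase j).filter (· < i) = J.filter (· < i) := by
          ext a
          simp only [Finset.mem_filter, Finset.mem_erase]
          constructor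
          · rintro ⟨⟨-, h⟩, h'⟩; exact ⟨h, h'⟩
          · rintro ⟨h, h'⟩; exact ⟨⟨(h'.trans hlt).ne, h⟩, h'⟩
        have h2 : (J.filter (· < j)).card = ((J.erase i).filter (· < j)).card + 1 := by
          rw [Finset.filter_erase, Finset.card_erase_add_one]
          exact Finset.mem_filter.2 ⟨hi, hlt⟩
        simp only [hi, hj, hlt.ne, hlt.ne', ne_eq, not_false_eq_true, and_self, if_true, h1, h2,
          Finset.erase_right_comm (a := i) (b := j)]
        ring
      · simp [hj]
    · simp [hi]

/-- The exterior multiplication by a vector of `ℂ²ⁿ`. -/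
def wedgeVec (n : ℕ) : (Fin (2 * n) → ℂ) →ₗ[ℂ] Module.End ℂ (ExtAlg n) where
  toFun a := ∑ j, a j • wedgeOp j
  map_add' a b := by simp [add_smul, Finset.sum_add_distrib]
  map_smul' c a := by simp [mul_smul, Finset.smul_sum]

lemma wedgeVec_apply {n : ℕ} (a : Fin (2 * n) → ℂ) : wedgeVec n a = ∑ j, a j • wedgeOp j := rfl

lemma wedgeVec_anti {n : ℕ} (a b : Fin (2 * n) → ℂ) :
    wedgeVec n a * wedgeVec n b = -(wedgeVec n b * wedgeVec n a) := by
  simp only [wedgeVec_apply, Finset.sum_mul, Finset.mul_sum, smul_mul_smul_comm]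
  rw [Finset.sum_comm, ← Finset.sum_neg_distrib]
  refine Finset.sum_congr rfl fun i _ => ?_
  rw [← Finset.sum_neg_distrib]
  refine Finset.sum_congr rfl fun j _ => ?_
  rw [wedgeOp_anti, smul_neg, mul_comm (a i)]

lemma wedgeVec_sq {n : ℕ} (a : Fin (2 * n) → ℂ) : wedgeVec n a * wedgeVec n a = 0 := by
  have h := eq_neg_iff_add_eq_zero.1 (wedgeVec_anti a a)
  rw [← two_smul ℂ] at h
  exact (smul_eq_zero.1 h).resolve_left two_ne_zero

lemma wedgeVec_single {n : ℕ} (j : Fin (2 * n)) : wedgeVec n (Pi.single j 1) = wedgeOp j := by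
  rw [wedgeVec_apply, Finset.sum_eq_single j] <;> simp +contextual

/-- The basis element `ω^I`. -/
def omega {n : ℕ} (I : Finset (Fin (2 * n))) : ExtAlg n := Pi.single I 1

lemma wedgeOp_omega {n : ℕ} {j : Fin (2 * n)} {I : Finset (Fin (2 * n))} (h : ∀ i ∈ I, j < i) :
    wedgeOp j (omega I) = omega (insert j I) := by
  funext J
  rw [wedgeOp_apply, omega, omega]
  have hj : j ∉ I := fun hj => lt_irrefl _ (h j hj)
  by_cases hJ : J = insert j I
  · subst hJ
    have : (insert j I).filter (· < j) = ∅ := by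
      refine Finset.filter_eq_empty_iff.2 fun i hi => ?_
      rcases Finset.mem_insert.1 hi with rfl | hi
      · exact lt_irrefl _
      · exact (h i hi).not_gt
    simp [this, Finset.erase_insert hj]
  · rw [Pi.single_eq_of_ne hJ]
    split_ifs with hmem
    · rw [Pi.single_eq_of_ne, mul_zero]
      rintro rfl
      exact hJ (Finset.insert_erase hmem).symm
    · rfl

/-- The coefficient of `ω⁰ ∧ ⋯ ∧ ω²ⁿ⁻¹` in the product of the elements of a list of operators
applied to `1`. -/
def topCoeff (n : ℕ) : Module.End ℂ (ExtAlg n) →ₗ[ℂ] ℂ where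
  toFun T := T (omega ∅) Finset.univ
  map_add' _ _ := rfl
  map_smul' _ _ := rfl

lemma topCoeff_apply {n : ℕ} (T : Module.End ℂ (ExtAlg n)) :
    topCoeff n T = T (omega ∅) Finset.univ := rfl

/-- The product runs over the last `m` basis vectors: the leftmost factor acts last, so each newly
applied index is smaller than all those present and no sign appears. -/
lemma prod_wedgeOp_omega (n : ℕ) (m : ℕ) (hm : m ≤ 2 * n) :
    (List.ofFn fun k : Fin m => wedgeOp (n := n) ⟨2 * n - m + k, by omega⟩).prod (omega ∅) =
      omega (Finset.univ.filter fun j : Fin (2 * n) => 2 * n - m ≤ j) := by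
  induction m with
  | zero =>
    have : (Finset.univ.filter fun j : Fin (2 * n) => 2 * n - 0 ≤ j) = ∅ :=
      Finset.filter_eq_empty_iff.2 fun j _ => by have := j.2; omega
    rw [this]; simp
  | succ m ih =>
    rw [List.ofFn_succ, List.prod_cons, Module.End.mul_apply]
    have h1 : (fun i : Fin m => wedgeOp (n := n) ⟨2 * n - (m + 1) + (i.succ : Fin (m + 1)),
        by simp; omega⟩) = fun k : Fin m => wedgeOp (n := n) ⟨2 * n - m + k, by omega⟩ := by
      funext i
      congr 2
      simp; omega
    rw [h1, ih (by omega), wedgeOp_omega]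
    · congr 1
      ext j
      simp only [Finset.mem_insert, Finset.mem_filter, Finset.mem_univ, true_and, Fin.ext_iff]
      simp; omega
    · intro i hi
      simp only [Finset.mem_filter, Finset.mem_univ, true_and] at hi
      rw [Fin.lt_def]; simp; omega

/-- Because each multiplication squares to zero, the product factors through the exterior algebra.
The left side is thus an alternating form in `2n` vectors of a `2n`-dimensional space, determined by
its value on the standard basis, which is `1`. -/
lemma topCoeff_prod_wedgeVec {n : ℕ} (a : Fin (2 * n) → Fin (2 * n) → ℂ) :
    topCoeff n (List.ofFn fun k => wedgeVec n (a k)).prod = (Matrix.of a).det := by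
  set L := ExteriorAlgebra.lift ℂ ⟨wedgeVec n, wedgeVec_sq⟩
  set f : (Fin (2 * n) → ℂ) [⋀^Fin (2 * n)]→ₗ[ℂ] ℂ :=
    ((topCoeff n).comp L.toLinearMap).compAlternatingMap (ExteriorAlgebra.ιMulti ℂ (2 * n)) with hf
  have hfa : ∀ a, f a = topCoeff n (List.ofFn fun k => wedgeVec n (a k)).prod := by
    intro a
    simp only [hf, LinearMap.compAlternatingMap_apply, LinearMap.comp_apply,
      ExteriorAlgebra.ιMulti_apply, AlgHom.toLinearMap_apply, map_list_prod, List.map_ofFn]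
    congr 3
    funext k
    simp [L]
  have h1 : f (Pi.basisFun ℂ (Fin (2 * n))) = 1 := by
    rw [hfa]
    have := prod_wedgeOp_omega n (2 * n) le_rfl
    simp only [Nat.sub_self, zero_add, Nat.zero_le, Finset.filter_true] at this
    rw [topCoeff_apply]
    simp only [Pi.basisFun_apply, wedgeVec_single]
    rw [this]
    simp [omega]
  rw [← hfa, f.eq_smul_basis_det (Pi.basisFun ℂ (Fin (2 * n))), h1]
  simp only [one_smul, Pi.basisFun_det]
  rfl

/-- Splitting the indices `0, …, 2n-1` into pairs. -/
def pairEquiv (n : ℕ) : Fin n × Fin 2 ≃ Fin (2 * n) where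
  toFun p := ⟨2 * p.1 + p.2, by omega⟩
  invFun j := (⟨j / 2, by omega⟩, ⟨j % 2, by omega⟩)
  left_inv p := by ext <;> simp <;> omega
  right_inv j := by ext; simp; omega

lemma topCoeff_prod_pairs {n : ℕ} (x y : Fin n → Fin (2 * n) → ℂ) :
    topCoeff n (List.ofFn fun i => wedgeVec n (x i) * wedgeVec n (y i)).prod =
      (Matrix.of fun (p q : Fin n × Fin 2) => ![x p.1, y p.1] p.2 (pairEquiv n q)).det := by
  set a : Fin (2 * n) → Fin (2 * n) → ℂ := fun k =>
    ![x ((pairEquiv n).symm k).1, y ((pairEquiv n).symm k).1] ((pairEquiv n).symm k).2 with ha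
  have h1 : (List.ofFn fun i => wedgeVec n (x i) * wedgeVec n (y i)).prod =
      (List.ofFn fun k => wedgeVec n (a k)).prod := by
    rw [List.ofFn_mul', List.prod_flatten, List.map_ofFn]
    congr 2
    funext i
    have h0 : a (pairEquiv n (i, 0)) = x i := by simp [ha]
    have h1 : a (pairEquiv n (i, 1)) = y i := by simp [ha]
    rw [← h0, ← h1]
    simp [List.ofFn_succ, pairEquiv]
  rw [h1, topCoeff_prod_wedgeVec, ← Matrix.det_submatrix_equiv_self (pairEquiv n)]
  congr 1
  ext p q
  simp [ha]

/-! ### The quaternionic mixed discriminant -/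

open scoped ComplexOrder

/-- The coefficients of the operators `∇_{jα}`, `j = 2l + b`, in the real derivatives
`∂_{x_{4l+m}}`. -/
def nablaCoeff (α : Fin 2) (m : Fin 4) (b : Fin 2) : ℂ :=
  ![![![1, 0], ![Complex.I, 0], ![0, 1], ![0, -Complex.I]],
    ![![0, 1], ![0, -Complex.I], ![-1, 0], ![-Complex.I, 0]]] α m b

/-- The vector `(∇_{jα} x_p)_j` of `ℂ²ⁿ`. -/
def nablaVec {n : ℕ} (α : Fin 2) (p : Fin n × Fin 4) : Fin (2 * n) → ℂ := fun j =>
  if ((pairEquiv n).symm j).1 = p.1 then nablaCoeff α p.2 ((pairEquiv n).symm j).2 else 0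

/-- The vector `∇_{jα}` of a real linear form. -/
def nablaLin {n : ℕ} (α : Fin 2) (c : Fin n × Fin 4 → ℝ) : Fin (2 * n) → ℂ :=
  ∑ p, (c p : ℂ) • nablaVec α p

lemma nablaLin_apply {n : ℕ} (α : Fin 2) (c : Fin n × Fin 4 → ℝ) (l : Fin n) (b : Fin 2) :
    nablaLin α c (pairEquiv n (l, b)) = ∑ m, (c (l, m) : ℂ) * nablaCoeff α m b := by
  simp only [nablaLin, Finset.sum_apply, Pi.smul_apply, nablaVec, Equiv.symm_apply_apply,
    smul_eq_mul, mul_ite, mul_zero, Fintype.sum_prod_type]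
  rw [Finset.sum_eq_single l]
  · simp
  · intro l' _ hl'
    simp [hl'.symm]
  · simp

/-- The exterior multiplication by `△u`, where `u` has Hessian `A`. -/
def bastonOp {n : ℕ} (A : Matrix (Fin n × Fin 4) (Fin n × Fin 4) ℝ) : Module.End ℂ (ExtAlg n) :=
  ∑ p, ∑ q, (A p q : ℂ) • (wedgeVec n (nablaVec 0 p) * wedgeVec n (nablaVec 1 q))

section BastonOp

variable {n : ℕ} {A B : Matrix (Fin n × Fin 4) (Fin n × Fin 4) ℝ}

lemma bastonOp_add : bastonOp (A + B) = bastonOp A + bastonOp B := by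
  simp only [bastonOp, Matrix.add_apply, Complex.ofReal_add, add_smul, Finset.sum_add_distrib]

lemma bastonOp_smul (c : ℝ) : bastonOp (c • A) = (c : ℂ) • bastonOp A := by
  simp only [bastonOp, Matrix.smul_apply, smul_eq_mul, Complex.ofReal_mul, mul_smul,
    Finset.smul_sum]

lemma bastonOp_zero : bastonOp (0 : Matrix (Fin n × Fin 4) (Fin n × Fin 4) ℝ) = 0 := by
  simp [bastonOp]

lemma bastonOp_sum {κ : Type*} (s : Finset κ)
    (C : κ → Matrix (Fin n × Fin 4) (Fin n × Fin 4) ℝ) :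
    bastonOp (∑ r ∈ s, C r) = ∑ r ∈ s, bastonOp (C r) := by
  classical
  induction s using Finset.induction_on with
  | empty => simpa using bastonOp_zero
  | insert r s hr ih => rw [Finset.sum_insert hr, Finset.sum_insert hr, bastonOp_add, ih]

lemma wedgeVec_pair_comm (a b c d : Fin (2 * n) → ℂ) :
    (wedgeVec n a * wedgeVec n b) * (wedgeVec n c * wedgeVec n d) =
      (wedgeVec n c * wedgeVec n d) * (wedgeVec n a * wedgeVec n b) := by
  have h1 : ∀ x y z : Fin (2 * n) → ℂ, wedgeVec n x * wedgeVec n y * wedgeVec n z =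
      wedgeVec n z * (wedgeVec n x * wedgeVec n y) := by
    intro x y z
    have e1 := eq_neg_iff_add_eq_zero.1 (wedgeVec_anti y z)
    have e2 := eq_neg_iff_add_eq_zero.1 (wedgeVec_anti x z)
    have e3 : wedgeVec n x * wedgeVec n y * wedgeVec n z -
        wedgeVec n z * (wedgeVec n x * wedgeVec n y) =
        wedgeVec n x * (wedgeVec n y * wedgeVec n z + wedgeVec n z * wedgeVec n y) -
        (wedgeVec n x * wedgeVec n z + wedgeVec n z * wedgeVec n x) * wedgeVec n y := by
      noncomm_ring
    rw [e1, e2, mul_zero, zero_mul, sub_zero] at e3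
    exact sub_eq_zero.1 e3
  rw [← mul_assoc, h1, mul_assoc, h1, mul_assoc]

lemma bastonOp_comm (A B : Matrix (Fin n × Fin 4) (Fin n × Fin 4) ℝ) :
    Commute (bastonOp A) (bastonOp B) := by
  unfold bastonOp
  refine Commute.sum_left _ _ _ fun p _ => Commute.sum_left _ _ _ fun q _ =>
    Commute.sum_right _ _ _ fun p' _ => Commute.sum_right _ _ _ fun q' _ => ?_
  have h : Commute (wedgeVec n (nablaVec 0 p) * wedgeVec n (nablaVec 1 q))
      (wedgeVec n (nablaVec 0 p') * wedgeVec n (nablaVec 1 q')) := wedgeVec_pair_comm _ _ _ _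
  exact (h.smul_left _).smul_right _

lemma bastonOp_vecMulVec (c : Fin n × Fin 4 → ℝ) : bastonOp (Matrix.vecMulVec c c) =
    wedgeVec n (nablaLin 0 c) * wedgeVec n (nablaLin 1 c) := by
  simp only [nablaLin, map_sum, map_smul, Finset.sum_mul, Finset.mul_sum, smul_mul_smul_comm,
    bastonOp, Matrix.vecMulVec_apply]
  rw [Finset.sum_comm]
  refine Finset.sum_congr rfl fun p _ => Finset.sum_congr rfl fun q _ => ?_
  push_cast
  rfl

lemma exists_sum_vecMulVec (hA : A.PosSemidef) :
    ∃ c : Fin n × Fin 4 → Fin n × Fin 4 → ℝ, A = ∑ r, Matrix.vecMulVec (c r) (c r) := by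
  open scoped MatrixOrder in
  obtain ⟨C, rfl⟩ := CStarAlgebra.nonneg_iff_eq_star_mul_self.mp hA.nonneg
  refine ⟨C, ?_⟩
  ext p q
  simp [Matrix.mul_apply, Matrix.sum_apply, Matrix.vecMulVec_apply, Matrix.star_apply]

/-! ### Right multiplications and the cone of quaternionic plurisubharmonicity -/

/-- The matrices of the right multiplications by `1, i, j, k` in `ℍ`. -/
def rightMulMat (m : Fin 4) : Matrix (Fin 4) (Fin 4) ℝ :=
  ![1, !![0, -1, 0, 0; 1, 0, 0, 0; 0, 0, 0, 1; 0, 0, -1, 0],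
    !![0, 0, -1, 0; 0, 0, 0, -1; 1, 0, 0, 0; 0, 1, 0, 0],
    !![0, 0, 0, -1; 0, 0, 1, 0; 0, -1, 0, 0; 1, 0, 0, 0]] m

/-- The matrices of the right multiplications by `1, i, j, k` in `ℍⁿ`. -/
def rightMul (n : ℕ) (m : Fin 4) : Matrix (Fin n × Fin 4) (Fin n × Fin 4) ℝ :=
  Matrix.of fun p q => if p.1 = q.1 then rightMulMat m p.2 q.2 else 0

/-- Right multiplication by a unit quaternion mixes the pair `∇_{j0}`, `∇_{j1}` by an element of
`SU(2)` with rows `(a, b)` and `(-b̄, ā)`, the same for all `j`. For `1, i, j, k` the pairs `(a, b)`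
are read off from the table. -/
lemma exists_rightMul_nablaCoeff (m : Fin 4) : ∃ a b : ℂ,
    a * (starRingEnd ℂ) a + b * (starRingEnd ℂ) b = 1 ∧ ∀ p c,
      (∑ q, (rightMulMat m p q : ℂ) * nablaCoeff 0 q c =
        a * nablaCoeff 0 p c + b * nablaCoeff 1 p c) ∧
      (∑ q, (rightMulMat m p q : ℂ) * nablaCoeff 1 q c =
        -(starRingEnd ℂ) b * nablaCoeff 0 p c + (starRingEnd ℂ) a * nablaCoeff 1 p c) := by
  have key : ∃ ab : Fin 4 → ℂ × ℂ, ∀ m, (ab m).1 * (starRingEnd ℂ) (ab m).1 +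
      (ab m).2 * (starRingEnd ℂ) (ab m).2 = 1 ∧ ∀ p c,
      (∑ q, (rightMulMat m p q : ℂ) * nablaCoeff 0 q c =
        (ab m).1 * nablaCoeff 0 p c + (ab m).2 * nablaCoeff 1 p c) ∧
      (∑ q, (rightMulMat m p q : ℂ) * nablaCoeff 1 q c =
        -(starRingEnd ℂ) (ab m).2 * nablaCoeff 0 p c +
          (starRingEnd ℂ) (ab m).1 * nablaCoeff 1 p c) := by
    refine ⟨![(1, 0), (-Complex.I, 0), (0, -1), (0, Complex.I)], fun m => ⟨?_, fun p c => ?_⟩⟩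
    · fin_cases m <;> simp
    · fin_cases m <;> fin_cases p <;> fin_cases c <;>
        simp [rightMulMat, nablaCoeff, Fin.sum_univ_four, Matrix.one_apply]
  obtain ⟨ab, h⟩ := key
  exact ⟨_, _, h m⟩

lemma sum_rightMul_nablaVec (m : Fin 4) (α : Fin 2) (p : Fin n × Fin 4) (j : Fin (2 * n)) :
    (∑ q, (rightMul n m p q : ℂ) • nablaVec α q) j =
      if ((pairEquiv n).symm j).1 = p.1 then
        ∑ q, (rightMulMat m p.2 q : ℂ) * nablaCoeff α q ((pairEquiv n).symm j).2 else 0 := by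
  simp only [Finset.sum_apply, Pi.smul_apply, nablaVec, smul_eq_mul, rightMul, Matrix.of_apply,
    Fintype.sum_prod_type]
  rw [Finset.sum_eq_single p.1]
  · simp only [if_true]
    split_ifs <;> simp
  · intro l _ hl
    simp [hl.symm]
  · simp

/-- The pair `∇₀`, `∇₁` enters through its exterior product, which an `SU(2)` change of the pair
multiplies by the determinant `1`. Explicitly, the `00` and `11` terms cancel because the
multiplications anticommute and `A` is symmetric, and the `10` term is minus the `01` term, leaving
the factor `aā + bb̄ = 1`. -/
lemma bastonOp_rightMul (hA : A.IsSymm) (m : Fin 4) :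
    bastonOp ((rightMul n m).transpose * A * rightMul n m) = bastonOp A := by
  obtain ⟨a, b, hab, h⟩ := exists_rightMul_nablaCoeff m
  have h0 : ∀ p : Fin n × Fin 4, ∑ q, (rightMul n m p q : ℂ) • nablaVec 0 q =
      a • nablaVec 0 p + b • nablaVec 1 p := by
    intro p
    funext j
    rw [sum_rightMul_nablaVec, (h _ _).1]
    simp only [Pi.add_apply, Pi.smul_apply, nablaVec, smul_eq_mul]
    split_ifs <;> simp
  have h1 : ∀ p : Fin n × Fin 4, ∑ q, (rightMul n m p q : ℂ) • nablaVec 1 q =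
      (-(starRingEnd ℂ) b) • nablaVec 0 p + (starRingEnd ℂ) a • nablaVec 1 p := by
    intro p
    funext j
    rw [sum_rightMul_nablaVec, (h _ _).2]
    simp only [Pi.add_apply, Pi.smul_apply, nablaVec, smul_eq_mul]
    split_ifs <;> simp
  set N : Fin 2 → Fin n × Fin 4 → Module.End ℂ (ExtAlg n) := fun α p => wedgeVec n (nablaVec α p)
    with hN
  have e1 : bastonOp ((rightMul n m).transpose * A * rightMul n m) =
      ∑ p, ∑ q, (A p q : ℂ) • ((a • N 0 p + b • N 1 p) *
        ((-(starRingEnd ℂ) b) • N 0 q + (starRingEnd ℂ) a • N 1 q)) := by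
    have e2 : ∀ p, a • N 0 p + b • N 1 p = ∑ r, (rightMul n m p r : ℂ) • N 0 r := by
      intro p
      simp only [hN, ← map_smul, ← map_add, ← map_sum, h0]
    have e3 : ∀ p, (-(starRingEnd ℂ) b) • N 0 p + (starRingEnd ℂ) a • N 1 p =
        ∑ r, (rightMul n m p r : ℂ) • N 1 r := by
      intro p
      simp only [hN, ← map_smul, ← map_add, ← map_sum, h1]
    simp only [e2, e3, Finset.sum_mul, Finset.mul_sum, smul_mul_smul_comm, Finset.smul_sum,
      smul_smul, bastonOp, Matrix.mul_apply, Matrix.transpose_apply]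
    push_cast
    simp only [Finset.sum_smul]
    rw [Finset.sum_comm]
    have e4 : ∀ F : Fin n × Fin 4 → Fin n × Fin 4 → Fin n × Fin 4 → Fin n × Fin 4 →
        Module.End ℂ (ExtAlg n), ∑ y, ∑ x, ∑ q, ∑ p, F x y q p = ∑ p, ∑ q, ∑ x, ∑ y, F y x q p := by
      intro F
      calc _ = ∑ y, ∑ x, ∑ p, ∑ q, F x y q p :=
            Finset.sum_congr rfl fun y _ => Finset.sum_congr rfl fun x _ => Finset.sum_comm
        _ = ∑ y, ∑ p, ∑ x, ∑ q, F x y q p :=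
            Finset.sum_congr rfl fun y _ => Finset.sum_comm
        _ = ∑ p, ∑ y, ∑ x, ∑ q, F x y q p := Finset.sum_comm
        _ = ∑ p, ∑ y, ∑ q, ∑ x, F x y q p :=
            Finset.sum_congr rfl fun y _ => Finset.sum_congr rfl fun x _ => Finset.sum_comm
        _ = _ := Finset.sum_congr rfl fun y _ => Finset.sum_comm
    rw [e4]
    refine Finset.sum_congr rfl fun p _ => Finset.sum_congr rfl fun q _ =>
      Finset.sum_congr rfl fun x _ => Finset.sum_congr rfl fun y _ => ?_
    congr 1
    ring
  have hanti : ∀ α, ∑ p, ∑ q, (A p q : ℂ) • (N α p * N α q) = 0 := by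
    intro α
    have : ∑ p, ∑ q, (A p q : ℂ) • (N α p * N α q) =
        -∑ p, ∑ q, (A p q : ℂ) • (N α p * N α q) := by
      conv_lhs => rw [Finset.sum_comm]
      rw [← Finset.sum_neg_distrib]
      refine Finset.sum_congr rfl fun p _ => ?_
      rw [← Finset.sum_neg_distrib]
      refine Finset.sum_congr rfl fun q _ => ?_
      rw [hA.apply, hN, wedgeVec_anti, smul_neg]
    have h := eq_neg_iff_add_eq_zero.1 this
    rw [← two_smul ℂ] at h
    exact (smul_eq_zero.1 h).resolve_left two_ne_zero
  have hswap : ∑ p, ∑ q, (A p q : ℂ) • (N 1 p * N 0 q) = -bastonOp A := by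
    rw [Finset.sum_comm, bastonOp, ← Finset.sum_neg_distrib]
    refine Finset.sum_congr rfl fun p _ => ?_
    rw [← Finset.sum_neg_distrib]
    refine Finset.sum_congr rfl fun q _ => ?_
    rw [hA.apply, hN, wedgeVec_anti, smul_neg]
  have e5 : ∀ p q, (A p q : ℂ) • ((a • N 0 p + b • N 1 p) *
        ((-(starRingEnd ℂ) b) • N 0 q + (starRingEnd ℂ) a • N 1 q)) =
      (-(a * (starRingEnd ℂ) b)) • ((A p q : ℂ) • (N 0 p * N 0 q)) +
      (a * (starRingEnd ℂ) a) • ((A p q : ℂ) • (N 0 p * N 1 q)) +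
      (-(b * (starRingEnd ℂ) b)) • ((A p q : ℂ) • (N 1 p * N 0 q)) +
      (b * (starRingEnd ℂ) a) • ((A p q : ℂ) • (N 1 p * N 1 q)) := by
    intro p q
    simp only [add_mul, mul_add, smul_mul_smul_comm, smul_add, smul_smul]
    module
  rw [e1]
  simp only [e5, Finset.sum_add_distrib, ← Finset.smul_sum, hanti, hswap]
  rw [smul_zero, smul_zero, zero_add, add_zero, smul_neg, neg_smul, neg_neg]
  change (a * (starRingEnd ℂ) a) • bastonOp A + _ = _
  rw [← add_smul, hab, one_smul]

/-- The sum of the conjugates of `A` by the right multiplications. -/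
def quatSum (A : Matrix (Fin n × Fin 4) (Fin n × Fin 4) ℝ) :
    Matrix (Fin n × Fin 4) (Fin n × Fin 4) ℝ :=
  ∑ m, (rightMul n m).transpose * A * rightMul n m

lemma bastonOp_quatSum (hA : A.IsSymm) : bastonOp ((1 / 4 : ℝ) • quatSum A) = bastonOp A := by
  rw [bastonOp_smul, quatSum, bastonOp_sum]
  simp only [bastonOp_rightMul hA, Finset.sum_const, Finset.card_univ, Fintype.card_fin]
  rw [← Nat.cast_smul_eq_nsmul ℂ, smul_smul]
  norm_num

/-- The symmetric matrices which are positive semidefinite on right quaternionic lines. -/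
def quatCone (n : ℕ) : Set (Matrix (Fin n × Fin 4) (Fin n × Fin 4) ℝ) :=
  {A | A.IsSymm ∧ (quatSum A).PosSemidef}

lemma quatSum_add : quatSum (A + B) = quatSum A + quatSum B := by
  simp [quatSum, Matrix.mul_add, Matrix.add_mul, Finset.sum_add_distrib]

lemma quatSum_smul (c : ℝ) : quatSum (c • A) = c • quatSum A := by
  simp [quatSum, Finset.smul_sum]

lemma isSymm_of_posSemidef (hA : A.PosSemidef) : A.IsSymm := by
  have := hA.isHermitian
  rwa [Matrix.IsHermitian, Matrix.conjTranspose_eq_transpose_of_trivial] at this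

lemma posSemidef_mem_quatCone (hA : A.PosSemidef) : A ∈ quatCone n := by
  refine ⟨isSymm_of_posSemidef hA, Matrix.posSemidef_sum _ fun m _ => ?_⟩
  have := hA.conjTranspose_mul_mul_same (rightMul n m)
  rwa [Matrix.conjTranspose_eq_transpose_of_trivial] at this

/-- The quaternionic mixed discriminant as a complex number. -/
def quatDisc (A : Fin n → Matrix (Fin n × Fin 4) (Fin n × Fin 4) ℝ) : ℂ :=
  topCoeff n (List.ofFn fun i => bastonOp (A i)).prod

lemma topCoeff_prod_sum {κ : Type*} [Fintype κ] (T : Fin n → κ → Module.End ℂ (ExtAlg n)) :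
    topCoeff n (List.ofFn fun i => ∑ r, T i r).prod =
      ∑ r : Fin n → κ, topCoeff n (List.ofFn fun i => T i (r i)).prod := by
  have := ((topCoeff n).compMultilinearMap
    (MultilinearMap.mkPiAlgebraFin ℂ n (Module.End ℂ (ExtAlg n)))).map_sum T
  simpa using this

lemma topCoeff_prod_smul (c : Fin n → ℂ) (T : Fin n → Module.End ℂ (ExtAlg n)) :
    topCoeff n (List.ofFn fun i => c i • T i).prod =
      (∏ i, c i) * topCoeff n (List.ofFn T).prod := by
  have := ((topCoeff n).compMultilinearMap
    (MultilinearMap.mkPiAlgebraFin ℂ n (Module.End ℂ (ExtAlg n)))).map_smul_univ c T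
  simpa using this

/-- By `topCoeff_prod_pairs` this is a determinant. Its two rows for index `i` form, for each `l`, a
`2 × 2` block with rows `(z, w)` and `(-w̄, z̄)`, so the matrix is quaternionic. -/
lemma topCoeff_quat_nonneg (c : Fin n → Fin n × Fin 4 → ℝ) :
    0 ≤ topCoeff n (List.ofFn fun i =>
      wedgeVec n (nablaLin 0 (c i)) * wedgeVec n (nablaLin 1 (c i))).prod := by
  rw [topCoeff_prod_pairs]
  convert det_quatMat_nonneg n (fun i l => (c i (l, 0) : ℂ) + c i (l, 1) * Complex.I)
    (fun i l => (c i (l, 2) : ℂ) - c i (l, 3) * Complex.I) using 2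
  ext ⟨i, a⟩ ⟨l, b⟩
  fin_cases a <;> fin_cases b <;>
    simp [nablaLin_apply, quatMat, nablaCoeff, Fin.sum_univ_four] <;> ring

/-- Averaging over the right multiplications does not change `bastonOp`, and for a matrix in the
cone the average is positive semidefinite, hence a sum of rank-one matrices. In the multilinear
expansion every term is the determinant of a quaternionic matrix. -/
lemma quatDisc_nonneg {A : Fin n → Matrix (Fin n × Fin 4) (Fin n × Fin 4) ℝ}
    (hA : ∀ i, A i ∈ quatCone n) : 0 ≤ quatDisc A := by
  choose c hc using fun i => exists_sum_vecMulVec ((hA i).2.smul (a := (1 / 4 : ℝ)) (by norm_num))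
  have h1 : ∀ i, bastonOp (A i) =
      ∑ r, wedgeVec n (nablaLin 0 (c i r)) * wedgeVec n (nablaLin 1 (c i r)) := by
    intro i
    rw [← bastonOp_quatSum (hA i).1, hc i, bastonOp_sum]
    simp only [bastonOp_vecMulVec]
  unfold quatDisc
  simp only [h1]
  rw [topCoeff_prod_sum]
  exact Finset.sum_nonneg fun r _ => topCoeff_quat_nonneg _

lemma quatDisc_eq_sum (A : Fin n → Matrix (Fin n × Fin 4) (Fin n × Fin 4) ℝ) :
    quatDisc A = ∑ P : Fin n → Fin n × Fin 4, ∑ Q : Fin n → Fin n × Fin 4,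
      (∏ i, (A i (P i) (Q i) : ℂ)) * topCoeff n (List.ofFn fun i =>
        wedgeVec n (nablaVec 0 (P i)) * wedgeVec n (nablaVec 1 (Q i))).prod := by
  have h1 : ∀ i, bastonOp (A i) = ∑ r : (Fin n × Fin 4) × (Fin n × Fin 4), (A i r.1 r.2 : ℂ) •
      (wedgeVec n (nablaVec 0 r.1) * wedgeVec n (nablaVec 1 r.2)) := fun i => by
    rw [Fintype.sum_prod_type, bastonOp]
  unfold quatDisc
  simp only [h1]
  rw [topCoeff_prod_sum]
  simp only [topCoeff_prod_smul]
  rw [← Fintype.sum_prod_type' (f := fun (P Q : Fin n → Fin n × Fin 4) =>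
    (∏ i, (A i (P i) (Q i) : ℂ)) * topCoeff n
    (List.ofFn fun i => wedgeVec n (nablaVec 0 (P i)) * wedgeVec n (nablaVec 1 (Q i))).prod)]
  exact Fintype.sum_equiv (Equiv.arrowProdEquivProdArrow (Fin n) (fun _ => Fin n × Fin 4)
    (fun _ => Fin n × Fin 4)) _ _ fun r => rfl

/-- In the determinant of `topCoeff_prod_pairs` the exchange of two first factors is an exchange of
two rows. -/
lemma topCoeff_pairs_swap_left (x y : Fin n → Fin (2 * n) → ℂ) {i j : Fin n} (hij : i ≠ j) :
    topCoeff n (List.ofFn fun r => wedgeVec n (x (Equiv.swap i j r)) * wedgeVec n (y r)).prod =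
      -topCoeff n (List.ofFn fun r => wedgeVec n (x r) * wedgeVec n (y r)).prod := by
  rw [topCoeff_prod_pairs, topCoeff_prod_pairs]
  have h := Matrix.det_permute (Equiv.swap (i, (0 : Fin 2)) (j, 0))
    (Matrix.of fun (p q : Fin n × Fin 2) => ![x p.1, y p.1] p.2 (pairEquiv n q))
  rw [Equiv.Perm.sign_swap (by simpa using hij)] at h
  simp only [Units.val_neg, Units.val_one, Int.cast_neg, Int.cast_one, neg_mul, one_mul] at h
  rw [← h]
  congr 1
  ext ⟨r, a⟩ q
  fin_cases a
  · simp only [Matrix.of_apply, Matrix.submatrix_apply, Equiv.swap_apply_def, Prod.mk.injEq]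
    split_ifs <;> simp_all
  · simp [Equiv.swap_apply_def]

lemma topCoeff_pairs_swap_right (x y : Fin n → Fin (2 * n) → ℂ) {i j : Fin n} (hij : i ≠ j) :
    topCoeff n (List.ofFn fun r => wedgeVec n (x r) * wedgeVec n (y (Equiv.swap i j r))).prod =
      -topCoeff n (List.ofFn fun r => wedgeVec n (x r) * wedgeVec n (y r)).prod := by
  rw [topCoeff_prod_pairs, topCoeff_prod_pairs]
  have h := Matrix.det_permute (Equiv.swap (i, (1 : Fin 2)) (j, 1))
    (Matrix.of fun (p q : Fin n × Fin 2) => ![x p.1, y p.1] p.2 (pairEquiv n q))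
  rw [Equiv.Perm.sign_swap (by simpa using hij)] at h
  simp only [Units.val_neg, Units.val_one, Int.cast_neg, Int.cast_one, neg_mul, one_mul] at h
  rw [← h]
  congr 1
  ext ⟨r, a⟩ q
  fin_cases a
  · simp [Equiv.swap_apply_def]
  · simp only [Matrix.of_apply, Matrix.submatrix_apply, Equiv.swap_apply_def, Prod.mk.injEq]
    split_ifs <;> simp_all

end BastonOp

lemma re_quatDisc {n : ℕ} (A : Fin n → Matrix (Fin n × Fin 4) (Fin n × Fin 4) ℝ) :
    (quatDisc A).re = ∑ P : Fin n → Fin n × Fin 4, ∑ Q : Fin n → Fin n × Fin 4,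
      (topCoeff n (List.ofFn fun i =>
        wedgeVec n (nablaVec 0 (P i)) * wedgeVec n (nablaVec 1 (Q i))).prod).re *
        ∏ i, A i (P i) (Q i) := by
  rw [quatDisc_eq_sum, Complex.re_sum]
  refine Finset.sum_congr rfl fun P _ => ?_
  rw [Complex.re_sum]
  refine Finset.sum_congr rfl fun Q _ => ?_
  rw [← Complex.ofReal_prod, Complex.re_ofReal_mul, mul_comm]

/-- The quaternionic mixed discriminant. -/
def quatForm (n : ℕ) : MixedForm (Fin n × Fin 4) (Fin n) where
  -- `MixedForm` is real, so the real part is taken; on symmetric matrices nothing is lost, by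
  -- `quatDisc_im`.
  ker P Q := (topCoeff n (List.ofFn fun i =>
    wedgeVec n (nablaVec 0 (P i)) * wedgeVec n (nablaVec 1 (Q i))).prod).re
  swap_left P Q i j hij := by
    have := topCoeff_pairs_swap_left (fun r => nablaVec 0 (P r)) (fun r => nablaVec 1 (Q r)) hij
    simp only [Function.comp]
    rw [this, Complex.neg_re]
  swap_right P Q i j hij := by
    have := topCoeff_pairs_swap_right (fun r => nablaVec 0 (P r)) (fun r => nablaVec 1 (Q r)) hij
    simp only [Function.comp]
    rw [this, Complex.neg_re]
  cone := quatCone n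
  psd_mem _ := posSemidef_mem_quatCone
  add_mem A B hA hB := ⟨hA.1.add hB.1, by rw [quatSum_add]; exact hA.2.add hB.2⟩
  smul_mem c A hc hA := ⟨hA.1.smul c, by rw [quatSum_smul]; exact hA.2.smul hc⟩
  nonneg A hA := by
    rw [← re_quatDisc]
    exact (Complex.le_def.1 (quatDisc_nonneg hA)).1

lemma disc_quatForm {n : ℕ} (A : Fin n → Matrix (Fin n × Fin 4) (Fin n × Fin 4) ℝ) :
    (quatForm n).disc A = (quatDisc A).re := by
  rw [MixedForm.disc_apply, re_quatDisc]
  rfl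

/-! ### Reality of the discriminant, and products of positive forms -/

section BastonList

variable {n : ℕ}

lemma quatDisc_update_sub (A : Fin n → Matrix (Fin n × Fin 4) (Fin n × Fin 4) ℝ) (i : Fin n)
    (X Y : Matrix (Fin n × Fin 4) (Fin n × Fin 4) ℝ) :
    quatDisc (Function.update A i (X - Y)) =
      quatDisc (Function.update A i X) - quatDisc (Function.update A i Y) := by
  have h := ((topCoeff n).compMultilinearMap
    (MultilinearMap.mkPiAlgebraFin ℂ n (Module.End ℂ (ExtAlg n)))).map_update_sub
    (fun r => bastonOp (A r)) i (bastonOp X) (bastonOp Y)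
  have h1 : ∀ Z : Matrix (Fin n × Fin 4) (Fin n × Fin 4) ℝ,
      Function.update (fun r => bastonOp (A r)) i (bastonOp Z) =
        fun r => bastonOp (Function.update A i Z r) := by
    intro Z
    funext r
    by_cases hr : r = i
    · subst hr; simp
    · simp [hr]
  have h2 : bastonOp (X - Y) = bastonOp X - bastonOp Y := by
    rw [eq_sub_iff_add_eq, ← bastonOp_add, sub_add_cancel]
  rw [← h2] at h
  simp only [h1, LinearMap.compMultilinearMap_apply, MultilinearMap.mkPiAlgebraFin_apply] at h
  exact h

lemma exists_posSemidef_sub {A : Matrix (Fin n × Fin 4) (Fin n × Fin 4) ℝ} (hA : A.IsSymm) :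
    ∃ X Y : Matrix (Fin n × Fin 4) (Fin n × Fin 4) ℝ, X.PosSemidef ∧ Y.PosSemidef ∧ A = X - Y := by
  set c : ℝ := ∑ p, ∑ q, |A p q|
  have hc : ∀ p q, |A p q| ≤ c := fun p q =>
    (Finset.single_le_sum (f := fun q => |A p q|) (fun _ _ => abs_nonneg _)
      (Finset.mem_univ q)).trans (Finset.single_le_sum (f := fun p => ∑ q, |A p q|)
        (fun _ _ => Finset.sum_nonneg fun _ _ => abs_nonneg _) (Finset.mem_univ p))
  have hc0 : 0 ≤ c := Finset.sum_nonneg fun _ _ => Finset.sum_nonneg fun _ _ => abs_nonneg _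
  refine ⟨_, _, Matrix.PosSemidef.one.smul (a := Fintype.card (Fin n × Fin 4) * c) (by positivity),
    posSemidef_smul_one_sub hA hc, ?_⟩
  rw [sub_sub_cancel]

/-- Positive semidefinite arguments give a value that is nonnegative in the order of `ℂ`, hence
real. A symmetric matrix is a difference of two such matrices, and the slots are treated one at a
time. -/
lemma quatDisc_im {A : Fin n → Matrix (Fin n × Fin 4) (Fin n × Fin 4) ℝ}
    (hA : ∀ i, (A i).IsSymm) : (quatDisc A).im = 0 := by
  have key : ∀ s : Finset (Fin n), ∀ A : Fin n → Matrix (Fin n × Fin 4) (Fin n × Fin 4) ℝ,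
      (∀ i ∈ s, (A i).IsSymm) → (∀ i ∉ s, (A i).PosSemidef) → (quatDisc A).im = 0 := by
    intro s
    induction s using Finset.induction_on with
    | empty =>
      intro A _ hA
      open scoped ComplexOrder in
      exact (Complex.le_def.1 (quatDisc_nonneg fun i =>
        posSemidef_mem_quatCone (hA i (by simp)))).2.symm
    | insert i s hi ih =>
      intro A h1 h2
      obtain ⟨X, Y, hX, hY, hXY⟩ := exists_posSemidef_sub (h1 i (Finset.mem_insert_self _ _))
      have hu : ∀ Z : Matrix (Fin n × Fin 4) (Fin n × Fin 4) ℝ, Z.PosSemidef →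
          (quatDisc (Function.update A i Z)).im = 0 := by
        intro Z hZ
        refine ih _ (fun r hr => ?_) fun r hr => ?_
        · have : r ≠ i := by rintro rfl; exact hi hr
          rw [Function.update_of_ne this]
          exact h1 r (Finset.mem_insert_of_mem hr)
        · by_cases hri : r = i
          · subst hri; simpa using hZ
          · rw [Function.update_of_ne hri]
            exact h2 r (by simp [hri, hr])
      rw [← Function.update_eq_self i A, hXY, quatDisc_update_sub, Complex.sub_im, hu X hX, hu Y hY,
        sub_zero]
  exact key Finset.univ A (fun i _ => hA i) (by simp)

/-- The family with the members of a list of functions. -/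
def family (n : ℕ) (L : List (HSpace n → ℝ)) : Fin n → HSpace n → ℝ :=
  -- The default value plays no role for lists of length `n`; being smooth, it frees
  -- `contDiff_family` from a condition on the length.
  fun t => L.getD t fun _ => 0

lemma ofFn_family {L : List (HSpace n → ℝ)} (hL : L.length = n) : List.ofFn (family n L) = L := by
  refine List.ext_getElem (by simp [hL]) fun i h1 h2 => ?_
  rw [List.getElem_ofFn]
  exact List.getD_eq_getElem _ _ h2

lemma contDiff_family {L : List (HSpace n → ℝ)} (hL : ∀ w ∈ L, ContDiff ℝ ∞ w) (t : Fin n) :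
    ContDiff ℝ ∞ (family n L t) := by
  unfold family
  by_cases h : (t : ℕ) < L.length
  · rw [List.getD_eq_getElem _ _ h]
    exact hL _ (List.getElem_mem h)
  · rw [List.getD_eq_default _ _ (not_lt.1 h)]
    exact contDiff_const

lemma topCoeff_hess {L : List (HSpace n → ℝ)} (hL : L.length = n)
    (hs : ∀ w ∈ L, ContDiff ℝ ∞ w) (x : HSpace n) :
    topCoeff n (L.map fun w => bastonOp (hess w x)).prod =
      (((quatForm n).ma (family n L) x : ℝ) : ℂ) := by
  conv_lhs => rw [← ofFn_family hL, List.map_ofFn]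
  change quatDisc (fun i => hess (family n L i) x) = _
  rw [MixedForm.ma, disc_quatForm]
  refine Complex.ext rfl ?_
  rw [quatDisc_im fun i => hess_symm (contDiff_family hs i)]
  simp

lemma update_family_cons (hn : 0 < n) (L : List (HSpace n → ℝ)) (f g : HSpace n → ℝ) :
    Function.update (family n (f :: L)) ⟨0, hn⟩ g = family n (g :: L) := by
  funext t
  by_cases ht : t = ⟨0, hn⟩
  · subst ht; simp [family]
  · rw [Function.update_of_ne ht]
    obtain ⟨t, h⟩ := t
    cases t with
    | zero => exact absurd rfl ht
    | succ t => simp [family]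

/-! ### Even-degree forms as combinations of products of positive forms -/

/-- The quaternionic structure of `ℂ²ⁿ`. -/
def quatJ (ξ : Fin (2 * n) → ℂ) : Fin (2 * n) → ℂ := fun j =>
  ![-(starRingEnd ℂ) (ξ (pairEquiv n (((pairEquiv n).symm j).1, 1))),
    (starRingEnd ℂ) (ξ (pairEquiv n (((pairEquiv n).symm j).1, 0)))] ((pairEquiv n).symm j).2

lemma quatJ_add (ξ η : Fin (2 * n) → ℂ) : quatJ (ξ + η) = quatJ ξ + quatJ η := by
  funext j
  obtain ⟨⟨l, b⟩, rfl⟩ := (pairEquiv n).surjective j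
  fin_cases b <;> simp [quatJ, add_comm]

lemma quatJ_smul (c : ℂ) (ξ : Fin (2 * n) → ℂ) :
    quatJ (c • ξ) = (starRingEnd ℂ) c • quatJ ξ := by
  funext j
  obtain ⟨⟨l, b⟩, rfl⟩ := (pairEquiv n).surjective j
  fin_cases b <;> simp [quatJ]

lemma quatJ_quatJ (ξ : Fin (2 * n) → ℂ) : quatJ (quatJ ξ) = -ξ := by
  funext j
  obtain ⟨⟨l, b⟩, rfl⟩ := (pairEquiv n).surjective j
  fin_cases b <;> simp [quatJ]

/-- Two complex coordinates determine the four real ones of each quaternion. Consequently every `ζ ∧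
Jζ` is the Baston form of a rank-one positive semidefinite matrix, by `bastonOp_vecMulVec`. -/
lemma exists_nablaLin (ξ : Fin (2 * n) → ℂ) :
    ∃ c : Fin n × Fin 4 → ℝ, nablaLin 0 c = ξ ∧ nablaLin 1 c = quatJ ξ := by
  refine ⟨fun p => ![(ξ (pairEquiv n (p.1, 0))).re, (ξ (pairEquiv n (p.1, 0))).im,
    (ξ (pairEquiv n (p.1, 1))).re, -(ξ (pairEquiv n (p.1, 1))).im] p.2, ?_, ?_⟩
  all_goals
    funext j
    obtain ⟨⟨l, b⟩, rfl⟩ := (pairEquiv n).surjective j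
    rw [nablaLin_apply]
    fin_cases b <;> apply Complex.ext <;>
      simp [nablaCoeff, Fin.sum_univ_four, quatJ]

/-- The span of the multiplications by positive forms. -/
def positiveSpan (n : ℕ) : Submodule ℂ (Module.End ℂ (ExtAlg n)) :=
  Submodule.span ℂ (bastonOp '' {C | C.PosSemidef})

/-- Polarization: since `J` is antilinear, `ξ ∧ Jη` is a combination of the values of `ζ ↦ ζ ∧ Jζ`
at `ξ + η`, `ξ + iη`, `ξ` and `η`. -/
lemma wedgeVec_quatJ_mem (ξ η : Fin (2 * n) → ℂ) :
    wedgeVec n ξ * wedgeVec n (quatJ η) ∈ positiveSpan n := by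
  have hq : ∀ ζ : Fin (2 * n) → ℂ, wedgeVec n ζ * wedgeVec n (quatJ ζ) ∈ positiveSpan n := by
    intro ζ
    obtain ⟨c, h0, h1⟩ := exists_nablaLin ζ
    rw [← h1, ← h0, ← bastonOp_vecMulVec]
    exact Submodule.subset_span ⟨_, MixedForm.posSemidef_vecMulVec c, rfl⟩
  have h : wedgeVec n ξ * wedgeVec n (quatJ η) = (1 / 2 : ℂ) •
      (wedgeVec n (ξ + η) * wedgeVec n (quatJ (ξ + η)) +
        Complex.I • (wedgeVec n (ξ + Complex.I • η) * wedgeVec n (quatJ (ξ + Complex.I • η))) -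
        (1 + Complex.I) • (wedgeVec n ξ * wedgeVec n (quatJ ξ) +
          wedgeVec n η * wedgeVec n (quatJ η))) := by
    simp only [quatJ_add, quatJ_smul, map_add, map_smul, Complex.conj_I, add_mul, mul_add,
      smul_mul_assoc, mul_smul_comm, smul_add, smul_smul]
    have e1 : Complex.I * (-Complex.I * Complex.I) = Complex.I := by
      rw [neg_mul, Complex.I_mul_I]; simp
    have e2 : Complex.I * -Complex.I = 1 := by rw [mul_neg, Complex.I_mul_I]; simp
    have e3 : Complex.I * Complex.I = -1 := Complex.I_mul_I
    rw [e1, e2, e3]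
    module
  rw [h]
  exact Submodule.smul_mem _ _ (Submodule.sub_mem _ (Submodule.add_mem _ (hq _)
    (Submodule.smul_mem _ _ (hq _))) (Submodule.smul_mem _ _ (Submodule.add_mem _ (hq _) (hq _))))

lemma wedgeOp_mul_mem (a b : Fin (2 * n)) : wedgeOp a * wedgeOp b ∈ positiveSpan n := by
  rw [← wedgeVec_single a, ← wedgeVec_single b]
  -- `J² = -1` makes `J` surjective, so the second factor can be written as `Jη`.
  have h : quatJ ((-1 : ℂ) • quatJ (Pi.single b 1)) = Pi.single b 1 := by
    rw [quatJ_smul, quatJ_quatJ]; simp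
  rw [← h]
  exact wedgeVec_quatJ_mem _ _

/-- The products of `p` positive `2`-forms. -/
def positiveProducts (n p : ℕ) : Set (ExtAlg n) :=
  {F | ∃ C : List (Matrix (Fin n × Fin 4) (Fin n × Fin 4) ℝ), C.length = p ∧
    (∀ A ∈ C, A.PosSemidef) ∧ F = (C.map bastonOp).prod (omega ∅)}

/-- The two smallest indices are split off, so that no sign occurs; multiplication by these two
basis vectors lies in the span of the multiplications by positive `2`-forms. -/
lemma omega_mem_span (p : ℕ) : ∀ I : Finset (Fin (2 * n)), I.card = 2 * p →
    omega I ∈ Submodule.span ℂ (positiveProducts n p) := by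
  induction p with
  | zero =>
    intro I hI
    obtain rfl : I = ∅ := Finset.card_eq_zero.1 (by simpa using hI)
    exact Submodule.subset_span ⟨[], rfl, by simp, by simp⟩
  | succ p ih =>
    intro I hI
    have hne : I.Nonempty := Finset.card_pos.1 (by omega)
    set a := I.min' hne
    have ha : a ∈ I := I.min'_mem hne
    have hc1 : (I.erase a).card = 2 * p + 1 := by rw [Finset.card_erase_of_mem ha, hI]; omega
    have hne' : (I.erase a).Nonempty := Finset.card_pos.1 (by omega)
    set b := (I.erase a).min' hne'
    have hb : b ∈ I.erase a := (I.erase a).min'_mem hne'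
    have hc2 : ((I.erase a).erase b).card = 2 * p := by rw [Finset.card_erase_of_mem hb, hc1]; omega
    have h1 : omega I = (wedgeOp a * wedgeOp b) (omega ((I.erase a).erase b)) := by
      rw [Module.End.mul_apply, wedgeOp_omega, Finset.insert_erase hb, wedgeOp_omega,
        Finset.insert_erase ha]
      · exact fun i hi => Finset.min'_lt_of_mem_erase_min' _ _ hi
      · exact fun i hi => Finset.min'_lt_of_mem_erase_min' _ _ hi
    rw [h1]
    have key : ∀ T ∈ positiveSpan n, ∀ F ∈ Submodule.span ℂ (positiveProducts n p),
        T F ∈ Submodule.span ℂ (positiveProducts n (p + 1)) := by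
      intro T hT
      refine Submodule.span_induction ?_ ?_ ?_ ?_ hT
      · rintro _ ⟨C, hC, rfl⟩ F hF
        refine Submodule.span_induction ?_ ?_ ?_ ?_ hF
        · rintro _ ⟨Cs, hl, hps, rfl⟩
          refine Submodule.subset_span ⟨C :: Cs, by simp [hl], ?_, ?_⟩
          · intro A hA
            rcases List.mem_cons.1 hA with rfl | h
            · exact hC
            · exact hps A h
          · simp
        · simp
        · intro x y _ _ hx hy
          rw [map_add]; exact Submodule.add_mem _ hx hy
        · intro c x _ hx
          rw [map_smul]; exact Submodule.smul_mem _ _ hx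
      · intro F _; simp
      · intro S T _ _ hS hT F hF
        rw [LinearMap.add_apply]; exact Submodule.add_mem _ (hS F hF) (hT F hF)
      · intro c S _ hS F hF
        rw [LinearMap.smul_apply]; exact Submodule.smul_mem _ _ (hS F hF)
    exact key _ (wedgeOp_mul_mem a b) _ (ih _ hc2)

/-- Every form `ω^I` of even degree is a combination of products of positive `2`-forms. -/
lemma exists_omega_eq_sum {p : ℕ} {I : Finset (Fin (2 * n))} (hI : I.card = 2 * p) :
    ∃ (N : ℕ) (c : Fin N → ℂ) (C : Fin N → List (Matrix (Fin n × Fin 4) (Fin n × Fin 4) ℝ)),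
      (∀ s, (C s).length = p ∧ ∀ A ∈ C s, A.PosSemidef) ∧
      omega I = ∑ s, c s • ((C s).map bastonOp).prod (omega ∅) := by
  obtain ⟨N, c, g, h⟩ := Submodule.mem_span_set'.1 (omega_mem_span p I hI)
  choose C hC using fun s => (g s).2
  refine ⟨N, c, C, fun s => ⟨(hC s).1, (hC s).2.1⟩, ?_⟩
  rw [← h]
  exact Finset.sum_congr rfl fun s _ => by rw [(hC s).2.2]

end BastonList

/-! ### Smooth functions with the submean value property -/

section Submean

variable {ι : Type*} [Fintype ι] [DecidableEq ι]

lemma hasDerivAt_line {w : EuclideanSpace ℝ ι → ℝ} (hw : ContDiff ℝ ∞ w)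
    (x z : EuclideanSpace ℝ ι) (t : ℝ) :
    HasDerivAt (fun t : ℝ => w (x + t • z)) (∑ p, z p * pd p w (x + t • z)) t := by
  have h1 : HasDerivAt (fun t : ℝ => x + t • z) z t := by
    simpa using ((hasDerivAt_id t).smul_const z).const_add x
  have h2 := ((hw.differentiable (by simp)) (x + t • z)).hasFDerivAt.comp_hasDerivAt t h1
  have hz : z = ∑ p, z p • (EuclideanSpace.single p 1 : EuclideanSpace ℝ ι) := by
    have := (EuclideanSpace.basisFun ι ℝ).sum_repr z
    simpa using this.symm
  have h3 : fderiv ℝ w (x + t • z) z = fderiv ℝ w (x + t • z)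
      (∑ p, z p • (EuclideanSpace.single p 1 : EuclideanSpace ℝ ι)) := by rw [← hz]
  refine h2.congr_deriv ?_
  rw [h3]
  simp only [map_sum, map_smul, smul_eq_mul, pd]

/-- The second differences of a smooth function are estimated by its Hessian. -/
lemma second_difference_le {w : EuclideanSpace ℝ ι → ℝ} (hw : ContDiff ℝ ∞ w)
    (x : EuclideanSpace ℝ ι) {ε : ℝ} (hε : 0 < ε) : ∃ δ > 0, ∀ z : EuclideanSpace ℝ ι, ‖z‖ < δ →
      w (x + z) + w (x - z) - 2 * w x ≤ ∑ p, ∑ q, z p * z q * hess w x p q + ε * ‖z‖ ^ 2 := by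
  set N : ℝ := (Fintype.card ι : ℝ) with hN
  set η : ℝ := ε / (N ^ 2 + 1)
  have hη : 0 < η := by positivity
  have hev : ∀ᶠ y in 𝓝 x, ∀ p q, |hess w y p q - hess w x p q| < η := by
    rw [eventually_all]; intro p
    rw [eventually_all]; intro q
    have hc : Continuous fun y => hess w y p q := (contDiff_hess hw).continuous
    have := Metric.tendsto_nhds.1 (hc.continuousAt (x := x)) η hη
    simpa [Real.dist_eq] using this
  obtain ⟨δ, hδ, hball⟩ := Metric.eventually_nhds_iff.1 hev
  refine ⟨δ, hδ, fun z hz => ?_⟩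
  have hzp : ∀ p, |z p| ≤ ‖z‖ := fun p => by simpa using PiLp.norm_apply_le z p
  have hclose : ∀ t ∈ Set.Icc (-1 : ℝ) 1, ∑ p, ∑ q, z p * z q * hess w (x + t • z) p q ≤
      ∑ p, ∑ q, z p * z q * hess w x p q + ε * ‖z‖ ^ 2 := by
    intro t ht
    have hd : dist (x + t • z) x < δ := by
      rw [dist_eq_norm, add_sub_cancel_left, norm_smul]
      have : |t| ≤ 1 := abs_le.2 ht
      have := mul_le_mul_of_nonneg_right this (norm_nonneg z)
      rw [Real.norm_eq_abs]
      linarith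
    have h1 := hball hd
    have h2 : ∀ p q, z p * z q * hess w (x + t • z) p q ≤
        z p * z q * hess w x p q + η * ‖z‖ ^ 2 := by
      intro p q
      have h3 : z p * z q * (hess w (x + t • z) p q - hess w x p q) ≤ η * ‖z‖ ^ 2 := by
        refine (le_abs_self _).trans ?_
        rw [abs_mul, abs_mul, mul_comm, sq]
        exact mul_le_mul (h1 p q).le (mul_le_mul (hzp p) (hzp q) (abs_nonneg _) (norm_nonneg _))
          (by positivity) hη.le
      linarith
    calc _ ≤ ∑ p, ∑ q, (z p * z q * hess w x p q + η * ‖z‖ ^ 2) :=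
          Finset.sum_le_sum fun p _ => Finset.sum_le_sum fun q _ => h2 p q
      _ = ∑ p, ∑ q, z p * z q * hess w x p q + N ^ 2 * (η * ‖z‖ ^ 2) := by
          simp only [Finset.sum_add_distrib, Finset.sum_const, Finset.card_univ, nsmul_eq_mul, ← hN]
          ring
      _ ≤ _ := by
          have h4 : N ^ 2 * η ≤ ε := by
            simp only [η]
            rw [mul_div_assoc', div_le_iff₀ (by positivity)]
            nlinarith
          nlinarith [sq_nonneg ‖z‖]
  set S : ℝ := ∑ p, ∑ q, z p * z q * hess w x p q + ε * ‖z‖ ^ 2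
  -- The bound on the Hessian along the segment, which is `hclose`, makes `φ` concave on `[-1, 1]`;
  -- comparing `φ 0` with the mean of `φ 1` and `φ (-1)` gives the claim.
  set φ : ℝ → ℝ := fun t => w (x + t • z) + w (x + (-t) • z) - t ^ 2 * S
  set φ' : ℝ → ℝ := fun t => (∑ p, z p * pd p w (x + t • z)) -
    (∑ p, z p * pd p w (x + (-t) • z)) - 2 * t * S
  set φ'' : ℝ → ℝ := fun t => (∑ p, ∑ q, z p * z q * hess w (x + t • z) p q) +
    (∑ p, ∑ q, z p * z q * hess w (x + (-t) • z) p q) - 2 * S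
  have hneg : ∀ {g : EuclideanSpace ℝ ι → ℝ} (_ : ContDiff ℝ ∞ g) (t : ℝ),
      HasDerivAt (fun t : ℝ => g (x + (-t) • z)) (-∑ p, z p * pd p g (x + (-t) • z)) t := by
    intro g hg t
    exact ((hasDerivAt_line hg x z (-t)).scomp t (hasDerivAt_neg t)).congr_deriv (by simp)
  have hφ : ∀ t, HasDerivAt φ (φ' t) t := by
    intro t
    have := ((hasDerivAt_line hw x z t).add (hneg hw t)).sub
      (((hasDerivAt_pow 2 t)).mul_const S)
    refine this.congr_deriv ?_
    simp only [φ']; push_cast; ring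
  have hφ' : ∀ t, HasDerivAt φ' (φ'' t) t := by
    intro t
    have h1 : HasDerivAt (fun t : ℝ => ∑ p, z p * pd p w (x + t • z))
        (∑ p, z p * ∑ q, z q * pd q (pd p w) (x + t • z)) t :=
      HasDerivAt.fun_sum fun p _ => (hasDerivAt_line (contDiff_pd hw) x z t).const_mul _
    have h2 : HasDerivAt (fun t : ℝ => ∑ p, z p * pd p w (x + (-t) • z))
        (∑ p, z p * -∑ q, z q * pd q (pd p w) (x + (-t) • z)) t :=
      HasDerivAt.fun_sum fun p _ => (hneg (contDiff_pd hw) t).const_mul _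
    have h3 := (h1.sub h2).sub (((hasDerivAt_id t).const_mul 2).mul_const S)
    refine h3.congr_deriv ?_
    simp only [φ'', mul_neg, Finset.sum_neg_distrib, Finset.mul_sum]
    have e : ∀ y, ∑ p, ∑ q, z p * z q * hess w y p q =
        ∑ p, ∑ q, z p * (z q * pd q (pd p w) y) := by
      intro y
      refine Finset.sum_congr rfl fun p _ => Finset.sum_congr rfl fun q _ => ?_
      have : hess w y p q = pd q (pd p w) y := pd_comm hw
      rw [this]; ring
    rw [e, e]
    ring
  have hconc : ConcaveOn ℝ (Set.Icc (-1 : ℝ) 1) φ := by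
    refine concaveOn_of_hasDerivWithinAt2_nonpos (convex_Icc _ _)
      (fun t _ => (hφ t).continuousAt.continuousWithinAt)
      (fun t _ => (hφ t).hasDerivWithinAt) (fun t _ => (hφ' t).hasDerivWithinAt) fun t ht => ?_
    rw [interior_Icc] at ht
    have e1 := hclose t ⟨ht.1.le, ht.2.le⟩
    have e2 := hclose (-t) ⟨by linarith [ht.2], by linarith [ht.1]⟩
    simp only [φ'']
    linarith
  have h := hconc.2 (show (1 : ℝ) ∈ Set.Icc (-1 : ℝ) 1 by norm_num)
    (show (-1 : ℝ) ∈ Set.Icc (-1 : ℝ) 1 by norm_num) (show (0 : ℝ) ≤ 1 / 2 by norm_num)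
    (show (0 : ℝ) ≤ 1 / 2 by norm_num) (by norm_num)
  simp only [smul_eq_mul, φ] at h
  norm_num at h
  have e : x + -z = x - z := by abel
  rw [e] at h
  linarith

end Submean

/-- The second moments of a ball in `ℝ⁴`. -/
lemma exists_moment {r : ℝ} (hr : 0 < r) : ∃ c > 0, ∀ i j : Fin 4,
    ∫ y in Metric.ball (0 : EuclideanSpace ℝ (Fin 4)) r, y i * y j = if i = j then c else 0 := by
  set B := Metric.ball (0 : EuclideanSpace ℝ (Fin 4)) r
  have hintg : ∀ g : EuclideanSpace ℝ (Fin 4) → ℝ, Continuous g → IntegrableOn g B := fun g hg =>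
    (hg.continuousOn.integrableOn_compact (isCompact_closedBall (0 : EuclideanSpace ℝ (Fin 4)) r)).mono_set
      Metric.ball_subset_closedBall
  -- The reflection taking `a` to `b` preserves the ball. Coordinate vectors show that the diagonal
  -- moments agree; `e i + e j` and `√2 • e 0` show that the mixed ones vanish.
  have hinv : ∀ a b : EuclideanSpace ℝ (Fin 4), ‖a‖ = ‖b‖ →
      ∫ y in B, (inner ℝ y a) ^ 2 = ∫ y in B, (inner ℝ y b) ^ 2 := by
    intro a b hab
    set R := (ℝ ∙ (a - b))ᗮ.reflection
    have hR : R a = b := Submodule.reflection_sub hab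
    have hmp := R.measurePreserving
    have hpre : R ⁻¹' B = B := by
      ext y; simp [B]
    symm
    rw [← hmp.setIntegral_preimage_emb R.toHomeomorph.measurableEmbedding, hpre]
    refine integral_congr_ae (Eventually.of_forall fun y => ?_)
    simp only
    rw [← hR, R.inner_map_map]
  set e : Fin 4 → EuclideanSpace ℝ (Fin 4) := fun i => EuclideanSpace.single i 1
  have hin : ∀ (y : EuclideanSpace ℝ (Fin 4)) i, inner ℝ y (e i) = y i := fun y i => by
    simp [e, EuclideanSpace.inner_single_right]
  have hdiag : ∀ i, ∫ y in B, y i * y i = ∫ y in B, y 0 * y 0 := by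
    intro i
    have := hinv (e i) (e 0) (by simp [e])
    simpa only [hin, sq] using this
  have hc : 0 < ∫ y in B, y 0 * y 0 := by
    have hco : Continuous fun y : EuclideanSpace ℝ (Fin 4) => y 0 * y 0 := by fun_prop
    rw [setIntegral_pos_iff_support_of_nonneg_ae (Eventually.of_forall fun y => mul_self_nonneg _)
      (hintg _ hco)]
    have hopen : IsOpen ((Function.support fun y : EuclideanSpace ℝ (Fin 4) => y 0 * y 0) ∩ B) :=
      (hco.isOpen_support).inter Metric.isOpen_ball
    refine hopen.measure_pos _ ⟨EuclideanSpace.single 0 (r / 2), ?_, ?_⟩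
    · simp [hr.ne']
    · simp only [B, mem_ball_zero_iff, PiLp.norm_single, Real.norm_eq_abs]
      rw [abs_of_pos (by positivity)]; linarith
  refine ⟨_, hc, fun i j => ?_⟩
  split_ifs with hij
  · subst hij; exact hdiag i
  · have hnorm : ‖e i + e j‖ = ‖(Real.sqrt 2) • e 0‖ := by
      have h1 : ‖e i + e j‖ ^ 2 = 2 := by
        rw [norm_add_sq_real]
        have : inner ℝ (e i) (e j) = 0 := by
          rw [hin]; simp [e, Ne.symm hij]
        rw [this]; simp [e]; norm_num
      have h2 : ‖(Real.sqrt 2) • e 0‖ ^ 2 = 2 := by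
        rw [norm_smul, mul_pow]; simp [e]
      have h3 : ‖e i + e j‖ ^ 2 = ‖(Real.sqrt 2) • e 0‖ ^ 2 := by rw [h1, h2]
      exact (sq_eq_sq₀ (norm_nonneg _) (norm_nonneg _)).1 h3
    have h := hinv _ _ hnorm
    have e1 : ∀ y : EuclideanSpace ℝ (Fin 4), (inner ℝ y (e i + e j)) ^ 2 = y i * y i + y j * y j + 2 * (y i * y j) := by
      intro y; rw [inner_add_right, hin, hin]; ring
    have e2 : ∀ y : EuclideanSpace ℝ (Fin 4), (inner ℝ y (Real.sqrt 2 • e 0)) ^ 2 = 2 * (y 0 * y 0) := by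
      intro y; rw [inner_smul_right, hin, mul_pow, Real.sq_sqrt (by norm_num)]; ring
    simp only [e1, e2] at h
    rw [integral_add, integral_add, integral_const_mul, integral_const_mul, hdiag i, hdiag j] at h
    · linarith
    · exact hintg _ (by fun_prop)
    · exact hintg _ (by fun_prop)
    · exact (hintg _ (by fun_prop : Continuous fun y : EuclideanSpace ℝ (Fin 4) => y i * y i)).add
        (hintg _ (by fun_prop))
    · exact (hintg _ (by fun_prop : Continuous fun y : EuclideanSpace ℝ (Fin 4) => y i * y j)).const_mul _

/-- The direction `b q` of the right quaternionic line, in terms of the real coordinates `c` of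
`b`. -/
lemma ofQuat_mul_apply {n : ℕ} {b : Fin n → ℍ[ℝ]} {c : Fin n × Fin 4 → ℝ}
    (hb : ∀ l, b l = ⟨c (l, 0), c (l, 1), c (l, 2), c (l, 3)⟩) (y : EuclideanSpace ℝ (Fin 4)) :
    ofQuat (fun l => b l * ⟨y 0, y 1, y 2, y 3⟩) =
      ∑ m, y m • (WithLp.toLp 2 ((rightMul n m).mulVec c) : HSpace n) := by
  have key : ∀ (m : Fin 4) (l : Fin n) (i : Fin 4), (rightMul n m).mulVec c (l, i) =
      ∑ j, rightMulMat m i j * c (l, j) := by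
    intro m l i
    simp only [Matrix.mulVec, dotProduct, rightMul, Matrix.of_apply, Fintype.sum_prod_type]
    rw [Finset.sum_eq_single l]
    · simp
    · intro l' _ hl'
      simp [hl'.symm]
    · simp
  ext ⟨l, i⟩
  have h0 : (b l).re = c (l, 0) := by rw [hb]
  have h1 : (b l).imI = c (l, 1) := by rw [hb]
  have h2 : (b l).imJ = c (l, 2) := by rw [hb]
  have h3 : (b l).imK = c (l, 3) := by rw [hb]
  simp only [ofQuat, Fin.sum_univ_four]
  fin_cases i <;> simp [rightMulMat, key, Fin.sum_univ_four]
  · refine (Quaternion.re_mul (b l) _).trans ?_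
    rw [h0, h1, h2, h3]; ring
  · refine (Quaternion.imI_mul (b l) _).trans ?_
    rw [h0, h1, h2, h3]; ring
  · refine (Quaternion.imJ_mul (b l) _).trans ?_
    rw [h0, h1, h2, h3]; ring
  · refine (Quaternion.imK_mul (b l) _).trans ?_
    rw [h0, h1, h2, h3]; ring

/-- The quadratic form of `quatSum (hess w x)` at `c` is the sum of the second derivatives of `w` in
the directions `b, bi, bj, bk`, that is, the Laplacian along the right line of direction `b`. Were
it negative, the bound on second differences, integrated over a small ball with its isotropic second
moments, would contradict the submean inequality. -/
lemma mem_quatCone_of_submean {n : ℕ} {w : HSpace n → ℝ} (hw : ContDiff ℝ ∞ w) {x : HSpace n}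
    (h : ∀ b : Fin n → ℍ[ℝ], b ≠ 0 → ∃ r₀ > 0, ∀ r, 0 < r → r < r₀ →
      ∫ _y in Metric.ball (0 : EuclideanSpace ℝ (Fin 4)) r, w x ≤
        ∫ y in Metric.ball (0 : EuclideanSpace ℝ (Fin 4)) r, w (rightLine x b y)) :
    hess w x ∈ quatCone n := by
  set A := hess w x with hA
  have hAs : A.IsSymm := hess_symm hw
  refine ⟨hAs, Matrix.PosSemidef.of_dotProduct_mulVec_nonneg ?_ fun c => ?_⟩
  · rw [Matrix.IsHermitian, Matrix.conjTranspose_eq_transpose_of_trivial, quatSum,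
      Matrix.transpose_sum]
    refine Finset.sum_congr rfl fun m _ => ?_
    rw [Matrix.transpose_mul, Matrix.transpose_mul, Matrix.transpose_transpose, hAs.eq,
      Matrix.mul_assoc]
  set v : Fin 4 → HSpace n := fun m => WithLp.toLp 2 ((rightMul n m).mulVec c) with hv
  set D' : Fin 4 → Fin 4 → Fin n × Fin 4 → Fin n × Fin 4 → ℝ := fun m m' p q =>
    v m p * v m' q * A p q
  set D : Fin 4 → Fin 4 → ℝ := fun m m' => ∑ p, ∑ q, D' m m' p q
  have hT : star c ⬝ᵥ (quatSum A).mulVec c = ∑ m, D m m := by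
    simp only [quatSum, Matrix.sum_mulVec, dotProduct_sum, star_trivial]
    refine Finset.sum_congr rfl fun m _ => ?_
    rw [← Matrix.mulVec_mulVec, ← Matrix.mulVec_mulVec, Matrix.dotProduct_mulVec,
      Matrix.vecMul_transpose]
    simp only [D, D', hv]
    generalize (rightMul n m).mulVec c = X
    simp only [dotProduct, Matrix.mulVec, Finset.mul_sum]
    exact Finset.sum_congr rfl fun p _ => Finset.sum_congr rfl fun q _ => by ring
  rw [hT]
  set b : Fin n → ℍ[ℝ] := fun l => ⟨c (l, 0), c (l, 1), c (l, 2), c (l, 3)⟩ with hb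
  by_cases hb0 : b = 0
  · have hc0 : c = 0 := by
      funext ⟨l, i⟩
      have := congrFun hb0 l
      simp only [hb, Pi.zero_apply] at this
      fin_cases i
      · exact congrArg QuaternionAlgebra.re this
      · exact congrArg QuaternionAlgebra.imI this
      · exact congrArg QuaternionAlgebra.imJ this
      · exact congrArg QuaternionAlgebra.imK this
    simp [D, D', hv, hc0]
  obtain ⟨r₀, hr₀, hmean⟩ := h b hb0
  by_contra hneg
  push Not at hneg
  set T := ∑ m, D m m
  set V : ℝ := ∑ m, ‖v m‖
  have hV : 0 ≤ V := Finset.sum_nonneg fun _ _ => norm_nonneg _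
  -- With this choice the total error `4 * ε * V ^ 2` is at most half of `-T`.
  set ε : ℝ := -T / (8 * (V ^ 2 + 1))
  have hε : 0 < ε := div_pos (by linarith) (by positivity)
  obtain ⟨δ, hδ, hsd⟩ := second_difference_le hw x hε
  set ℓ : EuclideanSpace ℝ (Fin 4) → HSpace n := fun y => ∑ m, y m • v m with hℓ
  have hline : ∀ y, rightLine x b y = x + ℓ y := fun y => by
    rw [rightLine, ofQuat_mul_apply fun l => rfl]
  have hℓn : ∀ y, ‖ℓ y‖ ≤ ‖y‖ * V := by
    intro y
    refine (norm_sum_le _ _).trans ?_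
    rw [Finset.mul_sum]
    refine Finset.sum_le_sum fun m _ => ?_
    rw [norm_smul]
    exact mul_le_mul_of_nonneg_right (PiLp.norm_apply_le y m) (norm_nonneg _)
  obtain ⟨r, hr, hrr₀, hrδ⟩ : ∃ r, 0 < r ∧ r < r₀ ∧ r * (V + 1) < δ := by
    refine ⟨min (r₀ / 2) (δ / (2 * (V + 1))), by positivity,
      (min_le_left _ _).trans_lt (by linarith), ?_⟩
    calc _ ≤ δ / (2 * (V + 1)) * (V + 1) :=
          mul_le_mul_of_nonneg_right (min_le_right _ _) (by positivity)
      _ = δ / 2 := by field_simp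
      _ < δ := by linarith
  set B := Metric.ball (0 : EuclideanSpace ℝ (Fin 4)) r
  have hintg : ∀ g : EuclideanSpace ℝ (Fin 4) → ℝ, Continuous g → IntegrableOn g B := fun g hg =>
    (hg.continuousOn.integrableOn_compact
      (isCompact_closedBall (0 : EuclideanSpace ℝ (Fin 4)) r)).mono_set
      Metric.ball_subset_closedBall
  have hℓc : Continuous ℓ := by simp only [hℓ]; fun_prop
  have hwc := hw.continuous
  have hc1 : Continuous fun y => w (x + ℓ y) := by fun_prop
  have hc2 : Continuous fun y => w (x - ℓ y) := by fun_prop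
  have hodd : ∫ y in B, w (x - ℓ y) = ∫ y in B, w (x + ℓ y) := by
    have hmp := (LinearIsometryEquiv.neg ℝ (E := EuclideanSpace ℝ (Fin 4))).measurePreserving
    have hpre : (LinearIsometryEquiv.neg ℝ (E := EuclideanSpace ℝ (Fin 4))) ⁻¹' B = B := by
      ext y; simp [B]
    rw [← hmp.setIntegral_preimage_emb (LinearIsometryEquiv.neg ℝ
      (E := EuclideanSpace ℝ (Fin 4))).toHomeomorph.measurableEmbedding, hpre]
    refine integral_congr_ae (Eventually.of_forall fun y => ?_)
    simp [hℓ, sub_eq_add_neg]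
  have hm := hmean r hr hrr₀
  simp only [hline] at hm
  obtain ⟨κ, hκ, hmom⟩ := exists_moment hr
  have hlow : 0 ≤ ∫ y in B, (w (x + ℓ y) + w (x - ℓ y) - 2 * w x) := by
    rw [integral_sub (f := fun y => w (x + ℓ y) + w (x - ℓ y)) ((hintg _ hc1).add (hintg _ hc2))
      (hintg _ continuous_const), integral_add (hintg _ hc1) (hintg _ hc2), hodd, integral_const_mul]
    linarith
  have hup : ∫ y in B, (w (x + ℓ y) + w (x - ℓ y) - 2 * w x) ≤
      ∫ y in B, (∑ m, ∑ m', D m m' * (y m * y m') + ε * V ^ 2 * ∑ m, y m * y m) := by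
    refine setIntegral_mono_on (((hintg _ hc1).add (hintg _ hc2)).sub (hintg _ continuous_const))
      (hintg _ (by fun_prop)) measurableSet_ball fun y hy => ?_
    have hyr : ‖y‖ < r := by simpa [B] using hy
    have hn : ‖ℓ y‖ < δ := by
      refine (hℓn y).trans_lt (lt_of_le_of_lt ?_ hrδ)
      exact mul_le_mul hyr.le (by linarith) hV hr.le
    refine (hsd _ hn).trans (add_le_add (le_of_eq ?_) ?_)
    · have hexp : ∀ p q, ℓ y p * ℓ y q * A p q =
          ∑ m, ∑ m', D' m m' p q * (y m * y m') := by
        intro p q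
        simp only [hℓ, WithLp.ofLp_sum, WithLp.ofLp_smul, Finset.sum_apply, Pi.smul_apply,
          smul_eq_mul]
        rw [Finset.sum_mul_sum, Finset.sum_mul]
        refine Finset.sum_congr rfl fun m _ => ?_
        rw [Finset.sum_mul]
        exact Finset.sum_congr rfl fun m' _ => by simp only [D']; ring
      have hswap : ∀ F : Fin 4 → Fin 4 → Fin n × Fin 4 → Fin n × Fin 4 → ℝ,
          ∑ p, ∑ q, ∑ m, ∑ m', F m m' p q = ∑ m, ∑ m', ∑ p, ∑ q, F m m' p q := by
        intro F
        calc _ = ∑ p, ∑ m, ∑ q, ∑ m', F m m' p q :=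
              Finset.sum_congr rfl fun p _ => Finset.sum_comm
          _ = ∑ m, ∑ p, ∑ q, ∑ m', F m m' p q := Finset.sum_comm
          _ = ∑ m, ∑ p, ∑ m', ∑ q, F m m' p q :=
              Finset.sum_congr rfl fun m _ => Finset.sum_congr rfl fun p _ => Finset.sum_comm
          _ = _ := Finset.sum_congr rfl fun m _ => Finset.sum_comm
      rw [Finset.sum_congr rfl fun p _ => Finset.sum_congr rfl fun q _ => hexp p q,
        hswap fun m m' p q => D' m m' p q * (y m * y m')]
      refine Finset.sum_congr rfl fun m _ => Finset.sum_congr rfl fun m' _ => ?_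
      simp only [D, Finset.sum_mul]
    · have hy2 : ‖y‖ ^ 2 = ∑ m, y m * y m := by
        rw [EuclideanSpace.norm_sq_eq]
        exact Finset.sum_congr rfl fun m _ => by rw [Real.norm_eq_abs, sq_abs, sq]
      rw [← hy2, mul_assoc]
      refine mul_le_mul_of_nonneg_left ?_ hε.le
      calc ‖ℓ y‖ ^ 2 ≤ (‖y‖ * V) ^ 2 := pow_le_pow_left₀ (norm_nonneg _) (hℓn y) 2
        _ = V ^ 2 * ‖y‖ ^ 2 := by ring
  have hval : ∫ y in B, (∑ m, ∑ m', D m m' * (y m * y m') + ε * V ^ 2 * ∑ m, y m * y m) =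
      T * κ + ε * V ^ 2 * (4 * κ) := by
    rw [integral_add (hintg _ (by fun_prop)) (hintg _ (by fun_prop)), integral_const_mul,
      integral_finsetSum _ fun m _ => hintg _ (by fun_prop),
      integral_finsetSum _ fun m _ => hintg _ (by fun_prop)]
    congr 1
    · rw [Finset.sum_mul]
      refine Finset.sum_congr rfl fun m _ => ?_
      rw [integral_finsetSum _ fun m _ => hintg _ (by fun_prop)]
      simp [integral_const_mul, B, hmom]
    · simp [B, hmom]
  rw [hval] at hup
  have h1 : 0 ≤ T + 4 * ε * V ^ 2 := by
    have : 0 ≤ (T + 4 * ε * V ^ 2) * κ := by nlinarith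
    exact nonneg_of_mul_nonneg_left this hκ
  have h2 : 4 * ε * V ^ 2 ≤ -T / 2 := by
    have : ε * (8 * (V ^ 2 + 1)) = -T := by simp only [ε]; field_simp
    nlinarith
  linarith

/-! ### Smooth plurisubharmonic majorants -/

/-- The almost everywhere bound holds at every point near `x`: by upper semicontinuity a violation
would persist on a neighbourhood, which has positive measure. -/
theorem PSH.eventually_le_of_locallyBounded {n : ℕ} {Ω : Opens (HSpace n)} {u : HSpace n → EReal}
    (hu : PSH Ω u) (hb : LocallyBounded Ω u) {x : HSpace n} (hx : x ∈ Ω) :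
    ∃ C : ℝ, ∀ᶠ y in 𝓝 x, ((-C : ℝ) : EReal) ≤ u y := by
  obtain ⟨C, s, hs, hae⟩ := hb x hx
  refine ⟨C, ?_⟩
  filter_upwards [eventually_mem_nhds_iff.2 hs, Ω.isOpen.mem_nhds hx] with y hys hyΩ
  by_contra hlt
  push Not at hlt
  have h1 : ∀ᶠ z in 𝓝 y, u z < ((-C : ℝ) : EReal) := by
    have := hu.usc y hyΩ _ hlt
    rwa [Ω.isOpen.nhdsWithin_eq hyΩ] at this
  have h2 : ∀ᶠ z in 𝓝 y, u z < ((-C : ℝ) : EReal) ∧ z ∈ s := h1.and hys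
  have h3 := Measure.measure_pos_of_mem_nhds (volume : Measure (HSpace n)) h2
  refine h3.ne' (measure_mono_null ?_ hae)
  intro z hz hz'
  exact not_lt.2 (hz' hz.2).1 hz.1

theorem exists_bound_of_eventually {X : Type*} [TopologicalSpace X] {K : Set X} (hK : IsCompact K)
    {f : X → ℝ} (h : ∀ x ∈ K, ∃ C : ℝ, ∀ᶠ y in 𝓝 x, |f y| ≤ C) : ∃ M : ℝ, 0 ≤ M ∧ ∀ x ∈ K, |f x| ≤ M := by
  refine hK.induction_on (p := fun s => ∃ M : ℝ, 0 ≤ M ∧ ∀ x ∈ s, |f x| ≤ M)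
    ⟨0, le_rfl, by simp⟩ ?_ ?_ ?_
  · rintro s t hst ⟨M, h0, hM⟩
    exact ⟨M, h0, fun x hx => hM x (hst hx)⟩
  · rintro s t ⟨M, h0, hM⟩ ⟨M', h0', hM'⟩
    exact ⟨max M M', h0.trans (le_max_left _ _), fun x hx => hx.elim
      (fun h => (hM x h).trans (le_max_left _ _)) fun h => (hM' x h).trans (le_max_right _ _)⟩
  · intro x hx
    obtain ⟨C, hC⟩ := h x hx
    exact ⟨_, mem_nhdsWithin_of_mem_nhds hC, max C 0, le_max_right _ _,
      fun y hy => le_max_of_le_left hy⟩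

theorem PSH.coe_toReal {n : ℕ} {Ω : Opens (HSpace n)} {u : HSpace n → EReal}
    (hu : PSH Ω u) (hb : ∀ x ∈ Ω, ∃ C : ℝ, ∀ᶠ y in 𝓝 x, ((-C : ℝ) : EReal) ≤ u y)
    {x : HSpace n} (hx : x ∈ Ω) : ((u x).toReal : EReal) = u x := by
  obtain ⟨C, hC⟩ := hb x hx
  exact EReal.coe_toReal (hu.lt_top x hx).ne
    (ne_bot_of_le_ne_bot (EReal.coe_ne_bot _) hC.self_of_nhds)

theorem PSH.eventually_toReal_lt {n : ℕ} {Ω : Opens (HSpace n)} {u : HSpace n → EReal}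
    (hu : PSH Ω u) (hb : ∀ x ∈ Ω, ∃ C : ℝ, ∀ᶠ y in 𝓝 x, ((-C : ℝ) : EReal) ≤ u y)
    {x : HSpace n} (hx : x ∈ Ω) {c : ℝ} (hc : (u x).toReal < c) :
    ∀ᶠ y in 𝓝 x, (u y).toReal < c := by
  have h1 : u x < (c : EReal) := by
    rw [← hu.coe_toReal hb hx]; exact_mod_cast hc
  have h2 := hu.usc x hx _ h1
  rw [Ω.isOpen.nhdsWithin_eq hx] at h2
  filter_upwards [h2, Ω.isOpen.mem_nhds hx] with y hy hyΩ
  rw [← hu.coe_toReal hb hyΩ] at hy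
  exact_mod_cast hy

theorem PSH.exists_abs_toReal_le {n : ℕ} {Ω : Opens (HSpace n)} {u : HSpace n → EReal}
    (hu : PSH Ω u) (hb : ∀ x ∈ Ω, ∃ C : ℝ, ∀ᶠ y in 𝓝 x, ((-C : ℝ) : EReal) ≤ u y)
    {K : Set (HSpace n)} (hK : IsCompact K) (hKΩ : K ⊆ Ω) :
    ∃ M : ℝ, 0 ≤ M ∧ ∀ x ∈ K, |(u x).toReal| ≤ M := by
  refine exists_bound_of_eventually hK fun x hx => ?_
  obtain ⟨C, hC⟩ := hb x (hKΩ hx)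
  refine ⟨max C ((u x).toReal + 1), ?_⟩
  filter_upwards [hC, hu.eventually_toReal_lt hb (hKΩ hx) (lt_add_one _),
    Ω.isOpen.mem_nhds (hKΩ hx)] with y h1 h2 h3
  rw [← hu.coe_toReal hb h3, EReal.coe_le_coe_iff] at h1
  rw [abs_le]
  exact ⟨by linarith [le_max_left C ((u x).toReal + 1)], h2.le.trans (le_max_right _ _)⟩

/-- The passage from `ballMean` to Bochner integrals: since `f` agrees on the ball with an
integrable real function, both lower integrals are finite and the subtraction in `EReal` is an
ordinary one. -/
theorem setIntegral_const_le_of_le_ballMean {f : EuclideanSpace ℝ (Fin 4) → EReal}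
    {g : EuclideanSpace ℝ (Fin 4) → ℝ} {r c : ℝ} (hr : 0 < r)
    (hg : IntegrableOn g (Metric.ball 0 r)) (hfg : ∀ z ∈ Metric.ball 0 r, f z = g z)
    (hc : (c : EReal) ≤ ballMean f 0 r) :
    ∫ _y in Metric.ball (0 : EuclideanSpace ℝ (Fin 4)) r, c ≤ ∫ y in Metric.ball 0 r, g y := by
  have hA : ∫⁻ z in Metric.ball 0 r, (f z).toENNReal =
      ∫⁻ z in Metric.ball 0 r, ENNReal.ofReal (g z) :=
    setLIntegral_congr_fun measurableSet_ball fun z hz => by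
      simp only [hfg z hz, EReal.real_coe_toENNReal]
  have hB : ∫⁻ z in Metric.ball 0 r, (-f z).toENNReal =
      ∫⁻ z in Metric.ball 0 r, ENNReal.ofReal (-g z) :=
    setLIntegral_congr_fun measurableSet_ball fun z hz => by
      simp only [hfg z hz, ← EReal.coe_neg, EReal.real_coe_toENNReal]
  have hV : volume (Metric.ball (0 : EuclideanSpace ℝ (Fin 4)) r) ≠ ⊤ := measure_ball_lt_top.ne
  have hV0 : volume (Metric.ball (0 : EuclideanSpace ℝ (Fin 4)) r) ≠ 0 :=
    (Metric.measure_ball_pos _ _ hr).ne'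
  have hAt : ∫⁻ z in Metric.ball 0 r, ENNReal.ofReal (g z) ≠ ⊤ := hg.lintegral_lt_top.ne
  have hBt : ∫⁻ z in Metric.ball 0 r, ENNReal.ofReal (-g z) ≠ ⊤ := hg.neg.lintegral_lt_top.ne
  rw [ballMean, setLAverage_eq, setLAverage_eq, hA, hB] at hc
  rw [integral_eq_lintegral_pos_part_sub_lintegral_neg_part hg, setIntegral_const, smul_eq_mul,
    Measure.real]
  set A := ∫⁻ z in Metric.ball 0 r, ENNReal.ofReal (g z)
  set B := ∫⁻ z in Metric.ball 0 r, ENNReal.ofReal (-g z)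
  set V := volume (Metric.ball (0 : EuclideanSpace ℝ (Fin 4)) r)
  have h1 : ∀ X : ℝ≥0∞, X ≠ ⊤ → ((X / V : ℝ≥0∞) : EReal) = ((X.toReal / V.toReal : ℝ) : EReal) := by
    intro X hX
    rw [← ENNReal.toReal_div, EReal.coe_ennreal_toReal (ENNReal.div_ne_top hX hV0)]
  rw [h1 A hAt, h1 B hBt, ← EReal.coe_sub, EReal.coe_le_coe_iff, ← sub_div,
    le_div_iff₀ (ENNReal.toReal_pos hV0 hV)] at hc
  linarith

theorem continuous_rightLine {n : ℕ} (b : Fin n → ℍ[ℝ]) :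
    Continuous fun p : HSpace n × EuclideanSpace ℝ (Fin 4) => rightLine p.1 b p.2 := by
  have : ∀ p : HSpace n × EuclideanSpace ℝ (Fin 4), rightLine p.1 b p.2 =
      p.1 + ∑ m, p.2 m • WithLp.toLp 2 ((rightMul n m).mulVec
        fun p => ![(b p.1).re, (b p.1).imI, (b p.1).imJ, (b p.1).imK] p.2) := fun p => by
    rw [rightLine, ofQuat_mul_apply fun l => ?_]
    rfl
  simp only [this]
  fun_prop

theorem rightLine_add {n : ℕ} (x s : HSpace n) (b : Fin n → ℍ[ℝ])
    (y : EuclideanSpace ℝ (Fin 4)) : rightLine (x + s) b y = rightLine x b y + s := by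
  simp only [rightLine]; abel

theorem rightLine_zero {n : ℕ} (x : HSpace n) (b : Fin n → ℍ[ℝ]) : rightLine x b 0 = x := by
  ext p
  obtain ⟨l, m⟩ := p
  have h0 : ∀ l, b l * ⟨0, 0, 0, 0⟩ = 0 := fun l => mul_zero (b l)
  simp only [rightLine, ofQuat, PiLp.zero_apply, h0]
  fin_cases m <;> simp

/-! ### Suprema over small balls and mollification -/

section SupConvolution

variable {E : Type*} [NormedAddCommGroup E] [NormedSpace ℝ E] [FiniteDimensional ℝ E]

/-- The supremum of `g` over the closed ball of radius `δ`. -/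
def supBall (g : E → ℝ) (δ : ℝ) (x : E) : ℝ := sSup (g '' Metric.closedBall x δ)

theorem exists_supBall_eq {g : E → ℝ} (hg : UpperSemicontinuous g) {δ : ℝ} (hδ : 0 ≤ δ) (x : E) :
    ∃ y ∈ Metric.closedBall x δ, supBall g δ x = g y ∧
      ∀ z ∈ Metric.closedBall x δ, g z ≤ g y := by
  have : ProperSpace E := FiniteDimensional.proper ℝ E
  obtain ⟨y, hy, hm⟩ := UpperSemicontinuousOn.exists_isMaxOn
    (Metric.nonempty_closedBall.2 hδ : (Metric.closedBall x δ).Nonempty)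
    (isCompact_closedBall x δ) (hg.upperSemicontinuousOn _)
  refine ⟨y, hy, IsGreatest.csSup_eq ⟨⟨y, hy, rfl⟩, ?_⟩, fun z hz => hm hz⟩
  rintro _ ⟨z, hz, rfl⟩
  exact hm hz

theorem le_supBall {g : E → ℝ} (hg : UpperSemicontinuous g) {δ : ℝ} {x z : E}
    (hz : z ∈ Metric.closedBall x δ) : g z ≤ supBall g δ x := by
  obtain ⟨y, -, h, hm⟩ := exists_supBall_eq hg (Metric.nonempty_closedBall.1 ⟨z, hz⟩) x
  exact h ▸ hm z hz

theorem upperSemicontinuous_supBall {g : E → ℝ} (hg : UpperSemicontinuous g) {δ : ℝ}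
    (hδ : 0 ≤ δ) : UpperSemicontinuous (supBall g δ) := by
  have : ProperSpace E := FiniteDimensional.proper ℝ E
  intro x c hc
  have hsub : Metric.closedBall x δ ⊆ g ⁻¹' Set.Iio c := fun z hz =>
    (le_supBall hg hz).trans_lt hc
  obtain ⟨ε, hε, hth⟩ := (isCompact_closedBall x δ).exists_thickening_subset_open
    (hg.isOpen_preimage c) hsub
  filter_upwards [Metric.ball_mem_nhds x hε] with z hz
  obtain ⟨y, hy, h, -⟩ := exists_supBall_eq hg hδ z
  rw [h]
  refine hth (Metric.mem_thickening_iff.2 ⟨y + (x - z), ?_, ?_⟩)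
  · rw [Metric.mem_closedBall, dist_eq_norm] at hy ⊢
    rwa [show y + (x - z) - x = y - z by abel]
  · rw [Metric.mem_ball, dist_eq_norm] at hz
    rw [dist_eq_norm, show y - (y + (x - z)) = z - x by abel]
    exact hz

end SupConvolution

/-- A bounded upper semicontinuous function is integrable against an integrable weight. -/
theorem UpperSemicontinuous.integrable_mul {α E : Type*} [MeasurableSpace α] {μ : Measure α}
    [TopologicalSpace E] [MeasurableSpace E] [OpensMeasurableSpace E]
    {g : E → ℝ} (hg : UpperSemicontinuous g)
    {M : ℝ} (hM : ∀ x, |g x| ≤ M) {φ : α → ℝ} (hφ : Integrable φ μ) {ℓ : α → E}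
    (hℓ : Measurable ℓ) : Integrable (fun y => φ y * g (ℓ y)) μ := by
  refine hφ.mul_bdd (c := M) (hg.measurable.comp hℓ).aestronglyMeasurable
    (Eventually.of_forall fun y => ?_)
  rw [Real.norm_eq_abs]
  exact hM _

theorem UpperSemicontinuous.integrableOn_comp {α E : Type*} [MeasurableSpace α] {μ : Measure α}
    [TopologicalSpace E] [MeasurableSpace E] [OpensMeasurableSpace E]
    {g : E → ℝ} (hg : UpperSemicontinuous g)
    {M : ℝ} (hM : ∀ x, |g x| ≤ M) {s : Set α} (hs : μ s ≠ ⊤) {ℓ : α → E}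
    (hℓ : Measurable ℓ) : IntegrableOn (fun y => g (ℓ y)) s μ := by
  have h := UpperSemicontinuous.integrable_mul (μ := μ.restrict s) hg hM
    (integrableOn_const hs : IntegrableOn (fun _ => (1 : ℝ)) s μ) hℓ
  simp only [one_mul] at h
  exact h

/-- The restriction of a plurisubharmonic function to a compact set, extended by a constant. -/
theorem PSH.exists_upperSemicontinuous {n : ℕ} {Ω : Opens (HSpace n)} {u : HSpace n → EReal}
    (hu : PSH Ω u) (hb : ∀ x ∈ Ω, ∃ C : ℝ, ∀ᶠ y in 𝓝 x, ((-C : ℝ) : EReal) ≤ u y)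
    {K : Set (HSpace n)} (hK : IsCompact K) (hKΩ : K ⊆ Ω) :
    ∃ (g : HSpace n → ℝ) (M : ℝ), UpperSemicontinuous g ∧ (∀ x, |g x| ≤ M) ∧
      (∀ x ∈ K, g x = (u x).toReal) ∧
      ∀ x b r, b ≠ 0 → 0 < r → (∀ y ∈ Metric.closedBall 0 r, rightLine x b y ∈ K) →
        ∫ _y in Metric.ball (0 : EuclideanSpace ℝ (Fin 4)) r, g x ≤
          ∫ y in Metric.ball 0 r, g (rightLine x b y) := by
  classical
  obtain ⟨M, hM0, hM⟩ := hu.exists_abs_toReal_le hb hK hKΩ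
  -- The value `-M` off `K` is at most every value on `K`; as `K` is closed, this preserves upper
  -- semicontinuity.
  set g : HSpace n → ℝ := fun x => if x ∈ K then (u x).toReal else -M with hg
  have hgK : ∀ x ∈ K, g x = (u x).toReal := fun x hx => if_pos hx
  have hgM : ∀ x, |g x| ≤ M := by
    intro x
    by_cases hx : x ∈ K
    · rw [hgK x hx]; exact hM x hx
    · simp [hg, hx, abs_of_nonneg hM0]
  have husc : UpperSemicontinuous g := by
    intro x c hc
    have hMc : -M < c := (neg_le_of_abs_le (hgM x)).trans_lt hc
    by_cases hx : x ∈ K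
    · rw [hgK x hx] at hc
      filter_upwards [hu.eventually_toReal_lt hb (hKΩ hx) hc] with y hy
      simp only [hg]
      split_ifs
      exacts [hy, hMc]
    · filter_upwards [hK.isClosed.isOpen_compl.mem_nhds hx] with y hy
      simp only [hg]
      rwa [if_neg hy]
  refine ⟨g, M, husc, hgM, hgK, fun x b r hb0 hr hline => ?_⟩
  have h0 : (0 : EuclideanSpace ℝ (Fin 4)) ∈ Metric.closedBall 0 r :=
    Metric.mem_closedBall_self hr.le
  have hx : x ∈ K := by simpa [rightLine_zero] using hline 0 h0
  have hmean := (hu.subharmonic x b hb0).le_mean 0 r hr fun y hy => hKΩ (hline y hy)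
  refine setIntegral_const_le_of_le_ballMean hr ?_ (fun z hz => ?_) ((le_of_eq ?_).trans hmean)
  · exact UpperSemicontinuous.integrableOn_comp husc hgM measure_ball_lt_top.ne
      ((continuous_rightLine b).comp (Continuous.prodMk_right x)).measurable
  · have := hline z (Metric.ball_subset_closedBall hz)
    rw [hgK _ this, hu.coe_toReal hb (hKΩ this)]
  · rw [hgK x hx, hu.coe_toReal hb (hKΩ hx), rightLine_zero]

/-- The supremum at `x` is attained at some `z`. The line through `z` is the line through `x`
translated by `z - x`, so `g` on it is at most `supBall g δ` on the line through `x`. -/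
theorem supBall_submean {n : ℕ} {g : HSpace n → ℝ} {M δ r : ℝ} {K : Set (HSpace n)}
    (hg : UpperSemicontinuous g) (hM : ∀ x, |g x| ≤ M) (hδ : 0 ≤ δ) {b : Fin n → ℍ[ℝ]}
    (h : ∀ x, (∀ y ∈ Metric.closedBall 0 r, rightLine x b y ∈ K) →
        ∫ _y in Metric.ball (0 : EuclideanSpace ℝ (Fin 4)) r, g x ≤
          ∫ y in Metric.ball 0 r, g (rightLine x b y)) {x : HSpace n}
    (hx : ∀ y ∈ Metric.closedBall 0 r, Metric.closedBall (rightLine x b y) δ ⊆ K) :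
    ∫ _y in Metric.ball (0 : EuclideanSpace ℝ (Fin 4)) r, supBall g δ x ≤
      ∫ y in Metric.ball 0 r, supBall g δ (rightLine x b y) := by
  obtain ⟨z, hz, hzg, -⟩ := exists_supBall_eq hg hδ x
  have hzx : z = x + (z - x) := by abel
  have hd : ∀ y, rightLine z b y ∈ Metric.closedBall (rightLine x b y) δ := fun y => by
    rw [hzx, rightLine_add, Metric.mem_closedBall, dist_eq_norm, add_sub_cancel_left]
    rwa [Metric.mem_closedBall, dist_eq_norm] at hz
  have hsM : ∀ x, |supBall g δ x| ≤ M := fun x => by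
    obtain ⟨y, -, hy, -⟩ := exists_supBall_eq hg hδ x
    exact hy ▸ hM y
  rw [hzg]
  refine (h z fun y hy => hx y hy (hd y)).trans (integral_mono ?_ ?_ fun y => ?_)
  · exact UpperSemicontinuous.integrableOn_comp hg hM measure_ball_lt_top.ne
      ((continuous_rightLine b).comp (Continuous.prodMk_right z)).measurable
  · exact UpperSemicontinuous.integrableOn_comp (upperSemicontinuous_supBall hg hδ) hsM
      measure_ball_lt_top.ne ((continuous_rightLine b).comp (Continuous.prodMk_right x)).measurable
  · exact le_supBall hg (hd y)

/-- Mollification of a bounded upper semicontinuous function by a bump of radius `δ`. -/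
theorem exists_mollification {n : ℕ} {g : HSpace n → ℝ} {M δ : ℝ}
    (hg : UpperSemicontinuous g) (hM : ∀ x, |g x| ≤ M) (hδ : 0 < δ) :
    ∃ w : HSpace n → ℝ, ContDiff ℝ ∞ w ∧
      (∀ x c, (∀ y ∈ Metric.closedBall x δ, c ≤ g y) → c ≤ w x) ∧
      (∀ x c, (∀ y ∈ Metric.closedBall x δ, g y ≤ c) → w x ≤ c) ∧
      ∀ x b r, (∀ t ∈ Metric.closedBall (0 : HSpace n) δ,
        ∫ _y in Metric.ball (0 : EuclideanSpace ℝ (Fin 4)) r, g (x - t) ≤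
          ∫ y in Metric.ball 0 r, g (rightLine (x - t) b y)) →
        ∫ _y in Metric.ball (0 : EuclideanSpace ℝ (Fin 4)) r, w x ≤
          ∫ y in Metric.ball 0 r, w (rightLine x b y) := by
  let φ : ContDiffBump (0 : HSpace n) := ⟨δ / 2, δ, by positivity, by linarith⟩
  set ψ : HSpace n → ℝ := φ.normed volume with hψ
  have hψi : Integrable ψ := φ.integrable_normed
  have hψ0 : ∀ t, 0 ≤ ψ t := φ.nonneg_normed
  have hψ1 : ∫ t, ψ t = 1 := φ.integral_normed
  have hψs : ∀ t, t ∉ Metric.closedBall (0 : HSpace n) δ → ψ t = 0 := fun t ht => by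
    by_contra h
    have : t ∈ Function.support (φ.normed volume) := h
    rw [φ.support_normed_eq] at this
    exact ht (Metric.ball_subset_closedBall this)
  have hgl : LocallyIntegrable g := fun x => by
    refine ⟨Metric.ball x 1, Metric.ball_mem_nhds x one_pos, ?_⟩
    exact UpperSemicontinuous.integrableOn_comp hg hM measure_ball_lt_top.ne measurable_id
  have hintg : ∀ x, Integrable fun t => ψ t * g (x - t) := fun x =>
    UpperSemicontinuous.integrable_mul hg hM hψi (measurable_const.sub measurable_id)
  have hconst : ∀ c, ∫ t, ψ t * c = c := fun c => by rw [integral_mul_const, hψ1, one_mul]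
  have hball : ∀ x t, t ∈ Metric.closedBall (0 : HSpace n) δ → x - t ∈ Metric.closedBall x δ := by
    intro x t ht
    simpa [dist_eq_norm] using ht
  have hsmooth : ContDiff ℝ ∞ fun x => ∫ t, ψ t * g (x - t) :=
    φ.hasCompactSupport_normed.contDiff_convolution_left
      (ContinuousLinearMap.lsmul ℝ ℝ : ℝ →L[ℝ] ℝ →L[ℝ] ℝ) (n := ⊤)
      (φ.contDiff_normed (μ := volume)) hgl
  clear_value ψ
  clear hψ
  refine ⟨fun x => ∫ t, ψ t * g (x - t), hsmooth, fun x c h => ?_, fun x c h => ?_,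
    fun x b r h => ?_⟩
  · rw [← hconst c]
    refine integral_mono (hψi.mul_const c) (hintg x) fun t => ?_
    by_cases ht : t ∈ Metric.closedBall (0 : HSpace n) δ
    · exact mul_le_mul_of_nonneg_left (h _ (hball x t ht)) (hψ0 t)
    · simp [hψs t ht]
  · rw [← hconst c]
    refine integral_mono (hintg x) (hψi.mul_const c) fun t => ?_
    by_cases ht : t ∈ Metric.closedBall (0 : HSpace n) δ
    · exact mul_le_mul_of_nonneg_left (h _ (hball x t ht)) (hψ0 t)
    · simp [hψs t ht]
  · have hl : ∀ y t, rightLine x b y - t = rightLine (x - t) b y := fun y t => by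
      rw [sub_eq_add_neg, sub_eq_add_neg, rightLine_add]
    simp only [hl]
    have hlm : Measurable fun p : EuclideanSpace ℝ (Fin 4) × HSpace n =>
        rightLine (x - p.2) b p.1 :=
      ((continuous_rightLine b).comp ((continuous_const.sub continuous_snd).prodMk
        continuous_fst)).measurable
    have hprod : Integrable (Function.uncurry fun (y : EuclideanSpace ℝ (Fin 4)) (t : HSpace n) =>
        ψ t * g (rightLine (x - t) b y))
        ((volume.restrict (Metric.ball 0 r)).prod volume) := by
      have h1 : Integrable (fun p : EuclideanSpace ℝ (Fin 4) × HSpace n => (1 : ℝ) * ψ p.2)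
          ((volume.restrict (Metric.ball 0 r)).prod volume) :=
        Integrable.mul_prod (f := fun _ => (1 : ℝ))
          (integrableOn_const measure_ball_lt_top.ne) hψi
      simp only [one_mul] at h1
      exact UpperSemicontinuous.integrable_mul hg hM h1 hlm
    -- By Fubini the integral of `w` over the ball of the line is the average, with weight `ψ t`, of
    -- the integrals of `g` over translated lines.
    rw [integral_integral_swap hprod, setIntegral_const, smul_eq_mul, ← integral_const_mul]
    refine integral_mono ((hintg x).const_mul _) hprod.swap.integral_prod_left fun t => ?_
    simp only [integral_const_mul]
    by_cases ht : t ∈ Metric.closedBall (0 : HSpace n) δ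
    · have := h t ht
      rw [setIntegral_const, smul_eq_mul] at this
      calc _ = ψ t * (volume.real (Metric.ball (0 : EuclideanSpace ℝ (Fin 4)) r) * g (x - t)) := by
            ring
        _ ≤ _ := mul_le_mul_of_nonneg_left this (hψ0 t)
    · simp [hψs t ht]

/-- A locally bounded plurisubharmonic function has smooth plurisubharmonic majorants decreasing
to it near a given compact set. -/
theorem PSH.exists_majorant {n : ℕ} {Ω : Opens (HSpace n)} {u : HSpace n → EReal}
    (hu : PSH Ω u) (hb : ∀ x ∈ Ω, ∃ C : ℝ, ∀ᶠ y in 𝓝 x, ((-C : ℝ) : EReal) ≤ u y)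
    {K : Set (HSpace n)} (hK : IsCompact K) (hKΩ : K ⊆ Ω) :
    ∃ w, (quatForm n).Majorant K (fun x => (u x).toReal) w := by
  obtain ⟨ε, hε, hεΩ⟩ := hK.exists_cthickening_subset_open Ω.isOpen hKΩ
  obtain ⟨g, M, hg, hM, hgK, hsub⟩ := hu.exists_upperSemicontinuous hb hK.cthickening hεΩ
  have hKg : ∀ x ∈ K, g x = (u x).toReal := fun x hx =>
    hgK x (Metric.self_subset_cthickening K hx)
  -- Three displacements by at most `δ i` occur: along the line, by the mollification and by the
  -- supremum. The bound `3 * δ i ≤ ε` keeps them all where `g` coincides with `u`.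
  set δ : ℕ → ℝ := fun i => ε / 3 * (1 / (i + 1)) with hδ
  have hδ0 : ∀ i, 0 < δ i := fun i => by positivity
  have hδε : ∀ i, 3 * δ i ≤ ε := fun i => by
    have : (1 : ℝ) / (i + 1) ≤ 1 := (div_le_one (by positivity)).2 (by simp)
    simp only [hδ]; nlinarith
  have hδl : Tendsto δ atTop (𝓝 0) := by
    simpa [hδ] using (tendsto_one_div_add_atTop_nhds_zero_nat (𝕜 := ℝ)).const_mul (ε / 3)
  have hsM : ∀ i x, |supBall g (δ i) x| ≤ M := fun i x => by
    obtain ⟨y, -, hy, -⟩ := exists_supBall_eq hg (hδ0 i).le x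
    exact hy ▸ hM y
  -- Taking the supremum first, with the radius of the mollifier, makes `w i` a majorant without any
  -- mean value property: every ball over which the supremum is taken in mollifying at `y` contains
  -- `y`.
  choose w hwc hlow hup hmean using fun i =>
    exists_mollification (upperSemicontinuous_supBall hg (hδ0 i).le) (hsM i) (hδ0 i)
  refine ⟨w, hwc, Eventually.of_forall fun i y hy => ⟨?_, ?_⟩, fun x hx c hc => ?_⟩
  · refine mem_quatCone_of_submean (hwc i) fun b hb0 => ?_
    have hcont : Continuous fun z => rightLine y b z :=
      (continuous_rightLine b).comp (Continuous.prodMk_right y)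
    have hnear : ∀ᶠ z in 𝓝 (0 : EuclideanSpace ℝ (Fin 4)),
        rightLine y b z ∈ Metric.closedBall y (δ i) := by
      refine hcont.continuousAt.eventually ?_
      simp only [rightLine_zero]
      exact Metric.closedBall_mem_nhds y (hδ0 i)
    obtain ⟨r₀, hr₀, hr₀'⟩ := Metric.eventually_nhds_iff_ball.1 hnear
    refine ⟨r₀, hr₀, fun r hr hrr => hmean i y b r fun t ht => ?_⟩
    refine supBall_submean hg hM (hδ0 i).le (fun x hx => hsub x b r hb0 hr hx) fun z hz s hs => ?_
    refine Metric.closedBall_subset_cthickening hy ε ?_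
    have h1 := hr₀' z (Metric.closedBall_subset_ball hrr hz)
    rw [sub_eq_add_neg, rightLine_add] at hs
    simp only [Metric.mem_closedBall, dist_eq_norm, sub_zero] at h1 hs ht ⊢
    calc ‖s - y‖ = ‖(s - (rightLine y b z + -t)) + (rightLine y b z - y) - t‖ := by
          congr 1; abel
      _ ≤ ‖(s - (rightLine y b z + -t)) + (rightLine y b z - y)‖ + ‖t‖ := norm_sub_le _ _
      _ ≤ (δ i + δ i) + δ i := add_le_add ((norm_add_le _ _).trans (add_le_add hs h1)) ht
      _ ≤ ε := by linarith [hδε i]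
  · refine hlow i y _ fun z hz => ?_
    rw [← hKg y hy]
    exact le_supBall hg (Metric.mem_closedBall_comm.1 hz)
  · obtain ⟨c', hc', hc'c⟩ := exists_between hc
    rw [← hKg x hx] at hc'
    obtain ⟨ρ, hρ, hρ'⟩ := Metric.eventually_nhds_iff_ball.1 (hg x c' hc')
    have h1 : ∀ᶠ i in atTop, δ i < ρ / 3 := hδl.eventually_lt_const (by positivity)
    filter_upwards [h1.prod_mk (Metric.ball_mem_nhds x (by positivity : 0 < ρ / 3))] with p hp
    refine (hup p.1 p.2 c' fun y hy => ?_).trans_lt hc'c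
    obtain ⟨z, hz, hzg, -⟩ := exists_supBall_eq hg (hδ0 p.1).le y
    rw [hzg]
    refine (hρ' z ?_).le
    have h2 : dist p.2 x < ρ / 3 := hp.2
    rw [Metric.mem_closedBall] at hy hz
    rw [Metric.mem_ball]
    linarith [dist_triangle z y x, dist_triangle y p.2 x, hp.1]

/-- The majorants on an exhaustion by compact sets, all of the same function, are turned into one
decreasing approximation by `exists_diagonal` applied to a constant sequence. -/
theorem PSH.exists_approx {n : ℕ} {Ω : Opens (HSpace n)} {u : HSpace n → EReal}
    (hu : PSH Ω u) (hb : ∀ x ∈ Ω, ∃ C : ℝ, ∀ᶠ y in 𝓝 x, ((-C : ℝ) : EReal) ≤ u y) :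
    ∃ w, (quatForm n).Approx Ω (fun x => (u x).toReal) w := by
  obtain ⟨K, hK, hKm, hKΩ, hKn⟩ := exists_compact_exhaustion Ω.isOpen
  choose w hw using fun m => hu.exists_majorant hb (hK m) (hKΩ m)
  have hbd : ∀ x ∈ Ω, ∃ V ∈ 𝓝 x, ∃ C : ℝ, ∀ y ∈ V, -C ≤ (u y).toReal := by
    intro x hx
    obtain ⟨C, hC⟩ := hb x hx
    refine ⟨_, hC.and (Ω.isOpen.mem_nhds hx), C, fun y hy => ?_⟩
    have h := hy.1
    rwa [← hu.coe_toReal hb hy.2, EReal.coe_le_coe_iff] at h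
  obtain ⟨i, -, hi⟩ := MixedForm.exists_diagonal (𝓜 := quatForm n) (τ := Unit)
    (v := fun _ _ x => (u x).toReal) (vl := fun _ x => (u x).toReal) (w := fun _ m => w m)
    hK hKm hKΩ hKn (fun _ _ _ _ => le_rfl) (fun _ _ _ => tendsto_const_nhds)
    (fun _ => hbd) (fun _ m => hw m) (Q := fun _ _ => True)
    fun _ => Eventually.of_forall fun _ => trivial
  exact ⟨_, hi ()⟩

/-! ### Test forms and the operator `△` -/

section Forms

variable {n q : ℕ} {Ω : Opens (HSpace n)}

/-- The inclusion of `⋀^q ℂ²ⁿ` in the exterior algebra. -/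
def toExt (n q : ℕ) : Form n q →ₗ[ℂ] ExtAlg n where
  toFun F J := if h : J.card = q then F ⟨J, h⟩ else 0
  map_add' F G := by
    funext J
    simp only [Pi.add_apply]
    split_ifs <;> simp
  map_smul' c F := by
    funext J
    simp only [Pi.smul_apply, RingHom.id_apply]
    split_ifs <;> simp

lemma toExt_apply (F : Form n q) (J : Finset (Fin (2 * n))) :
    toExt n q F J = if h : J.card = q then F ⟨J, h⟩ else 0 := rfl

lemma toExt_eq_sum (F : Form n q) : toExt n q F = ∑ I, F I • omega I.1 := by
  funext J
  rw [toExt_apply, Finset.sum_apply]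
  simp only [Pi.smul_apply, smul_eq_mul, omega, Pi.single_apply]
  split_ifs with h
  · rw [Finset.sum_eq_single_of_mem (⟨J, h⟩ : MultiIndex n q) (Finset.mem_univ _)]
    · simp
    · intro I _ hI
      rw [if_neg, mul_zero]
      rintro rfl
      exact hI rfl
  · refine (Finset.sum_eq_zero fun I _ => ?_).symm
    rw [if_neg, mul_zero]
    rintro rfl
    exact h I.2

lemma toExt_omegaWedge (j : Fin (2 * n)) (F : Form n q) :
    toExt n (q + 1) (omegaWedge q j F) = wedgeOp j (toExt n q F) := by
  funext J
  rw [toExt_apply, wedgeOp_apply]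
  by_cases hj : j ∈ J
  · have hc := Finset.card_erase_add_one hj
    by_cases hJ : J.card = q + 1
    · have hq : (J.erase j).card = q := by omega
      simp [omegaWedge, hj, hJ, toExt_apply, hq]
    · have hq : (J.erase j).card ≠ q := by omega
      simp [hJ, toExt_apply, hq]
  · simp [omegaWedge, hj]

lemma partialDeriv_apply (l : Fin n) (m : Fin 4) (F : TestForm Ω q) (x : HSpace n) :
    partialDeriv l m F x = fderiv ℝ F x (EuclideanSpace.single (l, m) 1) := by
  rw [partialDeriv, TestFunction.lineDerivOp_eq_lineDerivCLM ℝ, TestFunction.lineDerivCLM_apply]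
  simp only [top_add, le_refl, if_true]
  exact (F.contDiff.differentiable (by simp) x).lineDeriv_eq_fderiv

lemma nabla_apply (j : Fin (2 * n)) (α : Fin 2) (F : TestForm Ω q) (x : HSpace n) :
    nabla j α F x = ∑ p, nablaVec α p j • fderiv ℝ F x (EuclideanSpace.single p 1) := by
  have h2 : (j : ℕ) % 2 = 0 ∨ (j : ℕ) % 2 = 1 := by omega
  rw [Fintype.sum_prod_type, Finset.sum_eq_single_of_mem ((pairEquiv n).symm j).1
    (Finset.mem_univ _)]
  · simp only [nablaVec, if_true, ← partialDeriv_apply]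
    have hl : ((pairEquiv n).symm j).1 = ⟨j / 2, by omega⟩ := rfl
    have hb : ((pairEquiv n).symm j).2 = ⟨j % 2, by omega⟩ := rfl
    rw [hl, hb]
    unfold nabla
    rcases h2 with h2 | h2
    · simp only [h2]
      fin_cases α <;> simp [Fin.sum_univ_four, nablaCoeff, sub_eq_add_neg]
    · simp only [h2]
      fin_cases α <;> simp [Fin.sum_univ_four, nablaCoeff, sub_eq_add_neg]
  · intro l _ hl
    refine Finset.sum_eq_zero fun m _ => ?_
    rw [nablaVec, if_neg (Ne.symm hl), zero_smul]

lemma toExt_dOp (α : Fin 2) (F : TestForm Ω q) (x : HSpace n) :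
    toExt n (q + 1) (dOp α F x) = ∑ p, wedgeVec n (nablaVec α p)
      (toExt n q (fderiv ℝ F x (EuclideanSpace.single p 1))) := by
  have h : dOp α F x = ∑ j, omegaWedge q j (nabla j α F x) := by
    rw [dOp]
    simp [TestFunction.postcompCLM_apply]
  rw [h, map_sum]
  simp only [toExt_omegaWedge, nabla_apply, map_sum, map_smul, wedgeVec_apply,
    LinearMap.sum_apply, LinearMap.smul_apply]
  exact Finset.sum_comm

/-- The real part of a coefficient of a test form. -/
def reCoeff (F : TestForm Ω q) (I : MultiIndex n q) (x : HSpace n) : ℝ := (F x I).re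

/-- The imaginary part of a coefficient of a test form. -/
def imCoeff (F : TestForm Ω q) (I : MultiIndex n q) (x : HSpace n) : ℝ := (F x I).im

lemma contDiff_coeff (F : TestForm Ω q) (I : MultiIndex n q) : ContDiff ℝ ∞ fun x => F x I :=
  contDiff_pi.1 F.contDiff I

lemma contDiff_reCoeff (F : TestForm Ω q) (I : MultiIndex n q) : ContDiff ℝ ∞ (reCoeff F I) :=
  Complex.reCLM.contDiff.comp (contDiff_coeff F I)

lemma contDiff_imCoeff (F : TestForm Ω q) (I : MultiIndex n q) : ContDiff ℝ ∞ (imCoeff F I) :=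
  Complex.imCLM.contDiff.comp (contDiff_coeff F I)

lemma fderiv_eq_pd (F : TestForm Ω q) (I : MultiIndex n q) (p : Fin n × Fin 4) (x : HSpace n) :
    fderiv ℝ F x (EuclideanSpace.single p 1) I =
      (pd p (reCoeff F I) x : ℂ) + Complex.I * pd p (imCoeff F I) x := by
  have hF : DifferentiableAt ℝ F x := F.contDiff.differentiable (by simp) x
  have hI : DifferentiableAt ℝ (fun x => F x I) x :=
    (contDiff_coeff F I).differentiable (by simp) x
  have h1 : fderiv ℝ F x (EuclideanSpace.single p 1) I =
      fderiv ℝ (fun x => F x I) x (EuclideanSpace.single p 1) := by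
    have := ((hasFDerivAt_pi' (Φ := fun x => F x)).1 hF.hasFDerivAt I).fderiv
    rw [this]; rfl
  have hre : pd p (reCoeff F I) x = (fderiv ℝ (fun x => F x I) x (EuclideanSpace.single p 1)).re := by
    have := (Complex.reCLM.hasFDerivAt.comp x hI.hasFDerivAt).fderiv
    exact congrArg (fun T => T (EuclideanSpace.single p 1)) this
  have him : pd p (imCoeff F I) x = (fderiv ℝ (fun x => F x I) x (EuclideanSpace.single p 1)).im := by
    have := (Complex.imCLM.hasFDerivAt.comp x hI.hasFDerivAt).fderiv
    exact congrArg (fun T => T (EuclideanSpace.single p 1)) this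
  rw [h1, hre, him]
  apply Complex.ext <;> simp

lemma reCoeff_partialDeriv (F : TestForm Ω q) (I : MultiIndex n q) (l : Fin n) (m : Fin 4) :
    reCoeff (partialDeriv l m F) I = pd (l, m) (reCoeff F I) := by
  funext x
  rw [reCoeff, partialDeriv_apply, fderiv_eq_pd]
  simp

lemma imCoeff_partialDeriv (F : TestForm Ω q) (I : MultiIndex n q) (l : Fin n) (m : Fin 4) :
    imCoeff (partialDeriv l m F) I = pd (l, m) (imCoeff F I) := by
  funext x
  rw [imCoeff, partialDeriv_apply, fderiv_eq_pd]
  simp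

/-- The operators `d₀` and `d₁` have constant coefficients, so both derivatives fall on the real and
imaginary parts of the coefficients of `F`, where they assemble into Hessians. -/
lemma toExt_baston (F : TestForm Ω q) (x : HSpace n) :
    toExt n (q + 2) (baston F x) = ∑ I, (bastonOp (hess (reCoeff F I) x) +
      Complex.I • bastonOp (hess (imCoeff F I) x)) (omega I.1) := by
  have hD : ∀ p, toExt n (q + 1) (fderiv ℝ (dOp 1 F) x (EuclideanSpace.single p 1)) =
      ∑ r : Fin n × Fin 4, wedgeVec n (nablaVec 1 r) (toExt n q
        (fderiv ℝ (partialDeriv r.1 r.2 F) x (EuclideanSpace.single p 1))) := by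
    intro p
    let T : Fin n × Fin 4 → Form n q →L[ℝ] ExtAlg n := fun r =>
      LinearMap.toContinuousLinearMap
        (((wedgeVec n (nablaVec 1 r)) ∘ₗ toExt n q).restrictScalars ℝ)
    let S : Form n (q + 1) →L[ℝ] ExtAlg n :=
      LinearMap.toContinuousLinearMap ((toExt n (q + 1)).restrictScalars ℝ)
    have hfun : (fun y => S (dOp 1 F y)) =
        fun y => ∑ r, T r (partialDeriv r.1 r.2 F y) := by
      funext y
      refine (toExt_dOp 1 F y).trans (Finset.sum_congr rfl fun r _ => ?_)
      rw [partialDeriv_apply]; rfl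
    have hG : DifferentiableAt ℝ (dOp 1 F) x := (dOp 1 F).contDiff.differentiable (by simp) x
    have h1 : HasFDerivAt (fun y => S (dOp 1 F y)) (S.comp (fderiv ℝ (dOp 1 F) x)) x :=
      S.hasFDerivAt.comp x hG.hasFDerivAt
    have h2 : HasFDerivAt (fun y => ∑ r, T r (partialDeriv r.1 r.2 F y))
        (∑ r, (T r).comp (fderiv ℝ (partialDeriv r.1 r.2 F) x)) x :=
      HasFDerivAt.fun_sum fun r _ => (T r).hasFDerivAt.comp x
        ((partialDeriv r.1 r.2 F).contDiff.differentiable (by simp) x).hasFDerivAt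
    rw [hfun] at h1
    have h3 := congrArg (fun L => L (EuclideanSpace.single p 1)) (h1.unique h2)
    simpa [S, T] using h3
  rw [baston, toExt_dOp]
  have hR : ∀ I : MultiIndex n q, (bastonOp (hess (reCoeff F I) x) +
      Complex.I • bastonOp (hess (imCoeff F I) x)) (omega I.1) =
      ∑ p, ∑ r, ((hess (reCoeff F I) x p r : ℂ) + Complex.I * hess (imCoeff F I) x p r) •
        wedgeVec n (nablaVec 0 p) (wedgeVec n (nablaVec 1 r) (omega I.1)) := by
    intro I
    simp only [bastonOp, LinearMap.add_apply, LinearMap.smul_apply, LinearMap.sum_apply,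
      Finset.smul_sum, ← Finset.sum_add_distrib, add_smul, mul_smul, Module.End.mul_apply]
  rw [Finset.sum_congr rfl fun I _ => hR I, Finset.sum_comm]
  refine Finset.sum_congr rfl fun p _ => ?_
  rw [hD, map_sum, Finset.sum_comm]
  refine Finset.sum_congr rfl fun r _ => ?_
  rw [toExt_eq_sum, map_sum, map_sum]
  refine Finset.sum_congr rfl fun I _ => ?_
  rw [map_smul, map_smul, fderiv_eq_pd, reCoeff_partialDeriv, imCoeff_partialDeriv]
  rfl

end Forms

/-! ### Products of smooth factors -/

section SmoothProduct

variable {n : ℕ}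

/-- The coefficient at `ω⁰ ∧ ⋯ ∧ ω²ⁿ⁻¹` of `△w₁ ∧ ⋯ ∧ △w_k ∧ F` for smooth `w₁, …, w_k`. -/
def bastonTop (W : List (HSpace n → ℝ)) (x : HSpace n) : ExtAlg n →ₗ[ℂ] ℂ :=
  LinearMap.proj Finset.univ ∘ₗ (W.map fun w => bastonOp (hess w x)).prod

lemma bastonTop_apply (W : List (HSpace n → ℝ)) (x : HSpace n) (F : ExtAlg n) :
    bastonTop W x F = (W.map fun w => bastonOp (hess w x)).prod F Finset.univ := rfl

/-- Multiplications by `2`-forms commute, so the first factor may be moved next to the test form. -/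
lemma bastonTop_cons (f : HSpace n → ℝ) (W : List (HSpace n → ℝ)) (x : HSpace n) (F : ExtAlg n) :
    bastonTop (f :: W) x F = bastonTop W x (bastonOp (hess f x) F) := by
  rw [bastonTop_apply, bastonTop_apply, List.map_cons, List.prod_cons, ← Module.End.mul_apply]
  have : Commute (bastonOp (hess f x)) (W.map fun w => bastonOp (hess w x)).prod :=
    Commute.list_prod_right _ _ fun T hT => by
      obtain ⟨w, hw, rfl⟩ := List.mem_map.1 hT
      exact bastonOp_comm _ _
  rw [this.eq]

/-- `ω^I` is a combination of products of positive constant `2`-forms, and each of these is the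
Baston form of a quadratic function. The coefficient thus becomes a combination of complete mixed
discriminants of `n` functions. The matrices depend on `I` but not on `W`, so they are fixed before
any limit. -/
lemma exists_bastonTop_eq {k : ℕ} {I : Finset (Fin (2 * n))} (hI : I.card + 2 * k = 2 * n) :
    ∃ (N : ℕ) (c : Fin N → ℂ) (C : Fin N → List (Matrix (Fin n × Fin 4) (Fin n × Fin 4) ℝ)),
      (∀ s, k + (C s).length = n ∧ ∀ A ∈ C s, A.PosSemidef) ∧
      ∀ W : List (HSpace n → ℝ), W.length = k → (∀ w ∈ W, ContDiff ℝ ∞ w) → ∀ x,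
        bastonTop W x (omega I) =
          ∑ s, c s * (((quatForm n).ma (family n (W ++ (C s).map quad)) x : ℝ) : ℂ) := by
  obtain ⟨N, c, C, hC, hsum⟩ := exists_omega_eq_sum (n := n) (p := n - k) (I := I) (by omega)
  have hlen : ∀ s, k + (C s).length = n := fun s => by rw [(hC s).1]; omega
  refine ⟨N, c, C, fun s => ⟨hlen s, (hC s).2⟩, fun W hWl hW x => ?_⟩
  rw [hsum, map_sum]
  refine Finset.sum_congr rfl fun s _ => ?_
  rw [map_smul, smul_eq_mul]
  congr 1
  rw [← topCoeff_hess (by simp [hWl, hlen s]), List.map_append, List.map_map, List.prod_append,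
    topCoeff_apply, bastonTop_apply, Module.End.mul_apply]
  · suffices h : (C s).map bastonOp = (C s).map ((fun w => bastonOp (hess w x)) ∘ quad) by rw [h]
    refine List.map_congr_left fun A hA => ?_
    have hs : A.IsSymm := by
      simpa [Matrix.IsHermitian, Matrix.IsSymm] using ((hC s).2 A hA).1
    simp only [Function.comp, hess_quad hs]
  · intro w hw
    rcases List.mem_append.1 hw with hw | hw
    · exact hW w hw
    · obtain ⟨A, -, rfl⟩ := List.mem_map.1 hw
      exact contDiff_quad A

lemma continuous_bastonTop_omega {W : List (HSpace n → ℝ)} {I : Finset (Fin (2 * n))}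
    (hI : I.card + 2 * W.length = 2 * n) (hW : ∀ w ∈ W, ContDiff ℝ ∞ w) :
    Continuous fun x => bastonTop W x (omega I) := by
  obtain ⟨N, c, C, -, h⟩ := exists_bastonTop_eq hI
  simp only [h W rfl hW]
  refine continuous_finsetSum _ fun s _ => continuous_const.mul (Complex.continuous_ofReal.comp
    ((quatForm n).ma_contDiff (contDiff_family fun w hw => ?_)).continuous)
  rcases List.mem_append.1 hw with hw | hw
  · exact hW w hw
  · obtain ⟨A, -, rfl⟩ := List.mem_map.1 hw
    exact contDiff_quad A

lemma hess_of_notMem_tsupport {f : HSpace n → ℝ} {x : HSpace n} (hx : x ∉ tsupport f) :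
    hess f x = 0 := by
  have : f =ᶠ[𝓝 x] fun _ => 0 := notMem_tsupport_iff_eventuallyEq.1 hx
  rw [hess_congr this, hess_const]

lemma hasCompactSupport_bastonTop_cons {f : HSpace n → ℝ} (hc : HasCompactSupport f)
    (W : List (HSpace n → ℝ)) (F : ExtAlg n) :
    HasCompactSupport fun x => bastonTop (f :: W) x F :=
  HasCompactSupport.intro hc fun x hx => by
    rw [bastonTop_apply, List.map_cons, List.prod_cons, hess_of_notMem_tsupport hx, bastonOp_zero,
      zero_mul]
    rfl

/-- After decomposing `ω^I` this is `integral_mul_ma_update` in the first slot of each family. -/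
lemma integral_mul_bastonTop_cons {W : List (HSpace n → ℝ)} {I : Finset (Fin (2 * n))}
    (hI : I.card + 2 * (W.length + 1) = 2 * n) (hW : ∀ w ∈ W, ContDiff ℝ ∞ w)
    {f g : HSpace n → ℝ} (hf : ContDiff ℝ ∞ f) (hg : ContDiff ℝ ∞ g) (hc : HasCompactSupport f) :
    ∫ x, (g x : ℂ) * bastonTop (f :: W) x (omega I) =
      ∫ x, (f x : ℂ) * bastonTop (g :: W) x (omega I) := by
  obtain ⟨N, c, C, hC, h⟩ := exists_bastonTop_eq hI
  have hn : 0 < n := by omega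
  have hs : ∀ f, ContDiff ℝ ∞ f → ∀ w ∈ f :: W, ContDiff ℝ ∞ w := fun f hf w hw => by
    rcases List.mem_cons.1 hw with rfl | hw
    exacts [hf, hW w hw]
  have hs' : ∀ f, ContDiff ℝ ∞ f → ∀ s, ∀ w ∈ f :: (W ++ (C s).map quad), ContDiff ℝ ∞ w := by
    intro f hf s w hw
    rcases List.mem_cons.1 hw with rfl | hw
    · exact hf
    · rcases List.mem_append.1 hw with hw | hw
      · exact hW w hw
      · obtain ⟨A, -, rfl⟩ := List.mem_map.1 hw
        exact contDiff_quad A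
  have hzero : ∀ s x, x ∉ tsupport f →
      (quatForm n).ma (family n (f :: (W ++ (C s).map quad))) x = 0 := fun s x hx => by
    rw [MixedForm.ma, (quatForm n).disc.map_coord_zero ⟨0, hn⟩]
    simpa [family] using hess_of_notMem_tsupport hx
  simp only [h (f :: W) rfl (hs f hf), h (g :: W) rfl (hs g hg), List.cons_append, Finset.mul_sum]
  rw [integral_finsetSum, integral_finsetSum]
  · refine Finset.sum_congr rfl fun s _ => ?_
    have e : ∀ a b : HSpace n → ℝ, ∫ x, (a x : ℂ) * (c s * ((b x : ℝ) : ℂ)) =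
        c s * ((∫ x, a x * b x : ℝ) : ℂ) := fun a b => by
      rw [← integral_complex_ofReal, ← integral_const_mul]
      congr 1; funext x; push_cast; ring
    rw [e, e]
    congr 2
    have := (quatForm n).integral_mul_ma_update (i := ⟨0, hn⟩)
      (contDiff_family (hs' f hf s)) hg hf (Or.inr hc)
    rwa [update_family_cons, update_family_cons] at this
  · intro s _
    have hma := ((quatForm n).ma_contDiff (contDiff_family (hs' g hg s))).continuous
    refine Continuous.integrable_of_hasCompactSupport ?_ ?_
    · exact (Complex.continuous_ofReal.comp hf.continuous).mul
        (continuous_const.mul (Complex.continuous_ofReal.comp hma))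
    · exact HasCompactSupport.mul_right (hc.comp_left Complex.ofReal_zero)
  · intro s _
    have hma := ((quatForm n).ma_contDiff (contDiff_family (hs' f hf s))).continuous
    refine Continuous.integrable_of_hasCompactSupport ?_ ?_
    · exact (Complex.continuous_ofReal.comp hg.continuous).mul
        (continuous_const.mul (Complex.continuous_ofReal.comp hma))
    · exact HasCompactSupport.intro hc fun x hx => by rw [hzero s x hx]; simp

variable {q : ℕ} {Ω : Opens (HSpace n)}

lemma hasCompactSupport_coeff (F : TestForm Ω q) (I : MultiIndex n q) :
    HasCompactSupport fun x => F x I :=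
  F.hasCompactSupport.comp_left (g := fun G : Form n q => G I) rfl

/-- The current `△w₁ ∧ ⋯ ∧ △w_k` for smooth `w₁, …, w_k`. -/
def smoothCurrent (W : List (HSpace n → ℝ)) (η : TestForm Ω q) : ℂ :=
  ∫ x, bastonTop W x (toExt n q (η x))

lemma smoothCurrent_eq_sum {W : List (HSpace n → ℝ)} (hq : q + 2 * W.length = 2 * n)
    (hW : ∀ w ∈ W, ContDiff ℝ ∞ w) {g : HSpace n → ℝ} (hg : Continuous g) (η : TestForm Ω q) :
    ∫ x, (g x : ℂ) * bastonTop W x (toExt n q (η x)) =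
      ∑ I : MultiIndex n q, ∫ x, η x I * ((g x : ℂ) * bastonTop W x (omega I.1)) := by
  rw [← integral_finsetSum]
  · congr 1
    funext x
    rw [toExt_eq_sum, map_sum, Finset.mul_sum]
    refine Finset.sum_congr rfl fun I _ => ?_
    rw [map_smul, smul_eq_mul]
    ring
  · intro I _
    refine Continuous.integrable_of_hasCompactSupport ?_ (hasCompactSupport_coeff η I).mul_right
    exact (contDiff_coeff η I).continuous.mul ((Complex.continuous_ofReal.comp hg).mul
      (continuous_bastonTop_omega (by rw [I.2, hq]) hW))

/-- The rule `(△R)(η) = R(△η)` for smooth data: the Hessians of the coefficients of `η`, real and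
imaginary parts separately, are moved onto `g`. The compact support is that of `η`. -/
lemma integral_mul_bastonTop_baston {W : List (HSpace n → ℝ)}
    (hq : q + 2 * (W.length + 1) = 2 * n) (hW : ∀ w ∈ W, ContDiff ℝ ∞ w) {g : HSpace n → ℝ}
    (hg : ContDiff ℝ ∞ g) (η : TestForm Ω q) :
    ∫ x, (g x : ℂ) * bastonTop W x (toExt n (q + 2) (baston η x)) = smoothCurrent (g :: W) η := by
  have hs : ∀ f, ContDiff ℝ ∞ f → ∀ w ∈ f :: W, ContDiff ℝ ∞ w := fun f hf w hw => by
    rcases List.mem_cons.1 hw with rfl | hw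
    exacts [hf, hW w hw]
  have hre : ∀ I, HasCompactSupport (reCoeff η I) := fun I =>
    (hasCompactSupport_coeff η I).comp_left Complex.zero_re
  have him : ∀ I, HasCompactSupport (imCoeff η I) := fun I =>
    (hasCompactSupport_coeff η I).comp_left Complex.zero_im
  have hcard : ∀ I : MultiIndex n q, I.1.card + 2 * (W.length + 1) = 2 * n := fun I => by
    rw [I.2, hq]
  have hintg : ∀ f, ContDiff ℝ ∞ f → HasCompactSupport f → ∀ I : MultiIndex n q,
      Integrable fun x => (g x : ℂ) * bastonTop (f :: W) x (omega I.1) := fun f hf hc I =>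
    Continuous.integrable_of_hasCompactSupport ((Complex.continuous_ofReal.comp hg.continuous).mul
      (continuous_bastonTop_omega (hcard I) (hs f hf)))
      (hasCompactSupport_bastonTop_cons hc W _).mul_left
  have hintg' : ∀ f : HSpace n → ℝ, ContDiff ℝ ∞ f → HasCompactSupport f → ∀ I : MultiIndex n q,
      Integrable fun x => (f x : ℂ) * bastonTop (g :: W) x (omega I.1) := fun f hf hc I =>
    Continuous.integrable_of_hasCompactSupport ((Complex.continuous_ofReal.comp hf.continuous).mul
      (continuous_bastonTop_omega (hcard I) (hs g hg)))
      (HasCompactSupport.mul_right (hc.comp_left Complex.ofReal_zero))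
  have h1 : ∀ x, (g x : ℂ) * bastonTop W x (toExt n (q + 2) (baston η x)) =
      ∑ I : MultiIndex n q, ((g x : ℂ) * bastonTop (reCoeff η I :: W) x (omega I.1) +
        Complex.I * ((g x : ℂ) * bastonTop (imCoeff η I :: W) x (omega I.1))) := by
    intro x
    rw [toExt_baston, map_sum, Finset.mul_sum]
    refine Finset.sum_congr rfl fun I _ => ?_
    rw [LinearMap.add_apply, LinearMap.smul_apply, map_add, map_smul,
      ← bastonTop_cons, ← bastonTop_cons, smul_eq_mul]
    ring
  have h2 : ∀ x, bastonTop (g :: W) x (toExt n q (η x)) =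
      ∑ I : MultiIndex n q, ((reCoeff η I x : ℂ) * bastonTop (g :: W) x (omega I.1) +
        Complex.I * ((imCoeff η I x : ℂ) * bastonTop (g :: W) x (omega I.1))) := by
    intro x
    rw [toExt_eq_sum, map_sum]
    refine Finset.sum_congr rfl fun I _ => ?_
    rw [map_smul, smul_eq_mul]
    conv_lhs => rw [← Complex.re_add_im (η x I)]
    simp only [reCoeff, imCoeff]
    ring
  rw [smoothCurrent]
  simp only [h1, h2]
  rw [integral_finsetSum, integral_finsetSum]
  · refine Finset.sum_congr rfl fun I _ => ?_
    rw [integral_add, integral_add, integral_const_mul, integral_const_mul,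
      integral_mul_bastonTop_cons (hcard I) hW (contDiff_reCoeff η I) hg (hre I),
      integral_mul_bastonTop_cons (hcard I) hW (contDiff_imCoeff η I) hg (him I)]
    · exact hintg' _ (contDiff_reCoeff η I) (hre I) I
    · exact (hintg' _ (contDiff_imCoeff η I) (him I) I).const_mul _
    · exact hintg _ (contDiff_reCoeff η I) (hre I) I
    · exact (hintg _ (contDiff_imCoeff η I) (him I) I).const_mul _
  · exact fun I _ => (hintg' _ (contDiff_reCoeff η I) (hre I) I).add
      ((hintg' _ (contDiff_imCoeff η I) (him I) I).const_mul _)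
  · exact fun I _ => (hintg _ (contDiff_reCoeff η I) (hre I) I).add
      ((hintg _ (contDiff_imCoeff η I) (him I) I).const_mul _)

lemma smoothCurrent_add_const {τ : Type*} {w : τ → HSpace n → ℝ} (hw : ∀ t, ContDiff ℝ ∞ (w t)) (c : τ → ℝ) (L : List τ)
    (η : TestForm Ω q) :
    smoothCurrent (L.map fun t x => w t x + c t) η = smoothCurrent (L.map w) η := by
  simp only [smoothCurrent, bastonTop_apply, List.map_map, Function.comp_def,
    hess_add_const (hw _)]

end SmoothProduct

/-! ### Coefficients of the limit currents -/

section Limit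

variable {n : ℕ} {Ω : Opens (HSpace n)}

lemma SmoothPsh.approx {w : HSpace n → ℝ} (hw : (quatForm n).SmoothPsh w) :
    (quatForm n).Approx Ω w fun _ => w where
  contDiff _ := hw.contDiff
  local_psh _ _ := ⟨Set.univ, univ_mem, 0, fun _ _ y _ => ⟨hw.mem_cone y, le_rfl⟩⟩
  tendsto _ _ := tendsto_const_nhds
  bdd_below x _ := by
    refine ⟨_, hw.contDiff.continuous.continuousAt.eventually_const_lt
      (sub_one_lt (w x)), -(w x - 1), fun y hy => ?_⟩
    rw [neg_neg]
    exact le_of_lt hy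

lemma approx_family {vs : List (HSpace n → ℝ)} {ws : List (ℕ → HSpace n → ℝ)}
    (h : List.Forall₂ ((quatForm n).Approx Ω) vs ws) (hl : vs.length = n) (t : Fin n) :
    (quatForm n).Approx Ω (family n vs t) fun j => family n (ws.map fun w => w j) t := by
  have h1 : (t : ℕ) < vs.length := by rw [hl]; exact t.2
  have h2 : (t : ℕ) < ws.length := by rw [← h.length_eq]; exact h1
  have h3 := h.get h1 h2
  simpa [family, h1, h2] using h3

lemma forall₂_append_quad {vs : List (HSpace n → ℝ)} {ws : List (ℕ → HSpace n → ℝ)}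
    (h : List.Forall₂ ((quatForm n).Approx Ω) vs ws)
    {C : List (Matrix (Fin n × Fin 4) (Fin n × Fin 4) ℝ)} (hC : ∀ A ∈ C, A.PosSemidef) :
    List.Forall₂ ((quatForm n).Approx Ω) (vs ++ C.map quad) (ws ++ C.map fun A _ => quad A) := by
  refine List.rel_append h ?_
  rw [List.forall₂_map_left_iff, List.forall₂_map_right_iff, List.forall₂_same]
  exact fun A hA => SmoothPsh.approx (MixedForm.smoothPsh_quad (hC A hA))

lemma IsLimitMeasure.congr_approx {ι σ : Type*} [Fintype ι] [DecidableEq ι] [Fintype σ]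
    [DecidableEq σ] {𝓜 : MixedForm ι σ} {Ω : Set (EuclideanSpace ℝ ι)} (hΩ : IsOpen Ω)
    {v : σ → EuclideanSpace ℝ ι → ℝ} {w w' : σ → ℕ → EuclideanSpace ℝ ι → ℝ}
    (hw : ∀ t, 𝓜.Approx Ω (v t) (w t)) (hw' : ∀ t, 𝓜.Approx Ω (v t) (w' t))
    {μ : Measure (EuclideanSpace ℝ ι)} (hμ : 𝓜.IsLimitMeasure Ω w μ) :
    𝓜.IsLimitMeasure Ω w' μ :=
  ⟨hμ.lt_top, fun f hf hc hfΩ =>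
    MixedForm.Approx.tendsto_of_tendsto hΩ hw hw' hf hc hfΩ (hμ.tendsto f hf hc hfΩ)⟩

lemma Approx.abs_le_on_compact {v : HSpace n → ℝ} {w : ℕ → HSpace n → ℝ}
    (hw : (quatForm n).Approx Ω v w) {K : Set (HSpace n)} (hK : IsCompact K) (hKΩ : K ⊆ Ω) :
    ∃ J, ∃ M : ℝ, (∀ j ≥ J, ∀ y ∈ K, |w j y| ≤ M) ∧ ∀ y ∈ K, |v y| ≤ M := by
  obtain ⟨J, M, hM⟩ := hw.bound_on_compact hK hKΩ
  refine ⟨J, M, hM, fun y hy => le_of_tendsto (hw.tendsto y (hKΩ hy)).abs ?_⟩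
  filter_upwards [eventually_ge_atTop J] with j hj using hM j hj y hy

lemma Approx.locallyIntegrableOn {v : HSpace n → ℝ} {w : ℕ → HSpace n → ℝ}
    (hw : (quatForm n).Approx Ω v w) {μ : Measure (HSpace n)}
    (hμ : ∀ K, IsCompact K → K ⊆ (Ω : Set (HSpace n)) → μ K < ⊤) :
    LocallyIntegrableOn (fun x => (v x : ℂ)) Ω (μ.restrict Ω) := by
  intro x hx
  obtain ⟨K, hK, hxK, hKΩ⟩ := exists_compact_subset Ω.isOpen hx
  obtain ⟨-, M, -, hM⟩ := Approx.abs_le_on_compact hw hK hKΩ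
  refine ⟨K, mem_nhdsWithin_of_mem_nhds (mem_interior_iff_mem_nhds.1 hxK), ?_⟩
  rw [IntegrableOn, Measure.restrict_restrict hK.measurableSet, Set.inter_eq_left.2 hKΩ]
  have : IsFiniteMeasure (μ.restrict K) := ⟨by simpa using hμ K hK hKΩ⟩
  refine Integrable.of_bound (C := M) ?_ ?_
  · exact Complex.continuous_ofReal.comp_aestronglyMeasurable
      (hw.aestronglyMeasurable hK.measurableSet hKΩ)
  · filter_upwards [ae_restrict_mem hK.measurableSet] with y hy
    simpa using hM y hy

lemma integrable_mul_of_locallyIntegrableOn {g f : HSpace n → ℂ} {μ : Measure (HSpace n)}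
    (hg : LocallyIntegrableOn g Ω (μ.restrict Ω)) (hf : Continuous f) (hc : HasCompactSupport f)
    (hfΩ : tsupport f ⊆ Ω) : Integrable (fun x => g x * f x) (μ.restrict Ω) := by
  have h1 : IntegrableOn g (tsupport f) (μ.restrict Ω) :=
    hg.integrableOn_compact_subset hfΩ hc
  have h2 : IntegrableOn (fun x => g x * f x) (tsupport f) (μ.restrict Ω) :=
    h1.mul_continuousOn hf.continuousOn hc
  refine (integrableOn_iff_integrable_of_support_subset fun x hx => ?_).1 h2
  exact subset_tsupport f (right_ne_zero_of_mul hx)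

lemma IsLimitMeasure.tendsto_mul_complex {v : Fin n → HSpace n → ℝ}
    {w : Fin n → ℕ → HSpace n → ℝ} (hw : ∀ t, (quatForm n).Approx Ω (v t) (w t))
    {v₀ : HSpace n → ℝ} {w₀ : ℕ → HSpace n → ℝ} (hw₀ : (quatForm n).Approx Ω v₀ w₀)
    {μ : Measure (HSpace n)} (hμ : (quatForm n).IsLimitMeasure Ω w μ) {f : HSpace n → ℂ}
    (hf : Continuous f) (hc : HasCompactSupport f) (hfΩ : tsupport f ⊆ Ω) :
    Tendsto (fun j => ∫ x, f x * ((w₀ j x : ℂ) * ((quatForm n).ma (fun t => w t j) x : ℝ))) atTop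
      (𝓝 (∫ x in (Ω : Set (HSpace n)), (v₀ x : ℂ) * f x ∂μ)) := by
  have hre := hμ.tendsto_mul Ω.isOpen hw hw₀ (Complex.continuous_re.comp hf)
    (hc.comp_left Complex.zero_re) ((tsupport_comp_subset Complex.zero_re f).trans hfΩ)
  have him := hμ.tendsto_mul Ω.isOpen hw hw₀ (Complex.continuous_im.comp hf)
    (hc.comp_left Complex.zero_im) ((tsupport_comp_subset Complex.zero_im f).trans hfΩ)
  have key : ∀ (ν : Measure (HSpace n)) (F : HSpace n → ℂ), Integrable F ν →
      ∫ x, F x ∂ν = ((∫ x, (F x).re ∂ν : ℝ) : ℂ) + ((∫ x, (F x).im ∂ν : ℝ) : ℂ) * Complex.I :=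
    fun ν F hF => (integral_re_add_im hF).symm
  have hl := (((Complex.continuous_ofReal.tendsto _).comp hre).add
    (((Complex.continuous_ofReal.tendsto _).comp him).mul_const Complex.I))
  rw [key _ _ (integrable_mul_of_locallyIntegrableOn (Approx.locallyIntegrableOn hw₀ hμ.lt_top)
    hf hc hfΩ)]
  have e : ∀ x, ((v₀ x : ℂ) * f x).re = (f x).re * v₀ x ∧
      ((v₀ x : ℂ) * f x).im = (f x).im * v₀ x := fun x => by simp [mul_comm]
  simp only [fun x => (e x).1, fun x => (e x).2]
  refine hl.congr fun j => ?_
  have hma := ((quatForm n).ma_contDiff fun t => (hw t).contDiff j).continuous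
  rw [key volume (fun x => f x * ((w₀ j x : ℂ) * ((quatForm n).ma (fun t => w t j) x : ℝ)))]
  · have e' : ∀ x, (f x * ((w₀ j x : ℂ) * ((quatForm n).ma (fun t => w t j) x : ℝ))).re =
        (f x).re * (w₀ j x * (quatForm n).ma (fun t => w t j) x) ∧
        (f x * ((w₀ j x : ℂ) * ((quatForm n).ma (fun t => w t j) x : ℝ))).im =
        (f x).im * (w₀ j x * (quatForm n).ma (fun t => w t j) x) := fun x => by
      rw [← Complex.ofReal_mul, Complex.re_mul_ofReal, Complex.im_mul_ofReal]
      exact ⟨rfl, rfl⟩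
    simp only [fun x => (e' x).1, fun x => (e' x).2]
    rfl
  · refine Continuous.integrable_of_hasCompactSupport ?_ hc.mul_right
    exact hf.mul ((Complex.continuous_ofReal.comp (hw₀.contDiff j).continuous).mul
      (Complex.continuous_ofReal.comp hma))

/-- The linear combination of positive Radon measures with complex coefficients. -/
lemma exists_complexRadonMeasure {N : ℕ} (c : Fin N → ℂ) {ν : Fin N → Measure (HSpace n)}
    (hν : ∀ s K, IsCompact K → K ⊆ (Ω : Set (HSpace n)) → ν s K < ⊤) :
    ∃ μ : ComplexRadonMeasure Ω, ∀ f : HSpace n → ℂ,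
      (∀ s, Integrable f ((ν s).restrict Ω)) →
      μ.integral f = ∑ s, c s * ∫ x in (Ω : Set (HSpace n)), f x ∂(ν s) := by
  -- `ENNReal.ofReal` keeps the positive parts of `±Re c` and `±Im c`; the weights `1, i, -1, -i` in
  -- the integral put `c` together again.
  set a : Fin 4 → Fin N → ℝ := fun m s =>
    ![(c s).re, (c s).im, -(c s).re, -(c s).im] m with ha
  refine ⟨⟨fun m => ∑ s, ENNReal.ofReal (a m s) • ν s, fun m K hK hKΩ => ?_⟩, fun f hf => ?_⟩
  · rw [Measure.finsetSum_apply]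
    refine ENNReal.sum_lt_top.2 fun s _ => ?_
    rw [Measure.smul_apply, smul_eq_mul]
    exact ENNReal.mul_lt_top ENNReal.ofReal_lt_top (hν s K hK hKΩ)
  · have h1 : ∀ m, ∫ x in (Ω : Set (HSpace n)), f x ∂(∑ s, ENNReal.ofReal (a m s) • ν s) =
        ∑ s, ((max (a m s) 0 : ℝ) : ℂ) * ∫ x in (Ω : Set (HSpace n)), f x ∂(ν s) := by
      intro m
      have h2 : (∑ s, ENNReal.ofReal (a m s) • ν s).restrict Ω =
          ∑ s, ENNReal.ofReal (a m s) • (ν s).restrict Ω := by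
        simp only [← Measure.restrictₗ_apply, map_sum, map_smul]
      rw [h2, integral_finsetSum_measure fun s _ => (hf s).smul_measure ENNReal.ofReal_ne_top]
      refine Finset.sum_congr rfl fun s _ => ?_
      rw [integral_smul_measure, ENNReal.toReal_ofReal', Complex.real_smul]
    simp only [ComplexRadonMeasure.integral, h1, Finset.mul_sum]
    rw [Finset.sum_comm]
    refine Finset.sum_congr rfl fun s _ => ?_
    simp only [← mul_assoc, ← Finset.sum_mul]
    congr 1
    have hp : ∀ r : ℝ, max r 0 - max (-r) 0 = r := fun r => by
      rcases le_total r 0 with h | h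
      · rw [max_eq_right h, max_eq_left (by linarith)]; ring
      · rw [max_eq_left h, max_eq_right (by linarith)]; ring
    have h3 : Complex.I ^ 3 = -Complex.I := Complex.I_pow_three
    rw [Fin.sum_univ_four]
    simp only [ha, Matrix.cons_val_zero, Matrix.cons_val_one, Matrix.cons_val, Fin.val_zero,
      Fin.val_one, Fin.val_two, pow_zero, pow_one, Complex.I_sq]
    rw [show ((3 : Fin 4) : ℕ) = 3 from rfl, h3]
    apply Complex.ext
    · have := hp (c s).re
      simp
      linarith
    · have := hp (c s).im
      simp
      linarith

/-- The coefficients of the current `△v₁ ∧ ⋯ ∧ △v_k`, as limits of those of smooth currents. -/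
lemma exists_coefficient {vs : List (HSpace n → ℝ)} {ws₀ : List (ℕ → HSpace n → ℝ)}
    (hws₀ : List.Forall₂ ((quatForm n).Approx Ω) vs ws₀) {I : Finset (Fin (2 * n))}
    (hI : I.card + 2 * vs.length = 2 * n) :
    ∃ μ : ComplexRadonMeasure Ω, ∀ ws, List.Forall₂ ((quatForm n).Approx Ω) vs ws →
      ∀ v₀ w₀, (quatForm n).Approx Ω v₀ w₀ → ∀ f : HSpace n → ℂ, Continuous f →
      HasCompactSupport f → tsupport f ⊆ (Ω : Set (HSpace n)) →
      Tendsto (fun j => ∫ x, f x * ((w₀ j x : ℂ) * bastonTop (ws.map fun w => w j) x (omega I)))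
        atTop (𝓝 (μ.integral fun x => (v₀ x : ℂ) * f x)) := by
  obtain ⟨N, c, C, hC, hden⟩ := exists_bastonTop_eq hI
  have hfam : ∀ s ws, List.Forall₂ ((quatForm n).Approx Ω) vs ws → ∀ t,
      (quatForm n).Approx Ω (family n (vs ++ (C s).map quad) t)
        fun j => family n (ws.map (fun w => w j) ++ (C s).map quad) t := fun s ws hws t => by
    have := approx_family (forall₂_append_quad hws (hC s).2) (by simpa using (hC s).1) t
    simpa [Function.comp_def] using this
  -- The measures are built from the single family `ws₀`; by `IsLimitMeasure.congr_approx` they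
  -- serve for every `ws`.
  choose ν hν using fun s => MixedForm.exists_isLimitMeasure Ω.isOpen (hfam s ws₀ hws₀)
  obtain ⟨μ, hμ⟩ := exists_complexRadonMeasure (Ω := Ω) c fun s => (hν s).lt_top
  refine ⟨μ, fun ws hws v₀ w₀ hw₀ f hf hc hfΩ => ?_⟩
  rw [hμ _ fun s => integrable_mul_of_locallyIntegrableOn
    (Approx.locallyIntegrableOn hw₀ (hν s).lt_top) hf hc hfΩ]
  have hsm : ∀ j, ∀ w ∈ ws.map fun w => w j, ContDiff ℝ ∞ w := by
    intro j w hw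
    obtain ⟨w', hw', rfl⟩ := List.mem_map.1 hw
    obtain ⟨i, hi, rfl⟩ := List.mem_iff_getElem.1 hw'
    exact (hws.get (by rw [hws.length_eq]; exact hi) hi).contDiff j
  have hlen : ∀ j, (ws.map fun w => w j).length = vs.length := fun j => by
    rw [List.length_map, hws.length_eq]
  have hlim := tendsto_finsetSum Finset.univ fun s _ =>
    (IsLimitMeasure.tendsto_mul_complex (hfam s ws hws) hw₀ (IsLimitMeasure.congr_approx Ω.isOpen
      (hfam s ws₀ hws₀) (hfam s ws hws) (hν s)) hf hc hfΩ).const_mul (c s)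
  refine hlim.congr fun j => ?_
  simp only [← integral_const_mul]
  rw [← integral_finsetSum]
  · congr 1
    funext x
    rw [hden _ (hlen j) (hsm j), Finset.mul_sum, Finset.mul_sum]
    exact Finset.sum_congr rfl fun s _ => by ring
  · intro s _
    have hma := ((quatForm n).ma_contDiff fun t => (hfam s ws hws t).contDiff j).continuous
    refine Integrable.const_mul (Continuous.integrable_of_hasCompactSupport ?_ hc.mul_right) _
    exact hf.mul ((Complex.continuous_ofReal.comp (hw₀.contDiff j).continuous).mul
      (Complex.continuous_ofReal.comp hma))

end Limit

/-! ### Currents -/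

section Currents

variable {n q : ℕ} {Ω : Opens (HSpace n)}

lemma tsupport_coeff_subset (F : TestForm Ω q) (I : MultiIndex n q) :
    tsupport (fun x => F x I) ⊆ (Ω : Set (HSpace n)) :=
  (tsupport_comp_subset (g := fun G : Form n q => G I) rfl F).trans F.tsupport_subset

/-- The operators are defined as bare functions on test forms; their continuity is what makes `η ↦ R
(△η)` a current. -/
lemma exists_nablaCLM (j : Fin (2 * n)) (α : Fin 2) :
    ∃ B : TestForm Ω q →L[ℂ] TestForm Ω q, ∀ F, B F = nabla j α F := by
  have hp : ∀ l m, ∃ B : TestForm Ω q →L[ℂ] TestForm Ω q, ∀ F, B F = partialDeriv l m F :=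
    fun l m => ⟨TestFunction.lineDerivCLM ℂ (EuclideanSpace.single (l, m) (1 : ℝ)), fun F =>
      (TestFunction.lineDerivOp_eq_lineDerivCLM ℂ).symm⟩
  choose B hB using hp
  let J : TestForm Ω q →L[ℂ] TestForm Ω q :=
    TestFunction.postcompCLM (Complex.I • ContinuousLinearMap.id ℂ (Form n q))
  have hJ : ∀ F, J F = Complex.I • F := fun F => rfl
  set l : Fin n := ⟨j / 2, by omega⟩ with hl
  by_cases h1 : (j : ℕ) % 2 = 0 <;> by_cases h2 : α = 0
  · exact ⟨B l 0 + J.comp (B l 1), fun F => by simp [nabla, h1, h2, hB, hl, hJ]⟩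
  · exact ⟨-B l 2 - J.comp (B l 3), fun F => by simp [nabla, h1, h2, hB, hl, hJ]⟩
  · exact ⟨B l 2 - J.comp (B l 3), fun F => by simp [nabla, h1, h2, hB, hl, hJ]⟩
  · exact ⟨B l 0 - J.comp (B l 1), fun F => by simp [nabla, h1, h2, hB, hl, hJ]⟩

lemma exists_dOpCLM (Ω : Opens (HSpace n)) (q : ℕ) (α : Fin 2) :
    ∃ B : TestForm Ω q →L[ℂ] TestForm Ω (q + 1), ∀ F, B F = dOp α F := by
  choose B hB using fun j => exists_nablaCLM (Ω := Ω) (q := q) j α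
  refine ⟨∑ j, (TestFunction.postcompCLM (omegaWedge q j)).comp (B j), fun F => ?_⟩
  rw [_root_.sum_apply, dOp]
  simp only [ContinuousLinearMap.comp_apply, hB]

lemma exists_bastonCLM (Ω : Opens (HSpace n)) (q : ℕ) :
    ∃ B : TestForm Ω q →L[ℂ] TestForm Ω (q + 2), ∀ F, B F = baston F := by
  obtain ⟨B, hB⟩ := exists_dOpCLM Ω q 1
  obtain ⟨B', hB'⟩ := exists_dOpCLM Ω (q + 1) 0
  exact ⟨B'.comp B, fun F => by rw [ContinuousLinearMap.comp_apply, hB, hB', baston]⟩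

lemma exists_dualForm (μ : MultiIndex n q → ComplexRadonMeasure Ω) {v : HSpace n → ℝ}
    {w : ℕ → HSpace n → ℝ} (hw : (quatForm n).Approx Ω v w) :
    ∃ R : DualForm Ω q, ∀ φ, R φ = ∑ I, (μ I).integral fun x => (v x : ℂ) * φ x I := by
  let B : MultiIndex n q → Form n q →L[ℂ] ℂ →L[ℂ] ℂ := fun I =>
    (ContinuousLinearMap.mul ℂ ℂ).comp
      (ContinuousLinearMap.proj (R := ℂ) (φ := fun _ : MultiIndex n q => ℂ) I)
  refine ⟨∑ I, ∑ m : Fin 4, Complex.I ^ (m : ℕ) • TestFunction.integralAgainstBilinCLM (B I)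
    (((μ I).part m).restrict Ω) fun x => (v x : ℂ), fun φ => ?_⟩
  simp only [_root_.sum_apply, _root_.smul_apply,
    ComplexRadonMeasure.integral, smul_eq_mul]
  refine Finset.sum_congr rfl fun I _ => Finset.sum_congr rfl fun m _ => ?_
  rw [TestFunction.integralAgainstBilinCLM_eq_integral
    (Approx.locallyIntegrableOn hw ((μ I).finite_on_compacts m))]
  congr 2
  funext x
  simp [B, mul_comm]

/-- The product of a test form and a smooth function. -/
def mulForm {w : HSpace n → ℝ} (hw : ContDiff ℝ ∞ w) (φ : TestForm Ω q) : TestForm Ω q where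
  toFun x := w x • φ x
  contDiff' := hw.smul φ.contDiff
  hasCompactSupport' := φ.hasCompactSupport.mono fun x hx h => hx (by simp [h])
  tsupport_subset' := by
    refine Set.Subset.trans (closure_mono fun x hx => ?_) φ.tsupport_subset
    exact right_ne_zero_of_smul (a := w x) hx

lemma mulForm_apply {w : HSpace n → ℝ} (hw : ContDiff ℝ ∞ w) (φ : TestForm Ω q) (x : HSpace n)
    (I : MultiIndex n q) : mulForm hw φ x I = (w x : ℂ) * φ x I := by
  change (w x • φ x) I = _
  rw [Pi.smul_apply, Complex.real_smul]

/-- The current `vT` is determined by `T`, whatever measures represent the coefficients of `T`. -/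
lemma HasCoefficients.tendsto_mulForm {T : DualForm Ω q}
    {μ : MultiIndex n q → ComplexRadonMeasure Ω} (hT : HasCoefficients T μ) {v : HSpace n → ℝ}
    {w : ℕ → HSpace n → ℝ} (hw : (quatForm n).Approx Ω v w) (φ : TestForm Ω q) :
    Tendsto (fun j => T (mulForm (hw.contDiff j) φ)) atTop
      (𝓝 (∑ I, (μ I).integral fun x => (v x : ℂ) * φ x I)) := by
  simp only [hT _, mulForm_apply, ComplexRadonMeasure.integral]
  refine tendsto_finsetSum _ fun I _ => tendsto_finsetSum _ fun m _ => Tendsto.const_mul _ ?_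
  have hfc := (contDiff_coeff φ I).continuous
  obtain ⟨J, M, hM, -⟩ := Approx.abs_le_on_compact hw (hasCompactSupport_coeff φ I)
    (tsupport_coeff_subset φ I)
  have h1 : LocallyIntegrableOn (fun _ : HSpace n => (M : ℂ)) Ω (((μ I).part m).restrict Ω) := by
    have : (quatForm n).SmoothPsh fun _ : HSpace n => M :=
      ⟨contDiff_const, fun x => by
        rw [hess_const]; exact (quatForm n).psd_mem _ Matrix.PosSemidef.zero⟩
    exact Approx.locallyIntegrableOn (SmoothPsh.approx this) ((μ I).finite_on_compacts m)
  have hintg := integrable_mul_of_locallyIntegrableOn h1 hfc (hasCompactSupport_coeff φ I)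
    (tsupport_coeff_subset φ I)
  refine tendsto_integral_filter_of_dominated_convergence _ ?_ ?_ hintg.norm ?_
  · exact Eventually.of_forall fun j => ((Complex.continuous_ofReal.comp
      (hw.contDiff j).continuous).mul hfc).aestronglyMeasurable
  · filter_upwards [eventually_ge_atTop J] with j hj
    refine Eventually.of_forall fun x => ?_
    rw [norm_mul, norm_mul]
    by_cases hx : x ∈ tsupport fun x => φ x I
    · refine mul_le_mul_of_nonneg_right ?_ (norm_nonneg _)
      rw [Complex.norm_real, Complex.norm_real]
      exact (hM j hj x hx).trans (le_abs_self M)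
    · rw [image_eq_zero_of_notMem_tsupport (f := fun x => φ x I) hx]
      simp
  · filter_upwards [ae_restrict_mem Ω.isOpen.measurableSet] with x hx
    exact ((Complex.continuous_ofReal.tendsto _).comp (hw.tendsto x hx)).mul_const _

/-- `T` is the limit of `△w_j¹ ∧ ⋯ ∧ △w_jᵏ` for all families of smooth approximations. -/
def IsLimitCurrent (Ω : Opens (HSpace n)) (vs : List (HSpace n → ℝ)) (T : DualForm Ω q) : Prop :=
  ∀ ws, List.Forall₂ ((quatForm n).Approx Ω) vs ws → ∀ η : TestForm Ω q,
    Tendsto (fun j => smoothCurrent (ws.map fun w => w j) η) atTop (𝓝 (T η))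

lemma contDiff_of_forall₂ {vs : List (HSpace n → ℝ)} {ws : List (ℕ → HSpace n → ℝ)}
    (hws : List.Forall₂ ((quatForm n).Approx Ω) vs ws) (j : ℕ) :
    ∀ w ∈ ws.map fun w => w j, ContDiff ℝ ∞ w := by
  intro w hw
  obtain ⟨w', hw', rfl⟩ := List.mem_map.1 hw
  obtain ⟨i, hi, rfl⟩ := List.mem_iff_getElem.1 hw'
  exact (hws.get (by rw [hws.length_eq]; exact hi) hi).contDiff j

lemma approx_one : (quatForm n).Approx Ω (fun _ => 1) fun _ _ => 1 :=
  SmoothPsh.approx ⟨contDiff_const, fun x => by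
    rw [hess_const]; exact (quatForm n).psd_mem _ Matrix.PosSemidef.zero⟩

/-- Measure coefficients of the limit currents of smooth approximations. -/
lemma exists_coefficients {vs : List (HSpace n → ℝ)} {ws₀ : List (ℕ → HSpace n → ℝ)}
    (hws₀ : List.Forall₂ ((quatForm n).Approx Ω) vs ws₀) (hq : q + 2 * vs.length = 2 * n) :
    ∃ μ : MultiIndex n q → ComplexRadonMeasure Ω,
      ∀ ws, List.Forall₂ ((quatForm n).Approx Ω) vs ws →
      ∀ v₀ w₀, (quatForm n).Approx Ω v₀ w₀ → ∀ φ : TestForm Ω q,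
      Tendsto (fun j => ∫ x, (w₀ j x : ℂ) * bastonTop (ws.map fun w => w j) x (toExt n q (φ x)))
        atTop (𝓝 (∑ I, (μ I).integral fun x => (v₀ x : ℂ) * φ x I)) := by
  choose μ hμ using fun I : MultiIndex n q => exists_coefficient hws₀ (I := I.1) (by rw [I.2, hq])
  refine ⟨μ, fun ws hws v₀ w₀ hw₀ φ => ?_⟩
  refine (tendsto_finsetSum _ fun I _ => hμ I ws hws v₀ w₀ hw₀ _ (contDiff_coeff φ I).continuous
    (hasCompactSupport_coeff φ I) (tsupport_coeff_subset φ I)).congr fun j => ?_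
  rw [smoothCurrent_eq_sum (by rw [List.length_map, ← hws.length_eq, hq])
    (contDiff_of_forall₂ hws j) (hw₀.contDiff j).continuous]

/-- The constant sequence `w₀ = 1` identifies the functional given by the limiting measures with
`T`. -/
lemma IsLimitCurrent.exists_hasCoefficients {vs : List (HSpace n → ℝ)}
    {ws₀ : List (ℕ → HSpace n → ℝ)} (hws₀ : List.Forall₂ ((quatForm n).Approx Ω) vs ws₀)
    (hq : q + 2 * vs.length = 2 * n) {T : DualForm Ω q} (hT : IsLimitCurrent Ω vs T) :
    ∃ μ, HasCoefficients T μ ∧ ∀ ws, List.Forall₂ ((quatForm n).Approx Ω) vs ws →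
      ∀ v₀ w₀, (quatForm n).Approx Ω v₀ w₀ → ∀ φ : TestForm Ω q,
      Tendsto (fun j => ∫ x, (w₀ j x : ℂ) * bastonTop (ws.map fun w => w j) x (toExt n q (φ x)))
        atTop (𝓝 (∑ I, (μ I).integral fun x => (v₀ x : ℂ) * φ x I)) := by
  obtain ⟨μ, hμ⟩ := exists_coefficients (q := q) hws₀ hq
  refine ⟨μ, fun φ => tendsto_nhds_unique (hT ws₀ hws₀ φ) ?_, hμ⟩
  have := hμ ws₀ hws₀ _ _ approx_one φ
  simpa [smoothCurrent] using this

lemma smoothCurrent_nil (η : TestForm Ω q) :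
    smoothCurrent [] η = ∫ x in (Ω : Set (HSpace n)),
      ∑ I : MultiIndex n q, if I.1 = Finset.univ then η x I else 0 := by
  have h : ∀ x, bastonTop [] x (toExt n q (η x)) =
      ∑ I : MultiIndex n q, if I.1 = Finset.univ then η x I else 0 := by
    intro x
    rw [bastonTop_apply, toExt_eq_sum]
    simp only [List.map_nil, List.prod_nil, Module.End.one_apply, Finset.sum_apply, Pi.smul_apply,
      omega, Pi.single_apply, smul_eq_mul, mul_ite, mul_one, mul_zero]
    exact Finset.sum_congr rfl fun I _ => by simp only [eq_comm]
  rw [smoothCurrent]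
  simp only [h]
  refine (setIntegral_eq_integral_of_forall_compl_eq_zero fun x hx => ?_).symm
  refine Finset.sum_eq_zero fun I _ => ?_
  have : η x = 0 := image_eq_zero_of_notMem_tsupport fun hx' => hx (η.tsupport_subset hx')
  rw [this]
  simp

/-- `u` is plurisubharmonic and locally bounded below on `Ω`. -/
structure BddPSH (Ω : Opens (HSpace n)) (u : HSpace n → EReal) : Prop where
  psh : PSH Ω u
  bdd : ∀ x ∈ Ω, ∃ C : ℝ, ∀ᶠ y in 𝓝 x, ((-C : ℝ) : EReal) ≤ u y

lemma exists_forall₂_approx {us : List (HSpace n → EReal)} (hus : ∀ u ∈ us, BddPSH Ω u) :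
    ∃ ws, List.Forall₂ ((quatForm n).Approx Ω) (us.map fun u x => (u x).toReal) ws := by
  induction us with
  | nil => exact ⟨[], List.Forall₂.nil⟩
  | cons u us ih =>
    obtain ⟨ws, hws⟩ := ih fun u hu => hus u (List.mem_cons_of_mem _ hu)
    obtain ⟨w, hw⟩ := (hus u List.mem_cons_self).psh.exists_approx (hus u List.mem_cons_self).bdd
    exact ⟨w :: ws, List.Forall₂.cons hw hws⟩

/-- Induction on the number of factors. The measures chosen in the definition of `u T` may differ
from those obtained as limits, but on a test form `φ` both give the limit of `T` applied to `φ`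
times an approximation of `u`. With the limiting measures, `R(△η)` is a limit of smooth integrals,
which integration by parts turns into smooth currents with one more factor. -/
lemma IsBastonProduct.isLimitCurrent {us : List (HSpace n → EReal)} (hus : ∀ u ∈ us, BddPSH Ω u) :
    ∀ {q : ℕ}, q + 2 * us.length = 2 * n → ∀ {P : DualForm Ω q}, IsBastonProduct Ω us q P →
      IsLimitCurrent Ω (us.map fun u x => (u x).toReal) P := by
  induction us with
  | nil =>
    intro q hq P hP ws hws η
    obtain rfl := List.forall₂_nil_left_iff.1 hws
    rw [hP η, ← smoothCurrent_nil]
    exact tendsto_const_nhds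
  | cons u us ih =>
    rintro q hq P ⟨T, R, hT, ⟨μ, hTμ, hR⟩, hP⟩ ws hws η
    have hus' : ∀ u ∈ us, BddPSH Ω u := fun u hu => hus u (List.mem_cons_of_mem _ hu)
    rw [List.length_cons] at hq
    have hlim := ih hus' (q := q + 2) (by omega) hT
    obtain ⟨w₀, ws', hw₀, hws', rfl⟩ := List.forall₂_cons_left_iff.1 hws
    obtain ⟨μ', hTμ', hμ'⟩ := hlim.exists_hasCoefficients hws'
      (by rw [List.length_map]; omega)
    have hRη : R (baston η) = ∑ I, (μ' I).integral fun x => ((u x).toReal : ℂ) * baston η x I := by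
      rw [hR]
      exact tendsto_nhds_unique (hTμ.tendsto_mulForm hw₀ _) (hTμ'.tendsto_mulForm hw₀ _)
    rw [hP, hRη]
    refine (hμ' ws' hws' _ w₀ hw₀ (baston η)).congr fun j => ?_
    exact integral_mul_bastonTop_baston (by
      rw [List.length_map, ← hws'.length_eq, List.length_map]; omega)
      (contDiff_of_forall₂ hws' j) (hw₀.contDiff j) η

/-- The product of the remaining factors is a limit current by `IsBastonProduct.isLimitCurrent` and
so has measure coefficients. These are multiplied by the first factor, and the result is composed
with `△`. -/
lemma exists_isBastonProduct {us : List (HSpace n → EReal)} (hus : ∀ u ∈ us, BddPSH Ω u) :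
    ∀ {q : ℕ}, q + 2 * us.length = 2 * n → ∃ P : DualForm Ω q, IsBastonProduct Ω us q P := by
  induction us with
  | nil =>
    intro q hq
    obtain ⟨μ, hμ⟩ := exists_coefficients (Ω := Ω) (q := q) (vs := []) List.Forall₂.nil hq
    obtain ⟨P, hP⟩ := exists_dualForm μ (approx_one (Ω := Ω))
    refine ⟨P, fun η => ?_⟩
    rw [← smoothCurrent_nil, hP]
    have := hμ [] List.Forall₂.nil _ _ approx_one η
    simp only [List.map_nil, Complex.ofReal_one, one_mul, tendsto_const_nhds_iff] at this
    simp only [Complex.ofReal_one, one_mul, smoothCurrent, this]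
  | cons u us ih =>
    intro q hq
    have hus' : ∀ u ∈ us, BddPSH Ω u := fun u hu => hus u (List.mem_cons_of_mem _ hu)
    rw [List.length_cons] at hq
    obtain ⟨T, hT⟩ := ih hus' (q := q + 2) (by omega)
    have hlim := hT.isLimitCurrent hus' (by omega)
    obtain ⟨ws, hws⟩ := exists_forall₂_approx hus'
    obtain ⟨μ, hTμ, -⟩ := hlim.exists_hasCoefficients hws (by rw [List.length_map]; omega)
    obtain ⟨w, hw⟩ := (hus u List.mem_cons_self).psh.exists_approx (hus u List.mem_cons_self).bdd
    obtain ⟨R, hR⟩ := exists_dualForm μ hw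
    obtain ⟨B, hB⟩ := exists_bastonCLM Ω q
    exact ⟨R.comp B, T, R, hT, ⟨μ, hTμ, hR⟩, fun η => by
      rw [ContinuousLinearMap.comp_apply, hB]⟩

/-- For uniqueness: two products are limits of the same sequence of smooth currents. -/
lemma existsUnique_isBastonProduct {us : List (HSpace n → EReal)} (hus : ∀ u ∈ us, BddPSH Ω u)
    (hq : q + 2 * us.length = 2 * n) : ∃! P : DualForm Ω q, IsBastonProduct Ω us q P := by
  obtain ⟨P, hP⟩ := exists_isBastonProduct hus hq
  obtain ⟨ws, hws⟩ := exists_forall₂_approx hus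
  refine ⟨P, hP, fun P' hP' => ContinuousLinearMap.ext fun η => ?_⟩
  exact tendsto_nhds_unique (hP'.isLimitCurrent hus hq ws hws η)
    (hP.isLimitCurrent hus hq ws hws η)

lemma BddPSH.of_le {u v : HSpace n → EReal} (hv : BddPSH Ω v) (hu : PSH Ω u)
    (h : ∀ x ∈ Ω, v x ≤ u x) : BddPSH Ω u :=
  ⟨hu, fun x hx => by
    obtain ⟨C, hC⟩ := hv.bdd x hx
    refine ⟨C, ?_⟩
    filter_upwards [hC, Ω.isOpen.mem_nhds hx] with y hy hyΩ using hy.trans (h y hyΩ)⟩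

/-- Convergence of `△v_j¹ ∧ ⋯ ∧ △v_jᵏ` for decreasing sequences of plurisubharmonic functions. -/
theorem tendsto_bastonProduct {k : ℕ} (hq : q + 2 * k = 2 * n) {v : Fin k → HSpace n → EReal}
    {vj : Fin k → ℕ → HSpace n → EReal} (hv : ∀ t, BddPSH Ω (v t))
    (hvj : ∀ t j, BddPSH Ω (vj t j)) (hdecr : ∀ t, ∀ x ∈ Ω, Antitone fun j => vj t j x)
    (hlim : ∀ t, ∀ x ∈ Ω, Tendsto (fun j => vj t j x) atTop (𝓝 (v t x)))
    {T : ℕ → DualForm Ω q} {S : DualForm Ω q}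
    (hT : ∀ j, IsBastonProduct Ω (List.ofFn fun t => vj t j) q (T j))
    (hS : IsBastonProduct Ω (List.ofFn v) q S) (η : TestForm Ω q) :
    Tendsto (fun j => T j η) atTop (𝓝 (S η)) := by
  obtain ⟨K, hK, hKm, hKΩ, hKn⟩ := exists_compact_exhaustion Ω.isOpen
  choose w hw using fun t j => (hvj t j).psh.exists_approx (hvj t j).bdd
  obtain ⟨w', hw'⟩ : ∃ w' : Fin k → ℕ → HSpace n → ℝ,
      ∀ t, (quatForm n).Approx Ω (fun x => (v t x).toReal) (w' t) :=
    ⟨_, fun t => ((hv t).psh.exists_approx (hv t).bdd).choose_spec⟩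
  have hforall : ∀ (a : Fin k → HSpace n → EReal) (b : Fin k → ℕ → HSpace n → ℝ),
      (∀ t, (quatForm n).Approx Ω (fun x => (a t x).toReal) (b t)) →
      List.Forall₂ ((quatForm n).Approx Ω) ((List.ofFn a).map fun u x => (u x).toReal)
        (List.ofFn b) := fun a b h => by
    rw [List.map_ofFn, List.forall₂_iff_get]
    exact ⟨by simp, fun i h1 h2 => by simpa using h _⟩
  have hTlim : ∀ m, Tendsto (fun i => smoothCurrent (List.ofFn fun t => w t m i) η) atTop
      (𝓝 (T m η)) := fun m => by
    have := (hT m).isLimitCurrent (fun u hu => by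
      obtain ⟨t, rfl⟩ := List.mem_ofFn.1 hu
      exact hvj t m) (by simpa using hq) _ (hforall _ _ fun t => hw t m) η
    simpa [List.map_ofFn, Function.comp_def] using this
  -- The side condition of the diagonal choice keeps the smooth current of the `m`-th diagonal
  -- member within `1 / (m + 1)` of `T m`. The diagonal sequence approximates `v`, so its currents
  -- tend to `S`, and hence so does `T m`.
  have hQ : ∀ m : ℕ, ∀ᶠ i in atTop,
      dist (smoothCurrent (List.ofFn fun t => w t m i) η) (T m η) < 1 / ((m : ℝ) + 1) := fun m =>
    (Metric.tendsto_nhds.1 (hTlim m)) _ (by positivity)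
  have hanti : ∀ t m, ∀ x ∈ (Ω : Set (HSpace n)), (vj t (m + 1) x).toReal ≤ (vj t m x).toReal := by
    intro t m x hx
    have h1 := (hvj t (m + 1)).psh.coe_toReal (hvj t (m + 1)).bdd hx
    have h2 := (hvj t m).psh.coe_toReal (hvj t m).bdd hx
    have h3 := hdecr t x hx (Nat.le_succ m)
    rw [← EReal.coe_le_coe_iff, h1, h2]
    exact h3
  have hconv : ∀ t, ∀ x ∈ (Ω : Set (HSpace n)),
      Tendsto (fun m => (vj t m x).toReal) atTop (𝓝 (v t x).toReal) := by
    intro t x hx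
    have h1 : ∀ m, ((vj t m x).toReal : EReal) = vj t m x := fun m =>
      (hvj t m).psh.coe_toReal (hvj t m).bdd hx
    have h2 := (hv t).psh.coe_toReal (hv t).bdd hx
    have h3 := hlim t x hx
    rw [← EReal.tendsto_coe, h2]
    exact h3.congr fun m => (h1 m).symm
  obtain ⟨i, hi, happ⟩ := MixedForm.exists_diagonal (𝓜 := quatForm n)
    (v := fun t m x => (vj t m x).toReal) (vl := fun t x => (v t x).toReal) (w := w)
    hK hKm hKΩ hKn hanti hconv (fun t => (hw' t).bdd_below)
    (fun t m => (hw t m).majorant (hK m) (hKΩ m)) hQ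
  have hSlim := hS.isLimitCurrent (fun u hu => by
    obtain ⟨t, rfl⟩ := List.mem_ofFn.1 hu
    exact hv t) (by simpa using hq) _ (hforall _ _ happ) η
  have hSlim' : Tendsto (fun m => smoothCurrent (List.ofFn fun t => w t m (i m)) η) atTop
      (𝓝 (S η)) := by
    refine hSlim.congr fun m => ?_
    have := smoothCurrent_add_const (fun t => (hw t m).contDiff (i m)) (fun _ => (1 / 2) ^ m)
      (List.finRange k) η
    simpa [List.map_ofFn, Function.comp_def, List.ofFn_eq_map] using this
  refine hSlim'.congr_dist ?_
  exact squeeze_zero (fun _ => dist_nonneg) (fun m => (hi m).le)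
    tendsto_one_div_add_atTop_nhds_zero_nat

end Currents

end QuatPluripotential

end

/-! ### The convergence theorem -/

theorem theorem3p2 {n k : ℕ} (hk : k ≤ n)
    (Ω : TopologicalSpace.Opens (QuatPluripotential.HSpace n))
    (v : Fin k → QuatPluripotential.HSpace n → EReal)
    (vj : Fin k → ℕ → QuatPluripotential.HSpace n → EReal)
    (hv : ∀ t, QuatPluripotential.PSH Ω (v t))
    (hv_bdd : ∀ t, QuatPluripotential.LocallyBounded Ω (v t))
    (hvj : ∀ t j, QuatPluripotential.PSH Ω (vj t j))
    (hdecr : ∀ t, ∀ x ∈ Ω, Antitone fun j => vj t j x)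
    (hlim : ∀ t, ∀ x ∈ Ω, Filter.Tendsto (fun j => vj t j x) Filter.atTop (nhds (v t x))) :
    -- the currents `△v_j¹ ∧ ⋯ ∧ △v_jᵏ` and `△v¹ ∧ ⋯ ∧ △vᵏ` are well defined
    (∀ j, ∃! T, QuatPluripotential.IsBastonProduct Ω
      (List.ofFn fun t => vj t j) (2 * n - 2 * k) T) ∧
    (∃! S, QuatPluripotential.IsBastonProduct Ω (List.ofFn v) (2 * n - 2 * k) S) ∧
    -- and the former converge weakly to the latter
    ∀ (T : ℕ → QuatPluripotential.DualForm Ω (2 * n - 2 * k))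
      (S : QuatPluripotential.DualForm Ω (2 * n - 2 * k)),
      (∀ j, QuatPluripotential.IsBastonProduct Ω
        (List.ofFn fun t => vj t j) (2 * n - 2 * k) (T j)) →
      QuatPluripotential.IsBastonProduct Ω (List.ofFn v) (2 * n - 2 * k) S →
      ∀ η : QuatPluripotential.TestForm Ω (2 * n - 2 * k),
        Filter.Tendsto (fun j => T j η) Filter.atTop (nhds (S η)) := by
  have hq : 2 * n - 2 * k + 2 * k = 2 * n := by omega
  have hb : ∀ t, QuatPluripotential.BddPSH Ω (v t) := fun t =>
    ⟨hv t, fun x hx => (hv t).eventually_le_of_locallyBounded (hv_bdd t) hx⟩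
  -- Local boundedness is assumed of the limits only; the members of a decreasing sequence lie above
  -- its limit and inherit the lower bound.
  have hbj : ∀ t j, QuatPluripotential.BddPSH Ω (vj t j) := fun t j =>
    (hb t).of_le (hvj t j) fun x hx => (hdecr t x hx).le_of_tendsto (hlim t x hx) j
  refine ⟨fun j => QuatPluripotential.existsUnique_isBastonProduct ?_ (by simpa using hq),
    QuatPluripotential.existsUnique_isBastonProduct ?_ (by simpa using hq), fun T S hT hS η =>
    QuatPluripotential.tendsto_bastonProduct hq hb hbj hdecr hlim hT hS η⟩
  · intro u hu
    obtain ⟨t, rfl⟩ := List.mem_ofFn.1 hu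
    exact hbj t j
  · intro u hu
    obtain ⟨t, rfl⟩ := List.mem_ofFn.1 hu
    exact hb t
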